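/- A finite set $S\subset\mathbb Z^2$ is digital convex if $S=\mathrm{conv}_{\mathbb R^2}(S)\cap\mathbb Z^2$. For $m\ge 1$ and $v=(v_0,\dots,v_{m-1})\in\mathbb Z^m$, the problem $DT_{\mathcal C}(v)$ asks whether there is a digital convex set $S\subset\{0,\dots,m-1\}\times\mathbb Z$ with exactly $v_i$ points in each column $x=i$. When $m\ge2$, $v_0\ne0$ and $v_{m-1}\neq 0$, let $T_m$ be the triangle with vertices $(0,0),(m-1,0),(m-1,m-1)$ and let $R_v$ be the set of the lattice points $(i,y)$, $0\le i\le m-1$, at vertical distance at most $v_i$ from $T_m$. Let $\Gamma(v)$ be the following directed graph. Its nodes are the pairs (quads) of non-vertical segments $(\underline s,\overline s)$ with end points in $R_v$ such that: the end points are in convex position, and a common end point of the two segments is the origin or has abscissa $m-1$; the interval $[a,b]$ of the common abscissas of the two segments is not empty; on $[a,b]$, $\overline s$ is above $\underline s$ (in the weak sense), and for every integer $i\in[a,b]$ the heights satisfy $\lfloor\overline y(i)\rfloor-\lceil\underline y(i)\rceil+1=v_i$. There is an edge from $(\underline s_1,\overline s_1)$ to $(\underline s_2,\overline s_2)$ if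 they have the same upper segment or the same lower segment, the right end point of the other segment of the first node is the left end point of the other segment of the second node, and this point is not in the convex hull of the other end points of the two nodes. $\mathrm{Left}$ is the set of the nodes such that the left end points of $\underline s$ and $\overline s$ are $(0,0)$ and $(0,v_0-1)$; $\mathrm{Right}$ is the set of the nodes such that the right end points of $\underline s$ and $\overline s$ are $(m-1,y)$ and $(m-1,y+v_{m-1}-1)$ for some $0\le y\le m-1$. The algorithm DAGTomo1 rejects $v$ if it has a negative entry, removes the null entries at both ends of $v$, accepts if at most one entry remains, and otherwise explores the nodes of $\Gamma$ of the trimmed vector that are reached from $\mathrm{Left}$, each one at most once, by trying all the points of the region as the new right end point of the lower or of the upper segment; it accepts if and only if a node of $\mathrm{Right}$ is reached. **Theorem.** (a) For every $m\ge 1$ and every $v\in\mathbb Z^m$, DAGTomo1, run as a program of a random access machine with integer registers and arrays, initially zero except for the input, and unit-cost operations, halts and decides $DT_{\mathcal C}(v)$. Its worst-case running time is $O\bigl(m^{11}+m(\sum_{i=0}^{m-1}\max(v_i,0))^5\bigr)$, where $\max(v_i,0)=v_i$ for all the vectors with nonnegative entries. (b) For every $m\ge2$ and every $v\in\mathbb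 Z^m$ with $v_0\neq0$ and $v_{m-1}\ne0$, $DT_{\mathcal C}(v)$ has a solution if and only if $\Gamma(v)$ has a (possibly trivial) path from $\mathrm{Left}$ to $\mathrm{Right}$. -/

import Mathlib

/-! ## Digital convex sets with a prescribed vertical X-ray -/

namespace XRay

/-- A lattice point, seen in the real plane. -/
def toPlane (p : ℤ × ℤ) : ℝ × ℝ := ((p.1 : ℝ), (p.2 : ℝ))

/-- A finite lattice set is digital convex if it contains exactly the lattice points of its
real convex hull. -/
def DigitalConvex (S : Finset (ℤ × ℤ)) : Prop :=
  ∀ p : ℤ × ℤ, p ∈ S ↔ toPlane p ∈ convexHull ℝ (toPlane '' (S : Set (ℤ × ℤ)))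

/-- `S` lies in the strip `[0 .. m-1] × ℤ` and has `v i` points in each column `i`. -/
def HasVerticalXRay {m : ℕ} (v : Fin m → ℤ) (S : Finset (ℤ × ℤ)) : Prop :=
  (∀ p ∈ S, 0 ≤ p.1 ∧ p.1 < (m : ℤ)) ∧
  ∀ i : Fin m, ((S.filter (fun p => p.1 = ((i : ℕ) : ℤ))).card : ℤ) = v i

/-- The decision problem: is there a digital convex lattice set with vertical X-ray `v`? -/
def DTC {m : ℕ} (v : Fin m → ℤ) : Prop :=
  ∃ S : Finset (ℤ × ℤ), DigitalConvex S ∧ HasVerticalXRay v S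

/-! ## The graph of quads -/

/-- The lattice points at vertical distance at most `v i` (in column `i`) from the triangle with
vertices `(0,0)`, `(m-1,0)`, `(m-1,m-1)`, whose column `i` is `{0, ..., i}`. -/
def Region {m : ℕ} (v : Fin m → ℤ) : Set (ℤ × ℤ) :=
  {p | ∃ i : Fin m, p.1 = ((i : ℕ) : ℤ) ∧ ∃ z : ℤ, 0 ≤ z ∧ z ≤ ((i : ℕ) : ℤ) ∧ |p.2 - z| ≤ v i}

/-- A segment, given by its two end points. -/
structure Seg where
  left : ℤ × ℤ
  right : ℤ × ℤ

/-- The height of (the line through) a non vertical segment at abscissa `i`. -/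
def Seg.height (s : Seg) (i : ℤ) : ℚ :=
  (s.left.2 : ℚ) + ((i - s.left.1 : ℤ) : ℚ) * ((s.right.2 - s.left.2 : ℤ) : ℚ)
    / ((s.right.1 - s.left.1 : ℤ) : ℚ)

/-- A pair of segments: a lower one and an upper one. -/
structure Quad where
  lower : Seg
  upper : Seg

/-- The set of the vertices of a quad. -/
def Quad.vertices (q : Quad) : Set (ℤ × ℤ) :=
  {q.lower.left, q.lower.right, q.upper.left, q.upper.right}

/-- The common abscissas of the two segments of a quad are those from `q.first` to `q.last`. -/
def Quad.first (q : Quad) : ℤ := max q.lower.left.1 q.upper.left.1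

/-- See `Quad.first`. -/
def Quad.last (q : Quad) : ℤ := min q.lower.right.1 q.upper.right.1

/-- The nodes of the graph `Γ(v)`. -/
structure IsNode {m : ℕ} (v : Fin m → ℤ) (q : Quad) : Prop where
  /-- the segments are not vertical -/
  lower_lt : q.lower.left.1 < q.lower.right.1
  upper_lt : q.upper.left.1 < q.upper.right.1
  /-- the vertices are in the region of work -/
  region : q.vertices ⊆ Region v
  /-- the vertices are in convex position -/
  convexPosition : ConvexIndependent ℝ (fun p : (toPlane '' q.vertices) => (p : ℝ × ℝ))
  /-- a vertex common to the two segments is the origin or is in the last column -/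
  common : ∀ p : ℤ × ℤ, (p = q.lower.left ∨ p = q.lower.right) →
    (p = q.upper.left ∨ p = q.upper.right) → p = (0, 0) ∨ p.1 = (m : ℤ) - 1
  /-- the segments have common columns -/
  overlap : q.first ≤ q.last
  /-- the upper segment is above the lower one -/
  above : ∀ i : ℤ, q.first ≤ i → i ≤ q.last → q.lower.height i ≤ q.upper.height i
  /-- the quad has the prescribed number of points in each common column -/
  xray : ∀ i : Fin m, q.first ≤ ((i : ℕ) : ℤ) → ((i : ℕ) : ℤ) ≤ q.last →
    ⌊q.upper.height (i : ℕ)⌋ - ⌈q.lower.height (i : ℕ)⌉ + 1 = v i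

/-- `t` follows `s`, and the junction is not in the convex hull of the other end points of `s`
and `t` and of the end points of the segment `u` on the other side. -/
def ConvexJunction (s t u : Seg) : Prop :=
  s.right = t.left ∧
  toPlane s.right ∉ convexHull ℝ (toPlane '' {s.left, t.right, u.left, u.right})

/-- The oriented edges of `Γ(v)`. -/
def Edge {m : ℕ} (v : Fin m → ℤ) (q₁ q₂ : Quad) : Prop :=
  IsNode v q₁ ∧ IsNode v q₂ ∧
  ((q₁.upper = q₂.upper ∧ ConvexJunction q₁.lower q₂.lower q₁.upper) ∨
   (q₁.lower = q₂.lower ∧ ConvexJunction q₁.upper q₂.upper q₁.lower))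

/-- The left-most nodes: the left vertices are the origin and `(0, v₀ - 1)`
(the same point if `v₀ = 1`). -/
def IsLeft {m : ℕ} (v : Fin m → ℤ) (q : Quad) : Prop :=
  IsNode v q ∧ q.lower.left = (0, 0) ∧
  ∃ hm : 0 < m, q.upper.left = (0, v ⟨0, hm⟩ - 1)

/-- The right-most nodes: the right vertices are `(m-1, y)` and `(m-1, y + v_{m-1} - 1)` with
`0 ≤ y ≤ m-1` (the same point if `v_{m-1} = 1`). -/
def IsRight {m : ℕ} (v : Fin m → ℤ) (q : Quad) : Prop :=
  IsNode v q ∧ ∃ (hm : 0 < m) (y : ℤ), 0 ≤ y ∧ y ≤ (m : ℤ) - 1 ∧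
  q.lower.right = ((m : ℤ) - 1, y) ∧
  q.upper.right = ((m : ℤ) - 1, y + v ⟨m - 1, by omega⟩ - 1)

/-- `Γ(v)` has a path from the left-most to the right-most nodes. -/
def HasPath {m : ℕ} (v : Fin m → ℤ) : Prop :=
  ∃ q₁ q₂ : Quad, IsLeft v q₁ ∧ IsRight v q₂ ∧ Relation.ReflTransGen (Edge v) q₁ q₂

/-! ## The machine model

A unit-cost random access machine over the integers, programmed in a structured language:
finitely many registers (indexed by `R`), finitely many arrays (indexed by `A`), assignments,
conditionals and while loops. Each operation of an expression, each memory access and each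
control step costs one unit. -/

/-- Integer expressions. -/
inductive AExpr (R A : Type) : Type where
  | num : ℤ → AExpr R A
  | reg : R → AExpr R A
  | read : A → AExpr R A → AExpr R A
  | plus : AExpr R A → AExpr R A → AExpr R A
  | minus : AExpr R A → AExpr R A → AExpr R A
  | times : AExpr R A → AExpr R A → AExpr R A
  | quot : AExpr R A → AExpr R A → AExpr R A

/-- Boolean expressions. -/
inductive BExpr (R A : Type) : Type where
  | lt : AExpr R A → AExpr R A → BExpr R A
  | le : AExpr R A → AExpr R A → BExpr R A
  | eq : AExpr R A → AExpr R A → BExpr R A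
  | and : BExpr R A → BExpr R A → BExpr R A
  | or : BExpr R A → BExpr R A → BExpr R A
  | not : BExpr R A → BExpr R A

/-- Programs. -/
inductive Prog (R A : Type) : Type where
  | skip : Prog R A
  | assign : R → AExpr R A → Prog R A
  | write : A → AExpr R A → AExpr R A → Prog R A
  | seq : Prog R A → Prog R A → Prog R A
  | ite : BExpr R A → Prog R A → Prog R A → Prog R A
  | loop : BExpr R A → Prog R A → Prog R A

/-- Memory states. -/
structure Mem (R A : Type) where
  reg : R → ℤ
  arr : A → ℤ → ℤ

section semantics
variable {R A : Type}

/-- The value of an expression. The quotient is the floor of the rational quotient when the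
divisor is positive. -/
def AExpr.eval (σ : Mem R A) : AExpr R A → ℤ
  | .num z => z
  | .reg r => σ.reg r
  | .read a e => σ.arr a (e.eval σ)
  | .plus e f => e.eval σ + f.eval σ
  | .minus e f => e.eval σ - f.eval σ
  | .times e f => e.eval σ * f.eval σ
  | .quot e f => e.eval σ / f.eval σ

/-- The number of steps of the evaluation of an expression. -/
def AExpr.cost : AExpr R A → ℕ
  | .num _ => 1
  | .reg _ => 1
  | .read _ e => e.cost + 1
  | .plus e f => e.cost + f.cost + 1
  | .minus e f => e.cost + f.cost + 1
  | .times e f => e.cost + f.cost + 1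
  | .quot e f => e.cost + f.cost + 1

/-- The truth of a Boolean expression. -/
def BExpr.eval (σ : Mem R A) : BExpr R A → Prop
  | .lt e f => e.eval σ < f.eval σ
  | .le e f => e.eval σ ≤ f.eval σ
  | .eq e f => e.eval σ = f.eval σ
  | .and b c => b.eval σ ∧ c.eval σ
  | .or b c => b.eval σ ∨ c.eval σ
  | .not b => ¬ b.eval σ

/-- The number of steps of the evaluation of a Boolean expression. -/
def BExpr.cost : BExpr R A → ℕ
  | .lt e f => e.cost + f.cost + 1
  | .le e f => e.cost + f.cost + 1
  | .eq e f => e.cost + f.cost + 1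
  | .and b c => b.cost + c.cost + 1
  | .or b c => b.cost + c.cost + 1
  | .not b => b.cost + 1

variable [DecidableEq R] [DecidableEq A]

/-- Change one register. -/
def Mem.setReg (σ : Mem R A) (x : R) (z : ℤ) : Mem R A :=
  { σ with reg := Function.update σ.reg x z }

/-- Change one cell of an array. -/
def Mem.setArr (σ : Mem R A) (a : A) (j z : ℤ) : Mem R A :=
  { σ with arr := Function.update σ.arr a (Function.update (σ.arr a) j z) }

/-- `Exec P σ t τ`: the (deterministic) execution of `P` from the memory state `σ` halts after
exactly `t` steps in the memory state `τ`. -/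
inductive Exec : Prog R A → Mem R A → ℕ → Mem R A → Prop where
  | skip (σ : Mem R A) : Exec .skip σ 1 σ
  | assign (x : R) (e : AExpr R A) (σ : Mem R A) :
      Exec (.assign x e) σ (e.cost + 1) (σ.setReg x (e.eval σ))
  | write (a : A) (j e : AExpr R A) (σ : Mem R A) :
      Exec (.write a j e) σ (j.cost + e.cost + 1) (σ.setArr a (j.eval σ) (e.eval σ))
  | seq {P Q : Prog R A} {σ σ' σ'' : Mem R A} {s t : ℕ} :
      Exec P σ s σ' → Exec Q σ' t σ'' → Exec (.seq P Q) σ (s + t) σ''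
  | ite_true {b : BExpr R A} {P Q : Prog R A} {σ σ' : Mem R A} {t : ℕ} :
      b.eval σ → Exec P σ t σ' → Exec (.ite b P Q) σ (b.cost + 1 + t) σ'
  | ite_false {b : BExpr R A} {P Q : Prog R A} {σ σ' : Mem R A} {t : ℕ} :
      ¬ b.eval σ → Exec Q σ t σ' → Exec (.ite b P Q) σ (b.cost + 1 + t) σ'
  | loop_done {b : BExpr R A} {P : Prog R A} {σ : Mem R A} :
      ¬ b.eval σ → Exec (.loop b P) σ (b.cost + 1) σ
  | loop_step {b : BExpr R A} {P : Prog R A} {σ σ' σ'' : Mem R A} {s t : ℕ} :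
      b.eval σ → Exec P σ s σ' → Exec (.loop b P) σ' t σ'' →
      Exec (.loop b P) σ (b.cost + 1 + s + t) σ''

end semantics

/-! ## The algorithm DAGTomo1 -/

/-- The registers of the program. -/
inductive Reg where
  /-- input: the number of columns -/
  | m
  /-- output: `1` for yes, `0` for no -/
  | out
  /-- a negative entry has been found -/
  | bad
  /-- the first column with a nonzero entry, the number of columns from it to the last one with a
  nonzero entry -/
  | lo | n
  /-- the number of points of the region; a current point -/
  | k | x | y
  /-- the current quad (indices of points): lower segment `a b`, upper segment `c d`; a point -/
  | a | b | c | d | e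
  /-- the candidate quad: lower segment `p q`, upper segment `r s` -/
  | p | q | r | s
  /-- status of the candidate; a column; the last column to be checked -/
  | ok | i | j
  /-- the queue of the reached quads: current position, end -/
  | h | t
  /-- a right-most quad has been reached -/
  | found
deriving DecidableEq

/-- The arrays of the program. -/
inductive Arr where
  /-- input: the X-ray -/
  | v
  /-- the coordinates of the points of the region -/
  | px | py
  /-- the reached quads, and the positions of their antecedents -/
  | qa | qb | qc | qd | ante
  /-- the cell of a quad contains `1` if the quad has been reached, `0` otherwise -/
  | seen
deriving DecidableEq

/-- Expressions of the program. -/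
abbrev E := AExpr Reg Arr

/-- Conditions of the program. -/
abbrev B := BExpr Reg Arr

/-- Pieces of the program. -/
abbrev P := Prog Reg Arr

instance : Add E := ⟨.plus⟩
instance : Sub E := ⟨.minus⟩
instance : Mul E := ⟨.times⟩
instance : Div E := ⟨.quot⟩
instance (z : ℕ) : OfNat E z := ⟨.num (z : ℤ)⟩

/-- The content of a register. -/
abbrev g (z : Reg) : E := .reg z

/-- The abscissa of the point of index `z`. -/
abbrev X (z : Reg) : E := .read .px (g z)

/-- The ordinate of the point of index `z`. -/
abbrev Y (z : Reg) : E := .read .py (g z)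

/-- The entry of the trimmed X-ray in column `z`. -/
abbrev W (z : E) : E := .read .v (g .lo + z)

infixr:30 " ;; " => Prog.seq
infix:35 " <~ " => Prog.assign

/-- Add `1` to a register. -/
def incr (z : Reg) : P := z <~ g z + 1

/-- Conditional without alternative. -/
def when (b : B) (S : P) : P := .ite b S .skip

/-- The candidate is rejected unless `b` holds. -/
def require (b : B) : P := .ite b .skip (.ok <~ 0)

/-- Twice the signed area of the triangle of the points of indices `u`, `w`, `z` (positive if
`u`, `w`, `z` turn counterclockwise). -/
def cross (u w z : Reg) : E := (X w - X u) * (Y z - Y u) - (Y w - Y u) * (X z - X u)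

/-- The height at abscissa `i` of the segment between the points of indices `w` and `z` is
`heightNum w z / heightDen w z`. -/
def heightNum (w z : Reg) : E := Y w * (X z - X w) + (g .i - X w) * (Y z - Y w)

/-- See `heightNum`. -/
def heightDen (w z : Reg) : E := X z - X w

/-- The cell of the candidate in the array of the reached quads. -/
def cell : E := ((g .p * g .k + g .q) * g .k + g .r) * g .k + g .s

/-- The condition on the left end points: they are both the origin, or each one is strictly on the
good side of the other segment. -/
def leftEnds : B :=
  .or (.and (.eq (g .p) (g .r)) (.and (.eq (X .p) 0) (.eq (Y .p) 0)))
      (.and (.lt 0 (cross .p .q .r)) (.lt (cross .r .s .p) 0))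

/-- The condition on the right end points: they are the same point of the last column, or each one
is strictly on the good side of the other segment. -/
def rightEnds : B :=
  .or (.and (.eq (g .q) (g .s)) (.eq (X .q) (g .n - 1)))
      (.and (.lt 0 (cross .p .q .s)) (.lt (cross .r .s .q) 0))

/-- In column `i`, the upper segment is above the lower one, and the number of lattice points
between them is the prescribed one. -/
def columnOk : B :=
  .and (.le (heightNum .p .q * heightDen .r .s) (heightNum .r .s * heightDen .p .q))
    (.eq (heightNum .r .s / heightDen .r .s - (0 - (0 - heightNum .p .q) / heightDen .p .q) + 1)
      (W (g .i)))

/-- Test whether the candidate `p q r s` is a node; the result is in `ok`. -/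
def testNode : P :=
  .ok <~ 1 ;;
  require (.and (.lt (X .p) (X .q)) (.lt (X .r) (X .s))) ;;
  require leftEnds ;;
  require rightEnds ;;
  .ite (.le (X .p) (X .r)) (.i <~ X .r) (.i <~ X .p) ;;
  .ite (.le (X .q) (X .s)) (.j <~ X .q) (.j <~ X .s) ;;
  require (.le (g .i) (g .j)) ;;
  when (.eq (g .ok) 1) (.loop (.le (g .i) (g .j)) (require columnOk ;; incr .i))

/-- The candidate is a right-most quad. -/
def isRightQuad : B :=
  .and (.and (.eq (X .q) (g .n - 1)) (.eq (X .s) (g .n - 1)))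
    (.and (.le 0 (Y .q)) (.le (Y .q) (g .n - 1)))

/-- If the candidate `p q r s` has not been reached yet, is a node and satisfies `turn`, then
store it with its antecedent `source`, and test whether it is right-most. -/
def visit (turn : B) (source : E) : P :=
  when (.eq (.read .seen cell) 0) (
    testNode ;;
    require turn ;;
    when (.eq (g .ok) 1) (
      .write .seen cell 1 ;;
      .write .qa (g .t) (g .p) ;;
      .write .qb (g .t) (g .q) ;;
      .write .qc (g .t) (g .r) ;;
      .write .qd (g .t) (g .s) ;;
      .write .ante (g .t) source ;;
      incr .t ;;
      when isRightQuad (.found <~ 1)))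

/-- List the points of the region, column by column. -/
def listRegion : P :=
  .k <~ 0 ;;
  .x <~ 0 ;;
  .loop (.lt (g .x) (g .n)) (
    .y <~ 0 - W (g .x) ;;
    .loop (.le (g .y) (g .x + W (g .x))) (
      .write .px (g .k) (g .x) ;;
      .write .py (g .k) (g .y) ;;
      incr .k ;;
      incr .y) ;;
    incr .x)

/-- Visit all the left-most quads. The points of column `0` are `(0, -w), ..., (0, w)` where `w` is
the first entry of the trimmed X-ray, so that the indices of `(0, 0)` and `(0, w - 1)` are
`w` and `2 * w - 1`. -/
def visitLeft : P :=
  .h <~ 0 ;;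
  .t <~ 0 ;;
  .found <~ 0 ;;
  .b <~ 0 ;;
  .loop (.lt (g .b) (g .k)) (
    .d <~ 0 ;;
    .loop (.lt (g .d) (g .k)) (
      .p <~ W 0 ;; .q <~ g .b ;; .r <~ 2 * W 0 - 1 ;; .s <~ g .d ;;
      visit (.le 0 0) (0 - 1) ;;
      incr .d) ;;
    incr .b)

/-- Visit the successors of the current quad, and go to the next one. -/
def expand : P :=
  .a <~ .read .qa (g .h) ;;
  .b <~ .read .qb (g .h) ;;
  .c <~ .read .qc (g .h) ;;
  .d <~ .read .qd (g .h) ;;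
  .e <~ 0 ;;
  .loop (.lt (g .e) (g .k)) (
    .p <~ g .b ;; .q <~ g .e ;; .r <~ g .c ;; .s <~ g .d ;;
    visit (.lt 0 (cross .a .b .e)) (g .h) ;;
    .p <~ g .a ;; .q <~ g .b ;; .r <~ g .d ;; .s <~ g .e ;;
    visit (.lt (cross .c .d .e) 0) (g .h) ;;
    incr .e) ;;
  incr .h

/-- The search for a path. -/
def search : P :=
  listRegion ;;
  visitLeft ;;
  .loop (.and (.lt (g .h) (g .t)) (.eq (g .found) 0)) expand ;;
  .out <~ g .found

/-- The algorithm: X-rays with a negative entry are rejected, the null columns at both ends are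
removed, X-rays with at most one remaining column are accepted, and in the other cases a path from
the left-most to the right-most quads is searched for. -/
def DAGTomo1 : P :=
  .bad <~ 0 ;;
  .i <~ 0 ;;
  .loop (.lt (g .i) (g .m)) (
    when (.lt (.read .v (g .i)) 0) (.bad <~ 1) ;;
    incr .i) ;;
  .ite (.eq (g .bad) 1) (.out <~ 0) (
    .lo <~ 0 ;;
    .loop (.and (.lt (g .lo) (g .m)) (.eq (W 0) 0)) (incr .lo) ;;
    .ite (.eq (g .lo) (g .m)) (.out <~ 1) (
      .n <~ g .m - g .lo ;;
      .loop (.eq (W (g .n - 1)) 0) (.n <~ g .n - 1) ;;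
      .ite (.eq (g .n) 1) (.out <~ 1) search))

/-- The initial memory state: the registers and the cells of the arrays contain `0`, except those
of the input `v`. -/
def input {m : ℕ} (v : Fin m → ℤ) : Mem Reg Arr where
  reg z := if z = .m then (m : ℤ) else 0
  arr a j := if a = .v then
      (if h : 0 ≤ j ∧ j < (m : ℤ) then v ⟨j.toNat, by omega⟩ else 0)
    else 0

end XRay

/-! From a set to a path. The boundary of the convex hull of a digital convex set consists of a
lower and an upper chain of edges, both running from the first column to the last. Sweep from left
to right, replacing each time whichever of the two current edges ends first. Two simultaneous edges
share a column, and in their common columns the set is exactly the set of lattice points between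
them, so that each pair is a node and each replacement an edge of `Γ(v)` (`Normalized.isNode`,
`Normalized.exists_path`). The end points must also lie in the region. Translations and vertical
shears preserve digital convexity and the column counts; they bring the lowest point of the first
column to the origin and that of the last column to a height between `0` and `m - 1`. The chord
joining these two points then lies in the triangle, and a point of the set outside the triangle
forces a run of points of the set in its column, whose length is at most `v i`
(`Normalized.subset_region`, `DTC.hasPath`).

From a path to a set. All turns along a path are convex, so the last segment on each side is the
strongest constraint to the right of its left end, and a new segment adds no constraint to the left
of its own left end. Hence local convexity suffices: the intersection of the half planes of all the
segments of the path has, in each column, exactly the points between the two segments of one node of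
the path (`Envelope.step`, `HasPath.dtc`).

The program. Convex position amounts to each end point being strictly on the good side of the
opposite segment, apart from the permitted common points (`isNode_iff_nodeTest`), and a convex
junction amounts to the sign of one determinant (`edge_lower_iff`, `edge_upper_iff`); so all tests
are integer arithmetic. The list of stored quads contains only reached nodes, without repetition,
and if the search stops without success it contains the left-most nodes and is closed under the
edges (`Queue`, `mem_of_reach`). With `k` points in the region there are at most `k ^ 4` quads, each
expanded once with `2 * k` candidates, each tested in time linear in the number of columns. Since `k
≤ m ^ 2 + 2 * ∑ v i`, the product `m * k ^ 5` gives the time bound (`cost_le`). -/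

namespace XRay

/-! ## Orientation of lattice points and convex hulls -/

/-- Twice the signed area of the triangle `p q z`. -/
def cr (p q z : ℤ × ℤ) : ℤ := (q.1 - p.1) * (z.2 - p.2) - (q.2 - p.2) * (z.1 - p.1)

theorem toPlane_injective : Function.Injective toPlane := by
  rintro ⟨a, b⟩ ⟨c, d⟩ h
  simp only [toPlane, Prod.mk.injEq, Int.cast_inj] at h
  exact Prod.ext h.1 h.2

/-- A point at which a pair of linear functionals is lexicographically minimal is not in the convex
hull of the other points. -/
theorem notMem_convexHull_of_lex {p : ℤ × ℤ} {T : Set (ℤ × ℤ)} (α β γ : ℤ)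
    (h : ∀ z ∈ T, 0 < α * (z.1 - p.1) + β * (z.2 - p.2) ∨
      (α * (z.1 - p.1) + β * (z.2 - p.2) = 0 ∧ 0 < γ * (z.1 - p.1))) :
    toPlane p ∉ convexHull ℝ (toPlane '' T) := by
  set f : ℝ × ℝ → ℝ := fun z => α * (z.1 - p.1) + β * (z.2 - p.2) with hf
  set k : ℝ × ℝ → ℝ := fun z => γ * (z.1 - p.1) with hk
  -- The points at which the pair `(f, k)` is lexicographically positive form a convex set, since
  -- both functions are affine; `p`, where both vanish, is not in it.
  have hconv : Convex ℝ {z : ℝ × ℝ | 0 < f z ∨ (f z = 0 ∧ 0 < k z)} := by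
    intro x hx y hy a b ha hb hab
    have e1 : f (a • x + b • y) = a * f x + b * f y := by
      have : b = 1 - a := by linarith
      subst this
      simp only [hf, Prod.fst_add, Prod.smul_fst, Prod.snd_add, Prod.smul_snd, smul_eq_mul]
      ring
    have e2 : k (a • x + b • y) = a * k x + b * k y := by
      have : b = 1 - a := by linarith
      subst this
      simp only [hk, Prod.fst_add, Prod.smul_fst, smul_eq_mul]
      ring
    simp only [Set.mem_ofPred_eq, e1, e2] at hx hy ⊢
    rcases ha.eq_or_lt with rfl | ha
    · obtain rfl : b = 1 := by linarith
      simpa using hy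
    rcases hb.eq_or_lt with rfl | hb
    · obtain rfl : a = 1 := by linarith
      simpa using hx
    rcases hx with hx | ⟨hx, hx'⟩ <;> rcases hy with hy | ⟨hy, hy'⟩
    · left; positivity
    · left; rw [hy]; nlinarith [mul_pos ha hx]
    · left; rw [hx]; nlinarith [mul_pos hb hy]
    · right; exact ⟨by rw [hx, hy]; ring, by positivity⟩
  have hsub : toPlane '' T ⊆ {z : ℝ × ℝ | 0 < f z ∨ (f z = 0 ∧ 0 < k z)} := by
    rintro _ ⟨z, hz, rfl⟩
    simp only [hf, hk, toPlane, Set.mem_ofPred_eq]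
    exact_mod_cast h z hz
  intro hp
  have := convexHull_min hsub hconv hp
  simp [hf, hk, toPlane] at this

theorem _root_.Convex.ordConnected_vertical {K : Set (ℝ × ℝ)} (hK : Convex ℝ K) (x : ℝ) :
    {y : ℝ | (x, y) ∈ K}.OrdConnected := by
  refine Convex.ordConnected fun y hy z hz s t hs ht hst => ?_
  simpa [← add_mul, hst] using hK hy hz hs ht hst

theorem segment_mem_convexHull {T : Set (ℤ × ℤ)} {a b : ℤ × ℤ} {i : ℤ} (ha : a ∈ T) (hb : b ∈ T)
    (hab : a.1 < b.1) (hai : a.1 ≤ i) (hib : i ≤ b.1) :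
    ((i : ℝ), (a.2 : ℝ) + (i - a.1) * (b.2 - a.2) / (b.1 - a.1)) ∈
      convexHull ℝ (toPlane '' T) := by
  have hab' : (0 : ℝ) < b.1 - a.1 := by
    have : (a.1 : ℝ) < b.1 := by exact_mod_cast hab
    linarith
  have hai' : (0 : ℝ) ≤ i - a.1 := by
    have : (a.1 : ℝ) ≤ i := by exact_mod_cast hai
    linarith
  have hib' : (0 : ℝ) ≤ b.1 - i := by
    have : (i : ℝ) ≤ b.1 := by exact_mod_cast hib
    linarith
  -- The point of abscissa `i` is the barycentre of `a` and `b` with weights proportional to `b.1 -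
  -- i` and `i - a.1`.
  have := (convex_convexHull ℝ (toPlane '' T)) (subset_convexHull ℝ _ ⟨a, ha, rfl⟩)
    (subset_convexHull ℝ _ ⟨b, hb, rfl⟩) (div_nonneg hib' hab'.le) (div_nonneg hai' hab'.le)
    (by field_simp; ring)
  convert this using 1
  ext
  · simp [toPlane]; field_simp; ring
  · simp [toPlane]; field_simp; ring

/-- A point between two segments, on a vertical line that meets both. -/
theorem mem_convexHull_of_between {T : Set (ℤ × ℤ)} {a b c d z : ℤ × ℤ}
    (ha : a ∈ T) (hb : b ∈ T) (hc : c ∈ T) (hd : d ∈ T)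
    (hab : a.1 < b.1) (hcd : c.1 < d.1) (haz : a.1 ≤ z.1) (hzb : z.1 ≤ b.1)
    (hcz : c.1 ≤ z.1) (hzd : z.1 ≤ d.1) (h₁ : 0 ≤ cr a b z) (h₂ : cr c d z ≤ 0) :
    toPlane z ∈ convexHull ℝ (toPlane '' T) := by
  refine ((convex_convexHull ℝ (toPlane '' T)).ordConnected_vertical _).out
    (segment_mem_convexHull ha hb hab haz hzb) (segment_mem_convexHull hc hd hcd hcz hzd)
    ⟨?_, ?_⟩
  · have hab' : (0 : ℝ) < b.1 - a.1 := by
      have : (a.1 : ℝ) < b.1 := by exact_mod_cast hab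
      linarith
    have : (0 : ℝ) ≤ (b.1 - a.1) * (z.2 - a.2) - (b.2 - a.2) * (z.1 - a.1) := by
      exact_mod_cast h₁
    rw [← le_sub_iff_add_le', div_le_iff₀ hab']
    linarith
  · have hab' : (0 : ℝ) < d.1 - c.1 := by
      have : (c.1 : ℝ) < d.1 := by exact_mod_cast hcd
      linarith
    have : ((d.1 - c.1) * (z.2 - c.2) - (d.2 - c.2) * (z.1 - c.1) : ℝ) ≤ 0 := by
      exact_mod_cast h₂
    rw [← sub_le_iff_le_add', le_div_iff₀ hab']
    linarith

/-! ## Heights -/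

/-- A single fraction with positive denominator: comparisons become cross products and roundings
become integer divisions, in the form in which the program computes them. -/
theorem Seg.height_eq (s : Seg) (h : s.left.1 < s.right.1) (i : ℤ) :
    s.height i = ((s.left.2 * (s.right.1 - s.left.1) + (i - s.left.1) * (s.right.2 - s.left.2) : ℤ) : ℚ)
      / ((s.right.1 - s.left.1 : ℤ) : ℚ) := by
  have : ((s.right.1 - s.left.1 : ℤ) : ℚ) ≠ 0 := by
    exact_mod_cast (by omega : s.right.1 - s.left.1 ≠ 0)
  rw [Seg.height, eq_div_iff this, add_mul, div_mul_cancel₀ _ this]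
  push_cast
  ring

theorem Seg.height_le_iff (s : Seg) (h : s.left.1 < s.right.1) (i y : ℤ) :
    s.height i ≤ y ↔ 0 ≤ cr s.left s.right (i, y) := by
  have : (0 : ℚ) < ((s.right.1 - s.left.1 : ℤ) : ℚ) := by
    exact_mod_cast (by omega : 0 < s.right.1 - s.left.1)
  rw [s.height_eq h, div_le_iff₀ this]
  norm_cast
  simp only [cr]
  constructor <;> intro _ <;> linarith

theorem Seg.le_height_iff (s : Seg) (h : s.left.1 < s.right.1) (i y : ℤ) :
    y ≤ s.height i ↔ cr s.left s.right (i, y) ≤ 0 := by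
  have : (0 : ℚ) < ((s.right.1 - s.left.1 : ℤ) : ℚ) := by
    exact_mod_cast (by omega : 0 < s.right.1 - s.left.1)
  rw [s.height_eq h, le_div_iff₀ this]
  norm_cast
  simp only [cr]
  constructor <;> intro _ <;> linarith

theorem Seg.floor_height (s : Seg) (h : s.left.1 < s.right.1) (i : ℤ) :
    ⌊s.height i⌋ = (s.left.2 * (s.right.1 - s.left.1) + (i - s.left.1) * (s.right.2 - s.left.2))
      / (s.right.1 - s.left.1) := by
  rw [s.height_eq h]
  obtain ⟨d, hd⟩ := Int.eq_ofNat_of_zero_le (by omega : 0 ≤ s.right.1 - s.left.1)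
  rw [hd]
  exact Rat.floor_intCast_div_natCast _ _

/-- The machine only has floor division, hence `⌈x⌉ = -⌊-x⌋`, with the negations written `0 - _` as
in `columnOk`. -/
theorem Seg.ceil_height (s : Seg) (h : s.left.1 < s.right.1) (i : ℤ) :
    ⌈s.height i⌉ = 0 - (0 - (s.left.2 * (s.right.1 - s.left.1)
      + (i - s.left.1) * (s.right.2 - s.left.2))) / (s.right.1 - s.left.1) := by
  rw [s.height_eq h]
  obtain ⟨d, hd⟩ := Int.eq_ofNat_of_zero_le (by omega : 0 ≤ s.right.1 - s.left.1)
  rw [hd, zero_sub, zero_sub]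
  exact Rat.ceil_intCast_div_natCast _ _

theorem Seg.height_le_height_iff (s t : Seg) (hs : s.left.1 < s.right.1)
    (ht : t.left.1 < t.right.1) (i : ℤ) : s.height i ≤ t.height i ↔
    (s.left.2 * (s.right.1 - s.left.1) + (i - s.left.1) * (s.right.2 - s.left.2))
      * (t.right.1 - t.left.1) ≤
    (t.left.2 * (t.right.1 - t.left.1) + (i - t.left.1) * (t.right.2 - t.left.2))
      * (s.right.1 - s.left.1) := by
  rw [s.height_eq hs, t.height_eq ht, div_le_div_iff₀]
  · norm_cast
  · exact_mod_cast (by omega : 0 < s.right.1 - s.left.1)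
  · exact_mod_cast (by omega : 0 < t.right.1 - t.left.1)

theorem Seg.height_left (s : Seg) : s.height s.left.1 = s.left.2 := by
  simp [Seg.height]

theorem Seg.height_right (s : Seg) (h : s.left.1 < s.right.1) : s.height s.right.1 = s.right.2 := by
  have : ((s.right.1 - s.left.1 : ℤ) : ℚ) ≠ 0 := by
    exact_mod_cast (by omega : s.right.1 - s.left.1 ≠ 0)
  rw [Seg.height, mul_comm, mul_div_assoc, div_self this]
  push_cast
  ring

/-! ## The arithmetic characterization of the nodes and of the edges -/

/-- The conditions on the quads that the program tests. -/
structure NodeTest {m : ℕ} (v : Fin m → ℤ) (q : Quad) : Prop where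
  lower_lt : q.lower.left.1 < q.lower.right.1
  upper_lt : q.upper.left.1 < q.upper.right.1
  leftEnds : (q.lower.left = q.upper.left ∧ q.lower.left = (0, 0)) ∨
    (0 < cr q.lower.left q.lower.right q.upper.left ∧
      cr q.upper.left q.upper.right q.lower.left < 0)
  rightEnds : (q.lower.right = q.upper.right ∧ q.lower.right.1 = (m : ℤ) - 1) ∨
    (0 < cr q.lower.left q.lower.right q.upper.right ∧
      cr q.upper.left q.upper.right q.lower.right < 0)
  overlap : q.first ≤ q.last
  above : ∀ i : ℤ, q.first ≤ i → i ≤ q.last → q.lower.height i ≤ q.upper.height i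
  xray : ∀ i : Fin m, q.first ≤ ((i : ℕ) : ℤ) → ((i : ℕ) : ℤ) ≤ q.last →
    ⌊q.upper.height (i : ℕ)⌋ - ⌈q.lower.height (i : ℕ)⌉ + 1 = v i

theorem Region.fst_mem {m : ℕ} {v : Fin m → ℤ} {p : ℤ × ℤ} (h : p ∈ Region v) :
    0 ≤ p.1 ∧ p.1 ≤ (m : ℤ) - 1 := by
  obtain ⟨i, hi, -⟩ := h
  have := i.2
  omega

section
variable {m : ℕ} {v : Fin m → ℤ} {q : Quad}

theorem Quad.forall_vertices {C : ℤ × ℤ → Prop} : (∀ z ∈ q.vertices, C z) ↔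
    C q.lower.left ∧ C q.lower.right ∧ C q.upper.left ∧ C q.upper.right := by
  simp [Quad.vertices]

theorem convexIndependent_vertices_iff :
    ConvexIndependent ℝ (fun p : (toPlane '' q.vertices) => (p : ℝ × ℝ)) ↔
      ∀ z ∈ q.vertices, toPlane z ∉ convexHull ℝ (toPlane '' (q.vertices \ {z})) := by
  rw [convexIndependent_set_iff_notMem_convexHull_sdiff]
  simp only [Set.forall_mem_image, Set.image_sdiff toPlane_injective, Set.image_singleton]

/-- The line of each segment leaves all the other vertices strictly on one side. Each end of the
segment is therefore lexicographically extreme, first for the distance to this line and then,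
against the other end, for the abscissa. -/
theorem NodeTest.isNode (h : NodeTest v q) (hr : q.vertices ⊆ Region v) : IsNode v q := by
  have hr' := hr
  obtain ⟨h1, h2, h3, h4, h5, h6, h7⟩ := h
  refine ⟨h1, h2, hr, ?_, ?_, h5, h6, h7⟩
  · rw [convexIndependent_vertices_iff]
    have hd : ∀ {x y : ℤ × ℤ}, x.1 < y.1 → x ≠ y := by rintro x _ h rfl; exact h.false
    have low : ∀ z ∈ q.vertices, z ≠ q.lower.left → z ≠ q.lower.right →
        0 < cr q.lower.left q.lower.right z := by
      rw [Quad.forall_vertices]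
      refine ⟨by simp, by simp, fun a b => ?_, fun a b => ?_⟩
      · rcases h3 with h | h
        · exact absurd h.1.symm a
        · exact h.1
      · rcases h4 with h | h
        · exact absurd h.1.symm b
        · exact h.1
    have upp : ∀ z ∈ q.vertices, z ≠ q.upper.left → z ≠ q.upper.right →
        cr q.upper.left q.upper.right z < 0 := by
      rw [Quad.forall_vertices]
      refine ⟨fun a b => ?_, fun a b => ?_, by simp, by simp⟩
      · rcases h3 with h | h
        · exact absurd h.1 a
        · exact h.2
      · rcases h4 with h | h
        · exact absurd h.1 b
        · exact h.2
    rw [Quad.forall_vertices]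
    refine ⟨?_, ?_, ?_, ?_⟩
    · refine notMem_convexHull_of_lex (-(q.lower.right.2 - q.lower.left.2))
        (q.lower.right.1 - q.lower.left.1) 1 fun z hz => ?_
      by_cases hz' : z = q.lower.right
      · right; subst hz'; exact ⟨by ring, by omega⟩
      · left; have := low z hz.1 hz.2 hz'; simp only [cr] at this; linarith
    · refine notMem_convexHull_of_lex (-(q.lower.right.2 - q.lower.left.2))
        (q.lower.right.1 - q.lower.left.1) (-1) fun z hz => ?_
      by_cases hz' : z = q.lower.left
      · right; subst hz'; exact ⟨by ring, by omega⟩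
      · left; have := low z hz.1 hz' hz.2; simp only [cr] at this; linarith
    · refine notMem_convexHull_of_lex ((q.upper.right.2 - q.upper.left.2))
        (-(q.upper.right.1 - q.upper.left.1)) 1 fun z hz => ?_
      by_cases hz' : z = q.upper.right
      · right; subst hz'; exact ⟨by ring, by omega⟩
      · left; have := upp z hz.1 hz.2 hz'; simp only [cr] at this; linarith
    · refine notMem_convexHull_of_lex ((q.upper.right.2 - q.upper.left.2))
        (-(q.upper.right.1 - q.upper.left.1)) (-1) fun z hz => ?_
      by_cases hz' : z = q.upper.left
      · right; subst hz'; exact ⟨by ring, by omega⟩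
      · left; have := upp z hz.1 hz' hz.2; simp only [cr] at this; linarith
  -- A common vertex is on both lines, so its determinant vanishes and the strict alternative is
  -- impossible.
  · rintro p (rfl | rfl) (h | h)
    · rcases h3 with h' | h'
      · exact Or.inl h'.2
      · rw [← h] at h'; simp [cr] at h'
    · rcases h4 with h' | h'
      · rw [← h'.1] at h; exact absurd (congrArg Prod.fst h) h1.ne
      · rw [← h] at h'; simp [cr] at h'
    · rcases h3 with h' | h'
      · rw [← h'.1] at h; exact absurd (congrArg Prod.fst h) h1.ne'
      · rw [← h] at h'; simp [cr, mul_comm] at h'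
    · rcases h4 with h' | h'
      · exact Or.inr h'.2
      · rw [← h] at h'; simp [cr, mul_comm] at h'

/-- If two segments do not meet each other badly, then the left end of the second one is above the
first one. -/
theorem cr_pos_of_above {p q r s : ℤ × ℤ}
    (h₁ : p.1 ≤ r.1 → 0 ≤ cr p q r) (h₂ : r.1 ≤ p.1 → cr r s p ≤ 0)
    (h₃ : p.1 ≤ r.1 → cr p q r ≠ 0)
    (h₄ : r.1 < p.1 → cr r s p ≤ 0 → ¬ 0 ≤ cr r q p) : 0 < cr p q r := by
  by_contra! h
  rcases le_or_gt p.1 r.1 with hx | hx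
  · exact h₃ hx (le_antisymm h (h₁ hx))
  · refine h₄ hx (h₂ hx.le) ?_
    have : cr r q p = - cr p q r := by simp only [cr]; ring
    omega

/-- The condition `above`, read at the ends of the common interval, gives weak inequalities for the
end points that lie over or under the other segment. For each remaining failure, some vertex is
caught between two segments joining other vertices, against the convex position. -/
theorem IsNode.nodeTest (h : IsNode v q) : NodeTest v q := by
  obtain ⟨h1, h2, hr, h4, h5, h6, h7, h8⟩ := h
  rw [convexIndependent_vertices_iff] at h4
  have hx : ∀ z ∈ q.vertices, 0 ≤ z.1 ∧ z.1 ≤ (m : ℤ) - 1 := fun z hz => Region.fst_mem (hr hz)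
  obtain ⟨⟨p, q⟩, ⟨r, s⟩⟩ := q
  simp only [Quad.first, Quad.last] at h1 h2 h5 h6 h7
  have P : p ∈ (Quad.mk ⟨p, q⟩ ⟨r, s⟩).vertices := by simp [Quad.vertices]
  have Q : q ∈ (Quad.mk ⟨p, q⟩ ⟨r, s⟩).vertices := by simp [Quad.vertices]
  have R : r ∈ (Quad.mk ⟨p, q⟩ ⟨r, s⟩).vertices := by simp [Quad.vertices]
  have S : s ∈ (Quad.mk ⟨p, q⟩ ⟨r, s⟩).vertices := by simp [Quad.vertices]
  -- A common point that is a right end of one segment and a left end of the other has columns on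
  -- both sides, so it is neither the origin nor in the last column.
  have hqr : q ≠ r := by
    intro e
    have e1 := congrArg Prod.fst e
    rcases h5 q (Or.inr rfl) (Or.inl e) with h | h
    · have h8 := hx p P; have h9 := congrArg Prod.fst h; simp only at h9; omega
    · have := hx s S; omega
  have hps : p ≠ s := by
    intro e
    have e1 := congrArg Prod.fst e
    rcases h5 p (Or.inl rfl) (Or.inr e) with h | h
    · have h8 := hx r R; have h9 := congrArg Prod.fst h; simp only at h9; omega
    · have := hx q Q; omega
  have hpq : p ≠ q := by intro e; have := congrArg Prod.fst e; omega
  have hrs : r ≠ s := by intro e; have := congrArg Prod.fst e; omega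
  have tst : ∀ i, p.1 ≤ i → r.1 ≤ i → i ≤ q.1 → i ≤ s.1 →
      (Seg.mk p q).height i ≤ (Seg.mk r s).height i :=
    fun i a b c d => h7 i (max_le a b) (le_min c d)
  have Cp : r.1 ≤ p.1 → p.1 ≤ s.1 → cr r s p ≤ 0 := by
    intro a b
    have := tst p.1 le_rfl a h1.le b
    rw [show (Seg.mk p q).height p.1 = p.2 from Seg.height_left _] at this
    exact (Seg.le_height_iff ⟨r, s⟩ h2 _ _).1 this
  have Cr : p.1 ≤ r.1 → r.1 ≤ q.1 → 0 ≤ cr p q r := by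
    intro a b
    have := tst r.1 a le_rfl b h2.le
    rw [show (Seg.mk r s).height r.1 = r.2 from Seg.height_left _] at this
    exact (Seg.height_le_iff ⟨p, q⟩ h1 _ _).1 this
  have Cq : r.1 ≤ q.1 → q.1 ≤ s.1 → cr r s q ≤ 0 := by
    intro a b
    have := tst q.1 h1.le a le_rfl b
    rw [show (Seg.mk p q).height q.1 = q.2 from Seg.height_right _ h1] at this
    exact (Seg.le_height_iff ⟨r, s⟩ h2 _ _).1 this
  have Cs : p.1 ≤ s.1 → s.1 ≤ q.1 → 0 ≤ cr p q s := by
    intro a b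
    have := tst s.1 a h2.le b le_rfl
    rw [show (Seg.mk r s).height s.1 = s.2 from Seg.height_right _ h2] at this
    exact (Seg.height_le_iff ⟨p, q⟩ h1 _ _).1 this
  have o1 : r.1 ≤ q.1 := (le_max_right _ _).trans (h6.trans (min_le_left _ _))
  have o2 : p.1 ≤ s.1 := (le_max_left _ _).trans (h6.trans (min_le_right _ _))
  -- The form in which convex position is used: no vertex lies between two segments `a b` and `c d`
  -- joining other vertices. The two segments may coincide, which excludes a vertex on a segment.
  have hull : ∀ {z a b c d : ℤ × ℤ}, z ∈ (Quad.mk ⟨p, q⟩ ⟨r, s⟩).vertices →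
      a ∈ (Quad.mk ⟨p, q⟩ ⟨r, s⟩).vertices → b ∈ (Quad.mk ⟨p, q⟩ ⟨r, s⟩).vertices →
      c ∈ (Quad.mk ⟨p, q⟩ ⟨r, s⟩).vertices → d ∈ (Quad.mk ⟨p, q⟩ ⟨r, s⟩).vertices →
      a ≠ z → b ≠ z → c ≠ z → d ≠ z → a.1 < b.1 → c.1 < d.1 → a.1 ≤ z.1 → z.1 ≤ b.1 →
      c.1 ≤ z.1 → z.1 ≤ d.1 → cr c d z ≤ 0 → ¬ 0 ≤ cr a b z := by
    intro z a b c d hz ha hb hc hd haz hbz hcz hdz hab hcd a1 a2 a3 a4 a5 a6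
    exact h4 z hz (mem_convexHull_of_between ⟨ha, haz⟩ ⟨hb, hbz⟩ ⟨hc, hcz⟩ ⟨hd, hdz⟩
      hab hcd a1 a2 a3 a4 a6 a5)
  refine ⟨h1, h2, ?_, ?_, h6, h7, h8⟩
  · by_cases hpr : p = r
    · left
      refine ⟨hpr, (h5 p (Or.inl rfl) (Or.inl hpr)).resolve_right fun h => ?_⟩
      have := hx q Q
      omega
    right
    change 0 < cr p q r ∧ cr r s p < 0
    refine ⟨cr_pos_of_above (fun a => Cr a o1) (fun a => Cp a o2) ?_ ?_, ?_⟩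
    · intro a e
      exact hull R P Q P Q hpr hqr hpr hqr h1 h1 a o1 a o1 e.le e.ge
    · intro a b
      exact hull P R Q R S (Ne.symm hpr) hpq.symm (Ne.symm hpr) hps.symm (by omega) h2 a.le h1.le
        a.le o2 b
    · by_contra! hc
      rcases le_or_gt r.1 p.1 with a | a
      · exact hull P R S R S (Ne.symm hpr) hps.symm (Ne.symm hpr) hps.symm h2 h2 a o2 a o2
          (Cp a o2) hc
      · refine hull R P Q P S hpr hqr hpr hrs.symm h1 (by omega) a.le o1 a.le h2.le ?_
          (Cr a.le o1)
        have : cr p s r = - cr r s p := by simp only [cr]; ring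
        omega
  · by_cases hqs : q = s
    · left
      refine ⟨hqs, (h5 q (Or.inr rfl) (Or.inr hqs)).resolve_left fun h => ?_⟩
      have h9 := hx p P
      have h10 := congrArg Prod.fst h
      simp only at h10; omega
    right
    change 0 < cr p q s ∧ cr r s q < 0
    constructor
    · by_contra! hc
      rcases le_or_gt s.1 q.1 with a | a
      · exact hull S P Q P Q hps hqs hps hqs h1 h1 o2 a o2 a hc (Cs o2 a)
      · refine hull Q P S R S hpq (Ne.symm hqs) hqr.symm (Ne.symm hqs) (by omega) h2 h1.le a.le
          o1 a.le (Cq o1 a.le) ?_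
        have : cr p s q = - cr p q s := by simp only [cr]; ring
        omega
    · by_contra! hc
      rcases le_or_gt q.1 s.1 with a | a
      · exact hull Q R S R S hqr.symm (Ne.symm hqs) hqr.symm (Ne.symm hqs) h2 h2 o1 a o1 a
          (Cq o1 a) hc
      · refine hull S P Q R Q hps hqs hrs hqs h1 (by omega) o2 a.le h2.le a.le ?_ (Cs o2 a.le)
        have : cr r q s = - cr r s q := by simp only [cr]; ring
        omega

theorem isNode_iff_nodeTest (hr : q.vertices ⊆ Region v) : IsNode v q ↔ NodeTest v q :=
  ⟨IsNode.nodeTest, fun h => h.isNode hr⟩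

end

/-! ### Convex junctions and edges of the graph as signs of determinants -/

section
variable {m : ℕ} {v : Fin m → ℤ} {a b c d e : ℤ × ℤ}

theorem IsNode.le_of_le (h : IsNode v ⟨⟨a, b⟩, ⟨c, d⟩⟩) : c.1 ≤ b.1 ∧ a.1 ≤ d.1 :=
  ⟨(le_max_right _ _).trans (h.overlap.trans (min_le_left _ _)),
    (le_max_left _ _).trans (h.overlap.trans (min_le_right _ _))⟩

/-- Without a strict left turn, `b` is above the segment `a e` and below `c d`, hence in the hull of
these four points. With a strict turn, the line `a b` is a support line of the four points that
meets them at `a` only, and `a` is to the left of `b`. -/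
theorem convexJunction_lower_iff (h₁ : IsNode v ⟨⟨a, b⟩, ⟨c, d⟩⟩)
    (h₂ : IsNode v ⟨⟨b, e⟩, ⟨c, d⟩⟩) :
    ConvexJunction ⟨a, b⟩ ⟨b, e⟩ ⟨c, d⟩ ↔ 0 < cr a b e := by
  have hab : a.1 < b.1 := h₁.lower_lt
  have hbe : b.1 < e.1 := h₂.lower_lt
  have hcd : c.1 < d.1 := h₁.upper_lt
  have hcb := h₁.le_of_le.1
  have hbd := h₂.le_of_le.2
  constructor
  · rintro ⟨-, h⟩
    by_contra! hc
    have hb : cr c d b ≤ 0 := by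
      have := h₁.above b.1 (max_le hab.le hcb) (le_min le_rfl hbd)
      rw [show (Seg.mk a b).height b.1 = b.2 from Seg.height_right _ hab] at this
      exact (Seg.le_height_iff ⟨c, d⟩ hcd _ _).1 this
    have he : 0 ≤ cr a e b := by
      have : cr a e b = - cr a b e := by simp only [cr]; ring
      omega
    exact h (mem_convexHull_of_between (a := a) (b := e) (c := c) (d := d) (by simp) (by simp)
      (by simp) (by simp) (by omega) hcd hab.le hbe.le hcb hbd he hb)
  · intro h
    refine ⟨rfl, notMem_convexHull_of_lex (-(b.2 - a.2)) (b.1 - a.1) (-1) ?_⟩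
    have key : ∀ z : ℤ × ℤ, (0 < cr a b z ∨ z = a) →
        0 < -(b.2 - a.2) * (z.1 - b.1) + (b.1 - a.1) * (z.2 - b.2) ∨
        (-(b.2 - a.2) * (z.1 - b.1) + (b.1 - a.1) * (z.2 - b.2) = 0 ∧ 0 < -1 * (z.1 - b.1)) := by
      rintro z (hz | rfl)
      · left; simp only [cr] at hz; linarith
      · right; exact ⟨by ring, by omega⟩
    simp only [Set.mem_insert_iff, Set.mem_singleton_iff, forall_eq_or_imp, forall_eq]
    refine ⟨key a (Or.inr rfl), key e (Or.inl h), key c ?_, key d ?_⟩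
    · rcases h₁.nodeTest.leftEnds with h' | h'
      · exact Or.inr h'.1.symm
      · exact Or.inl h'.1
    -- If `d` were `b`, it would be in the last column and there would be no room for `e` on its
    -- right.
    · rcases h₁.nodeTest.rightEnds with h' | h'
      · have h3 := Region.fst_mem (h₂.region (show e ∈ _ by simp [Quad.vertices]))
        have h4 := h'.2
        simp only at h4
        omega
      · exact Or.inl h'.1

theorem convexJunction_upper_iff (h₁ : IsNode v ⟨⟨a, b⟩, ⟨c, d⟩⟩)
    (h₂ : IsNode v ⟨⟨a, b⟩, ⟨d, e⟩⟩) :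
    ConvexJunction ⟨c, d⟩ ⟨d, e⟩ ⟨a, b⟩ ↔ cr c d e < 0 := by
  have hcd : c.1 < d.1 := h₁.upper_lt
  have hde : d.1 < e.1 := h₂.upper_lt
  have hab : a.1 < b.1 := h₁.lower_lt
  have had := h₁.le_of_le.2
  have hdb := h₂.le_of_le.1
  constructor
  · rintro ⟨-, h⟩
    by_contra! hc
    have hb : 0 ≤ cr a b d := by
      have := h₁.above d.1 (max_le had hcd.le) (le_min hdb le_rfl)
      rw [show (Seg.mk c d).height d.1 = d.2 from Seg.height_right _ hcd] at this
      exact (Seg.height_le_iff ⟨a, b⟩ hab _ _).1 this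
    have he : cr c e d ≤ 0 := by
      have : cr c e d = - cr c d e := by simp only [cr]; ring
      omega
    exact h (mem_convexHull_of_between (a := a) (b := b) (c := c) (d := e) (by simp) (by simp)
      (by simp) (by simp) hab (by omega) had hdb hcd.le hde.le hb he)
  · intro h
    refine ⟨rfl, notMem_convexHull_of_lex (d.2 - c.2) (-(d.1 - c.1)) (-1) ?_⟩
    have key : ∀ z : ℤ × ℤ, (cr c d z < 0 ∨ z = c) →
        0 < (d.2 - c.2) * (z.1 - d.1) + -(d.1 - c.1) * (z.2 - d.2) ∨
        ((d.2 - c.2) * (z.1 - d.1) + -(d.1 - c.1) * (z.2 - d.2) = 0 ∧ 0 < -1 * (z.1 - d.1)) := by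
      rintro z (hz | rfl)
      · left; simp only [cr] at hz; linarith
      · right; exact ⟨by ring, by omega⟩
    simp only [Set.mem_insert_iff, Set.mem_singleton_iff, forall_eq_or_imp, forall_eq]
    refine ⟨key c (Or.inr rfl), key e (Or.inl h), key a ?_, key b ?_⟩
    · rcases h₁.nodeTest.leftEnds with h' | h'
      · exact Or.inr h'.1
      · exact Or.inl h'.2
    · rcases h₁.nodeTest.rightEnds with h' | h'
      · have h3 := Region.fst_mem (h₂.region (show e ∈ _ by simp [Quad.vertices]))
        have h4 := h'.2
        have h5 := congrArg Prod.fst h'.1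
        simp only at h4 h5
        omega
      · exact Or.inl h'.2

/-- The edges that change the lower segment. -/
theorem edge_lower_iff (h₁ : IsNode v ⟨⟨a, b⟩, ⟨c, d⟩⟩) :
    Edge v ⟨⟨a, b⟩, ⟨c, d⟩⟩ ⟨⟨b, e⟩, ⟨c, d⟩⟩ ↔ IsNode v ⟨⟨b, e⟩, ⟨c, d⟩⟩ ∧ 0 < cr a b e := by
  constructor
  · rintro ⟨-, h₂, h⟩
    refine ⟨h₂, (convexJunction_lower_iff h₁ h₂).1 ?_⟩
    rcases h with h | h
    · exact h.2
    · have := h₁.lower_lt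
      have h' := h.1
      simp only [Seg.mk.injEq] at h' this
      rw [h'.1] at this
      exact absurd this (lt_irrefl _)
  · rintro ⟨h₂, h⟩
    exact ⟨h₁, h₂, Or.inl ⟨rfl, (convexJunction_lower_iff h₁ h₂).2 h⟩⟩

/-- The edges that change the upper segment. -/
theorem edge_upper_iff (h₁ : IsNode v ⟨⟨a, b⟩, ⟨c, d⟩⟩) :
    Edge v ⟨⟨a, b⟩, ⟨c, d⟩⟩ ⟨⟨a, b⟩, ⟨d, e⟩⟩ ↔ IsNode v ⟨⟨a, b⟩, ⟨d, e⟩⟩ ∧ cr c d e < 0 := by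
  constructor
  · rintro ⟨-, h₂, h⟩
    refine ⟨h₂, (convexJunction_upper_iff h₁ h₂).1 ?_⟩
    rcases h with h | h
    · have := h₁.upper_lt
      have h' := h.1
      simp only [Seg.mk.injEq] at h' this
      rw [h'.1] at this
      exact absurd this (lt_irrefl _)
    · exact h.2
  · rintro ⟨h₂, h⟩
    exact ⟨h₁, h₂, Or.inr ⟨rfl, (convexJunction_upper_iff h₁ h₂).2 h⟩⟩

/-- The successors of a node. -/
theorem Edge.cases {q : Quad} (h : Edge v ⟨⟨a, b⟩, ⟨c, d⟩⟩ q) :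
    (∃ e, q = ⟨⟨b, e⟩, ⟨c, d⟩⟩) ∨ (∃ e, q = ⟨⟨a, b⟩, ⟨d, e⟩⟩) := by
  obtain ⟨⟨a', b'⟩, ⟨c', d'⟩⟩ := q
  obtain ⟨-, -, ⟨h, h', -⟩ | ⟨h, h', -⟩⟩ := h
  · simp only [Seg.mk.injEq] at h h'
    obtain ⟨rfl, rfl⟩ := h
    subst h'
    exact Or.inl ⟨_, rfl⟩
  · simp only [Seg.mk.injEq] at h h'
    obtain ⟨rfl, rfl⟩ := h
    subst h'
    exact Or.inr ⟨_, rfl⟩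

end

/-! ## From a path to a digital convex set -/

theorem convex_cr_nonneg (p q : ℤ × ℤ) : Convex ℝ {z : ℝ × ℝ |
    0 ≤ ((q.1 : ℝ) - p.1) * (z.2 - p.2) - ((q.2 : ℝ) - p.2) * (z.1 - p.1)} := by
  intro x hx y hy s t hs ht hst
  obtain rfl : t = 1 - s := by linarith
  simp only [Set.mem_ofPred_eq, Prod.fst_add, Prod.smul_fst, Prod.snd_add, Prod.smul_snd,
    smul_eq_mul] at *
  nlinarith [mul_nonneg hs hx, mul_nonneg ht hy]

/-- The lattice points of an intersection of half planes form a digital convex set. -/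
theorem digitalConvex_of_halfPlanes {S : Finset (ℤ × ℤ)} (N : Set ((ℤ × ℤ) × (ℤ × ℤ)))
    (h : ∀ z, z ∈ S ↔ ∀ s ∈ N, 0 ≤ cr s.1 s.2 z) : DigitalConvex S := by
  intro z
  refine ⟨fun hz => subset_convexHull ℝ _ ⟨z, hz, rfl⟩, fun hz => (h z).2 fun s hs => ?_⟩
  have hsub : toPlane '' (S : Set (ℤ × ℤ)) ⊆ {z : ℝ × ℝ |
      0 ≤ ((s.2.1 : ℝ) - s.1.1) * (z.2 - s.1.2) - ((s.2.2 : ℝ) - s.1.2) * (z.1 - s.1.1)} := by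
    rintro _ ⟨w, hw, rfl⟩
    have := (h w).1 hw s hs
    simp only [cr, toPlane, Set.mem_ofPred_eq] at this ⊢
    exact_mod_cast this
  have := convexHull_min hsub (convex_cr_nonneg _ _) hz
  simp only [cr, toPlane, Set.mem_ofPred_eq] at this ⊢
  exact_mod_cast this

/-- At a convex turn `b`, the line of the next edge is the stronger constraint to the right of `b`,
and the line of the previous edge is the stronger one to the left. All four variants follow from one
linear relation between determinants. -/
theorem cr_nonneg_of_right {a b e z : ℤ × ℤ} (hab : a.1 < b.1) (hbe : b.1 < e.1)
    (h : 0 ≤ cr a b e) (hz : b.1 ≤ z.1) (hc : 0 ≤ cr b e z) : 0 ≤ cr a b z := by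
  have key : (e.1 - b.1) * cr a b z = (b.1 - a.1) * cr b e z + cr a b e * (z.1 - b.1) := by
    simp only [cr]; ring
  have h1 : 0 ≤ (b.1 - a.1) * cr b e z := mul_nonneg (by omega) hc
  have h2 : 0 ≤ cr a b e * (z.1 - b.1) := mul_nonneg h (by omega)
  exact nonneg_of_mul_nonneg_right (by omega : 0 ≤ (e.1 - b.1) * cr a b z) (by omega)

theorem cr_nonneg_of_left {a b e z : ℤ × ℤ} (hab : a.1 < b.1) (hbe : b.1 < e.1)
    (h : 0 ≤ cr a b e) (hz : z.1 ≤ b.1) (hc : 0 ≤ cr a b z) : 0 ≤ cr b e z := by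
  have key : (b.1 - a.1) * cr b e z = (e.1 - b.1) * cr a b z + cr a b e * (b.1 - z.1) := by
    simp only [cr]; ring
  have h1 : 0 ≤ (e.1 - b.1) * cr a b z := mul_nonneg (by omega) hc
  have h2 : 0 ≤ cr a b e * (b.1 - z.1) := mul_nonneg h (by omega)
  exact nonneg_of_mul_nonneg_right (by omega : 0 ≤ (b.1 - a.1) * cr b e z) (by omega)

theorem cr_nonpos_of_right {a b e z : ℤ × ℤ} (hab : a.1 < b.1) (hbe : b.1 < e.1)
    (h : cr a b e ≤ 0) (hz : b.1 ≤ z.1) (hc : cr b e z ≤ 0) : cr a b z ≤ 0 := by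
  have key : (e.1 - b.1) * cr a b z = (b.1 - a.1) * cr b e z + cr a b e * (z.1 - b.1) := by
    simp only [cr]; ring
  have h1 : (b.1 - a.1) * cr b e z ≤ 0 := mul_nonpos_of_nonneg_of_nonpos (by omega) hc
  have h2 : cr a b e * (z.1 - b.1) ≤ 0 := mul_nonpos_of_nonpos_of_nonneg h (by omega)
  exact nonpos_of_mul_nonpos_right (by omega : (e.1 - b.1) * cr a b z ≤ 0) (by omega)

theorem cr_nonpos_of_left {a b e z : ℤ × ℤ} (hab : a.1 < b.1) (hbe : b.1 < e.1)
    (h : cr a b e ≤ 0) (hz : z.1 ≤ b.1) (hc : cr a b z ≤ 0) : cr b e z ≤ 0 := by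
  have key : (b.1 - a.1) * cr b e z = (e.1 - b.1) * cr a b z + cr a b e * (b.1 - z.1) := by
    simp only [cr]; ring
  have h1 : (e.1 - b.1) * cr a b z ≤ 0 := mul_nonpos_of_nonneg_of_nonpos (by omega) hc
  have h2 : cr a b e * (b.1 - z.1) ≤ 0 := mul_nonpos_of_nonpos_of_nonneg h (by omega)
  exact nonpos_of_mul_nonpos_right (by omega : (b.1 - a.1) * cr b e z ≤ 0) (by omega)

/-- The point `z` is above the line of the segment. -/
def Seg.Below (s : Seg) (z : ℤ × ℤ) : Prop := 0 ≤ cr s.left s.right z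

/-- The point `z` is below the line of the segment. -/
def Seg.Above (s : Seg) (z : ℤ × ℤ) : Prop := cr s.left s.right z ≤ 0

section
variable {m : ℕ} {v : Fin m → ℤ}

/-- The set `N` of quads describes the boundary of a convex set on the left of the right end of
the quad `q`. -/
structure Envelope (v : Fin m → ℤ) (q : Quad) (N : Set Quad) : Prop where
  mem : q ∈ N
  node : IsNode v q
  lower : ∀ z : ℤ × ℤ, q.lower.left.1 ≤ z.1 → q.lower.Below z → ∀ q' ∈ N, q'.lower.Below z
  upper : ∀ z : ℤ × ℤ, q.upper.left.1 ≤ z.1 → q.upper.Above z → ∀ q' ∈ N, q'.upper.Above z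
  cover : ∀ i : ℤ, 0 ≤ i → i ≤ q.last → ∃ q₀ ∈ N, IsNode v q₀ ∧ q₀.first ≤ i ∧ i ≤ q₀.last ∧
    ∀ y : ℤ, q₀.lower.Below (i, y) → q₀.upper.Above (i, y) →
      ∀ q' ∈ N, q'.lower.Below (i, y) ∧ q'.upper.Above (i, y)

/-- Both left ends are in column `0`, so the single node covers every column up to its last one. -/
theorem IsLeft.envelope {q : Quad} (h : IsLeft v q) : Envelope v q {q} := by
  obtain ⟨h, hl, hm, hu⟩ := h
  refine ⟨rfl, h, ?_, ?_, fun i hi hi' => ⟨q, rfl, h, ?_, hi', ?_⟩⟩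
  · rintro z - hz q' rfl; exact hz
  · rintro z - hz q' rfl; exact hz
  · simpa [Quad.first, hl, hu] using hi
  · rintro y h1 h2 q' rfl; exact ⟨h1, h2⟩

/-- By the convex turn at the junction, the new line is implied by the old one to the left of the
junction and implies it, hence all the older ones on its side, to the right. So the old nodes still
describe the columns up to the junction, and the new node describes those beyond it. -/
theorem Envelope.step {q q' : Quad} {N : Set Quad} (h : Envelope v q N) (he : Edge v q q') :
    Envelope v q' (insert q' N) := by
  have hn' := he.2.1
  obtain ⟨hmem, hn, hlow, hupp, hcov⟩ := h
  obtain ⟨⟨a, b⟩, ⟨c, d⟩⟩ := q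
  rcases he.cases with ⟨e, rfl⟩ | ⟨e, rfl⟩
  · have hcr := ((edge_lower_iff hn).1 he).2
    have hab : a.1 < b.1 := hn.lower_lt
    have hbe : b.1 < e.1 := hn'.lower_lt
    have hcb := hn.le_of_le.1
    have hbd := hn'.le_of_le.2
    simp only [Quad.first, Quad.last, Seg.Below, Seg.Above] at *
    refine ⟨by simp, hn', ?_, ?_, ?_⟩
    · rintro z hz hz' q' (rfl | hq')
      · exact hz'
      · exact hlow z (hab.le.trans hz) (cr_nonneg_of_right hab hbe hcr.le hz hz') _ hq'
    · rintro z hz hz' q' (rfl | hq')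
      · exact hz'
      · exact hupp z hz hz' _ hq'
    · intro i hi hi'
      rcases le_or_gt i b.1 with hib | hib
      · obtain ⟨q₀, hq₀, hnq₀, h1, h2, h3⟩ := hcov i hi
          (le_min hib (hi'.trans (min_le_right _ _)))
        refine ⟨q₀, Or.inr hq₀, hnq₀, h1, h2, fun y y1 y2 q' => ?_⟩
        rintro (rfl | hq')
        · obtain ⟨h4, h5⟩ := h3 y y1 y2 _ hmem
          exact ⟨cr_nonneg_of_left hab hbe hcr.le hib h4, h5⟩
        · exact h3 y y1 y2 _ hq'
      · refine ⟨_, Or.inl rfl, hn', max_le hib.le (hcb.trans hib.le), hi', fun y y1 y2 q' => ?_⟩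
        rintro (rfl | hq')
        · exact ⟨y1, y2⟩
        · exact ⟨hlow (i, y) (hab.le.trans hib.le)
            (cr_nonneg_of_right hab hbe hcr.le hib.le y1) _ hq',
            hupp (i, y) (hcb.trans hib.le) y2 _ hq'⟩
  · have hcr := ((edge_upper_iff hn).1 he).2
    have hcd : c.1 < d.1 := hn.upper_lt
    have hde : d.1 < e.1 := hn'.upper_lt
    have had := hn.le_of_le.2
    have hdb := hn'.le_of_le.1
    simp only [Quad.first, Quad.last, Seg.Below, Seg.Above] at *
    refine ⟨by simp, hn', ?_, ?_, ?_⟩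
    · rintro z hz hz' q' (rfl | hq')
      · exact hz'
      · exact hlow z hz hz' _ hq'
    · rintro z hz hz' q' (rfl | hq')
      · exact hz'
      · exact hupp z (hcd.le.trans hz) (cr_nonpos_of_right hcd hde hcr.le hz hz') _ hq'
    · intro i hi hi'
      rcases le_or_gt i d.1 with hib | hib
      · obtain ⟨q₀, hq₀, hnq₀, h1, h2, h3⟩ := hcov i hi
          (le_min (hi'.trans (min_le_left _ _)) hib)
        refine ⟨q₀, Or.inr hq₀, hnq₀, h1, h2, fun y y1 y2 q' => ?_⟩
        rintro (rfl | hq')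
        · obtain ⟨h4, h5⟩ := h3 y y1 y2 _ hmem
          exact ⟨h4, cr_nonpos_of_left hcd hde hcr.le hib h5⟩
        · exact h3 y y1 y2 _ hq'
      · refine ⟨_, Or.inl rfl, hn', max_le (had.trans hib.le) hib.le, hi', fun y y1 y2 q' => ?_⟩
        rintro (rfl | hq')
        · exact ⟨y1, y2⟩
        · exact ⟨hlow (i, y) (had.trans hib.le) y1 _ hq',
            hupp (i, y) (hcd.le.trans hib.le)
            (cr_nonpos_of_right hcd hde hcr.le hib.le y2) _ hq'⟩

theorem exists_envelope {q₁ q : Quad} (h : IsLeft v q₁) (hp : Relation.ReflTransGen (Edge v) q₁ q) :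
    ∃ N, Envelope v q N := by
  induction hp with
  | refl => exact ⟨_, h.envelope⟩
  | tail _ he ih => obtain ⟨N, hN⟩ := ih; exact ⟨_, hN.step he⟩

theorem IsNode.between_iff {q : Quad} (h : IsNode v q) (i y : ℤ) :
    (q.lower.Below (i, y) ∧ q.upper.Above (i, y)) ↔
      ⌈q.lower.height i⌉ ≤ y ∧ y ≤ ⌊q.upper.height i⌋ := by
  rw [Int.ceil_le, Int.le_floor, Seg.height_le_iff _ h.lower_lt, Seg.le_height_iff _ h.upper_lt]
  rfl

/-- Guards against truncation: the cardinality of an integer interval is `Int.toNat (u + 1 - l)`,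
which agrees with `u - l + 1` for an empty column only if `l ≤ u + 1`. -/
theorem ceil_le_floor_add_one {x y : ℚ} (h : x ≤ y) : ⌈x⌉ ≤ ⌊y⌋ + 1 :=
  (Int.ceil_mono h).trans (Int.ceil_le_floor_add_one y)

/-- The lattice set with the given columns. -/
noncomputable def ofColumns {m : ℕ} (l u : Fin m → ℤ) : Finset (ℤ × ℤ) :=
  Finset.univ.biUnion fun i : Fin m => (Finset.Icc (l i) (u i)).image fun y => (((i : ℕ) : ℤ), y)

theorem mem_ofColumns {l u : Fin m → ℤ} {z : ℤ × ℤ} : z ∈ ofColumns l u ↔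
    ∃ i : Fin m, z.1 = ((i : ℕ) : ℤ) ∧ l i ≤ z.2 ∧ z.2 ≤ u i := by
  simp only [ofColumns, Finset.mem_biUnion, Finset.mem_univ, true_and, Finset.mem_image,
    Finset.mem_Icc]
  refine exists_congr fun i => ⟨?_, ?_⟩
  · rintro ⟨y, h, rfl⟩; exact ⟨rfl, h⟩
  · rintro ⟨h1, h2⟩; exact ⟨z.2, h2, by rw [← h1]⟩

theorem hasVerticalXRay_ofColumns {l u : Fin m → ℤ} (h : ∀ i, u i - l i + 1 = v i)
    (h' : ∀ i, l i ≤ u i + 1) : HasVerticalXRay v (ofColumns l u) := by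
  refine ⟨fun p hp => ?_, fun i => ?_⟩
  · obtain ⟨i, hi, -⟩ := mem_ofColumns.1 hp
    have := i.2
    omega
  · have : (ofColumns l u).filter (fun p => p.1 = ((i : ℕ) : ℤ)) =
        (Finset.Icc (l i) (u i)).image fun y => (((i : ℕ) : ℤ), y) := by
      ext z
      simp only [Finset.mem_filter, mem_ofColumns, Finset.mem_image, Finset.mem_Icc]
      constructor
      · rintro ⟨⟨j, hj, h⟩, hi⟩
        obtain rfl : i = j := Fin.ext (by omega)
        exact ⟨z.2, h, by rw [← hi]⟩
      · rintro ⟨y, h, rfl⟩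
        exact ⟨⟨i, rfl, h⟩, rfl⟩
    rw [this, Finset.card_image_of_injective _ (fun _ _ h => (Prod.mk.inj h).2), Int.card_Icc]
    have := h i
    have := h' i
    omega

/-- The set is cut out by the half planes of all the segments of the envelope of the path. In each
column, the node given by `Envelope.cover` implies all the other constraints, and its count is the
prescribed one. -/
theorem HasPath.dtc (h : HasPath v) : DTC v := by
  obtain ⟨q₁, q, hq₁, ⟨hn, hm, y, -, -, hl, hu⟩, hp⟩ := h
  obtain ⟨N, hN⟩ := exists_envelope hq₁ hp
  have hlast : q.last = (m : ℤ) - 1 := by simp [Quad.last, hl, hu]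
  have hcol : ∀ i : Fin m, ∃ l u : ℤ, u - l + 1 = v i ∧ l ≤ u + 1 ∧
      ∀ y : ℤ, (l ≤ y ∧ y ≤ u) ↔
        ∀ q' ∈ N, q'.lower.Below (((i : ℕ) : ℤ), y) ∧ q'.upper.Above (((i : ℕ) : ℤ), y) := by
    intro i
    have := i.2
    obtain ⟨q₀, hq₀, hn₀, h1, h2, h3⟩ := hN.cover (i : ℕ) (by omega) (by omega)
    refine ⟨⌈q₀.lower.height (i : ℕ)⌉, ⌊q₀.upper.height (i : ℕ)⌋, hn₀.xray i h1 h2,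
      ceil_le_floor_add_one (hn₀.above _ h1 h2), fun y => ?_⟩
    rw [← hn₀.between_iff]
    exact ⟨fun h => h3 y h.1 h.2, fun h => h _ hq₀⟩
  choose l u h1 h2 h3 using hcol
  refine ⟨ofColumns l u, ?_, hasVerticalXRay_ofColumns h1 h2⟩
  -- The upper segments are reversed so that the points below them have nonnegative determinant. The
  -- last two oriented lines express `0 ≤ x` and `x ≤ m - 1`.
  refine digitalConvex_of_halfPlanes ({s | ∃ q ∈ N, s = (q.lower.left, q.lower.right) ∨
    s = (q.upper.right, q.upper.left)} ∪
    {((0, 1), (0, 0)), (((m : ℤ) - 1, 0), ((m : ℤ) - 1, 1))}) fun z => ?_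
  have hsw : ∀ (p q : ℤ × ℤ), 0 ≤ cr q p z ↔ cr p q z ≤ 0 := by
    intro p q
    have : cr q p z = - cr p q z := by simp only [cr]; ring
    omega
  rw [mem_ofColumns]
  constructor
  · rintro ⟨i, hi, h⟩ s (⟨q, hq, rfl | rfl⟩ | rfl | rfl)
    · have := (h3 i z.2).1 h q hq
      rw [← hi] at this
      exact this.1
    · have := (h3 i z.2).1 h q hq
      rw [← hi] at this
      exact (hsw _ _).2 this.2
    · simp [cr]; omega
    · have := i.2
      simp [cr]; omega
  · intro h
    have h4 := h ((0, 1), (0, 0)) (by simp)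
    have h5 := h (((m : ℤ) - 1, 0), ((m : ℤ) - 1, 1)) (by simp)
    simp [cr] at h4 h5
    lift z.1 to ℕ using h4 with k hk
    refine ⟨⟨k, by omega⟩, rfl, (h3 _ _).2 fun q hq => ?_⟩
    simp only [hk]
    exact ⟨h (q.lower.left, q.lower.right) (Or.inl ⟨q, hq, Or.inl rfl⟩),
      (hsw _ _).1 (h (q.upper.right, q.upper.left) (Or.inl ⟨q, hq, Or.inr rfl⟩))⟩

end

/-! ## Affine maps of the lattice that preserve the columns -/

/-- A shear followed by a translation. -/
def shear (a b c : ℤ) : ℤ × ℤ ≃ ℤ × ℤ where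
  toFun z := (z.1 + a, z.2 + b + c * z.1)
  invFun z := (z.1 - a, z.2 - b - c * (z.1 - a))
  left_inv z := by ext <;> dsimp <;> ring
  right_inv z := by ext <;> dsimp <;> ring

/-- The lattice bijection is the restriction of an injective affine map of the plane, which commutes
with convex hulls. -/
theorem DigitalConvex.map_shear {S : Finset (ℤ × ℤ)} (h : DigitalConvex S) (a b c : ℤ) :
    DigitalConvex (S.map (shear a b c).toEmbedding) := by
  intro z
  let L : ℝ × ℝ →ₗ[ℝ] ℝ × ℝ :=
    { toFun := fun z => (z.1, z.2 + c * z.1)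
      map_add' := fun x y => by ext <;> simp; ring
      map_smul' := fun r x => by ext <;> simp; ring }
  let F : ℝ × ℝ →ᵃ[ℝ] ℝ × ℝ := L.toAffineMap + AffineMap.const ℝ (ℝ × ℝ) ((a : ℝ), (b : ℝ))
  have hF : ∀ z : ℝ × ℝ, F z = (z.1 + a, z.2 + c * z.1 + b) := fun z => by
    simp [F, L]
  have hFz : ∀ z : ℤ × ℤ, toPlane (shear a b c z) = F (toPlane z) := fun z => by
    rw [hF]
    simp [shear, toPlane]
    ring
  have hinj : Function.Injective F := by
    intro x y hxy
    rw [hF, hF, Prod.mk.injEq] at hxy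
    obtain ⟨h1, h2⟩ := hxy
    have h1 : x.1 = y.1 := by linarith
    rw [h1] at h2
    exact Prod.ext h1 (by linarith)
  have himg : toPlane '' ((S.map (shear a b c).toEmbedding : Finset (ℤ × ℤ)) : Set (ℤ × ℤ)) =
      F '' (toPlane '' (S : Set (ℤ × ℤ))) := by
    rw [Finset.coe_map, Set.image_image, Set.image_image]
    exact Set.image_congr fun z _ => hFz z
  rw [himg, ← AffineMap.image_convexHull]
  obtain ⟨w, rfl⟩ := (shear a b c).surjective z
  rw [hFz, hinj.mem_set_image, ← h w]
  simp

theorem card_column_map_shear (S : Finset (ℤ × ℤ)) (a b c i : ℤ) :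
    ((S.map (shear a b c).toEmbedding).filter (fun p => p.1 = i + a)).card =
      (S.filter (fun p => p.1 = i)).card := by
  rw [Finset.filter_map, Finset.card_map]
  congr 1
  ext z
  rw [Finset.mem_filter, Finset.mem_filter]
  simp [shear]

/-! ## Edges of the convex hull -/

/-- The points `p` and `q` are the left and the right end of an edge of the convex hull of `S`:
on the lower side if `ε = 1`, on the upper side if `ε = -1`. -/
structure HullEdge (ε : ℤ) (S : Finset (ℤ × ℤ)) (p q : ℤ × ℤ) : Prop where
  left_mem : p ∈ S
  right_mem : q ∈ S
  lt : p.1 < q.1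
  side : ∀ z ∈ S, 0 ≤ ε * cr p q z
  between : ∀ z ∈ S, cr p q z = 0 → p.1 ≤ z.1 ∧ z.1 ≤ q.1

section
variable {S : Finset (ℤ × ℤ)} {ε : ℤ}

/-- One step of gift wrapping: seen from `p`, the extreme slope is attained, and the farthest point
is taken among ties. The last clause yields maximal edges, as `HullEdge.between` requires. -/
theorem exists_min_slope {T : Finset (ℤ × ℤ)} (hT : T.Nonempty) (p : ℤ × ℤ)
    (hp : ∀ z ∈ T, p.1 < z.1) (hε : ε = 1 ∨ ε = -1) :
    ∃ e ∈ T, ∀ z ∈ T, 0 ≤ ε * cr p e z ∧ (cr p e z = 0 → z.1 ≤ e.1) := by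
  induction hT using Finset.Nonempty.cons_induction with
  | singleton a =>
    refine ⟨a, by simp, fun z hz => ?_⟩
    obtain rfl := Finset.mem_singleton.1 hz
    have : cr p z z = 0 := by simp only [cr]; ring
    simp [this]
  | cons a T ha hT ih =>
    obtain ⟨e, he, hmin⟩ := ih fun z hz => hp z (by simp [hz])
    have h1 := hp a (by simp)
    have h2 := hp e (by simp [he])
    -- Comparison of slopes from `p` is transitive: if the new point `a` beats the current best `e`,
    -- then it also beats every `z` that `e` beats.
    have key : ∀ z, (e.1 - p.1) * cr p a z = (a.1 - p.1) * cr p e z - (z.1 - p.1) * cr p e a := by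
      intro z; simp only [cr]; ring
    by_cases hc : 0 < ε * cr p e a ∨ (cr p e a = 0 ∧ a.1 ≤ e.1)
    · refine ⟨e, by simp [he], fun z hz => ?_⟩
      rcases Finset.mem_cons.1 hz with rfl | hz
      · rcases hc with hc | hc
        · exact ⟨hc.le, fun h => by rw [h] at hc; simp at hc⟩
        · exact ⟨by simp [hc.1], fun _ => hc.2⟩
      · exact hmin z hz
    · push Not at hc
      refine ⟨a, by simp, fun z hz => ?_⟩
      rcases Finset.mem_cons.1 hz with rfl | hz
      · have : cr p z z = 0 := by simp only [cr]; ring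
        simp [this]
      have h3 := hp z (by simp [hz])
      obtain ⟨h4, h5⟩ := hmin z hz
      have h6 : (e.1 - p.1) * (ε * cr p a z) =
          (a.1 - p.1) * (ε * cr p e z) + (z.1 - p.1) * (-(ε * cr p e a)) := by
        linear_combination ε * key z
      have h7 : 0 ≤ (a.1 - p.1) * (ε * cr p e z) := mul_nonneg (by omega) h4
      have h8 : 0 ≤ (z.1 - p.1) * (-(ε * cr p e a)) := mul_nonneg (by omega) (by omega)
      refine ⟨nonneg_of_mul_nonneg_right (by omega : 0 ≤ (e.1 - p.1) * (ε * cr p a z)) (by omega),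
        fun h => ?_⟩
      rw [h] at h6
      have h9 : (z.1 - p.1) * (-(ε * cr p e a)) = 0 := by linarith
      have h10 : ε * cr p e a = 0 := by
        have := (mul_eq_zero.1 h9).resolve_left (by omega)
        omega
      have h11 : cr p e a = 0 := (mul_eq_zero.1 h10).resolve_left (by omega)
      have h12 : (a.1 - p.1) * (ε * cr p e z) = 0 := by linarith
      have h13 : cr p e z = 0 :=
        (mul_eq_zero.1 ((mul_eq_zero.1 h12).resolve_left (by omega))).resolve_left (by omega)
      have := h5 h13
      have := hc.2 h11
      omega

/-- The first edge of the convex hull on the lower or upper side. -/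
theorem exists_first_hullEdge (hε : ε = 1 ∨ ε = -1) {p z : ℤ × ℤ} (hp : p ∈ S) (hz : z ∈ S)
    (hpz : p.1 < z.1) (hleft : ∀ w ∈ S, p.1 ≤ w.1) (hlow : ∀ w ∈ S, w.1 = p.1 → ε * p.2 ≤ ε * w.2) :
    ∃ e, HullEdge ε S p e := by
  obtain ⟨e, he, h⟩ := exists_min_slope (T := S.filter fun w => p.1 < w.1)
    ⟨z, by simp [hz, hpz]⟩ p (by simp) hε
  simp only [Finset.mem_filter, and_imp] at he h
  refine ⟨e, hp, he.1, he.2, fun w hw => ?_, fun w hw hw' => ⟨hleft w hw, ?_⟩⟩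
  · rcases (hleft w hw).lt_or_eq with h1 | h1
    · exact (h w hw h1).1
    · have h2 := hlow w hw h1.symm
      have : ε * cr p e w = (e.1 - p.1) * (ε * w.2 - ε * p.2) := by
        simp only [cr, ← h1]; ring
      rw [this]
      exact mul_nonneg (by omega) (by omega)
  · rcases (hleft w hw).lt_or_eq with h1 | h1
    · exact (h w hw h1).2 hw'
    · omega

/-- A point on the line of the edge would lie over the edge, by maximality. -/
theorem HullEdge.cr_pos {a b z : ℤ × ℤ} (h : HullEdge ε S a b) (hε : ε = 1 ∨ ε = -1) (hz : z ∈ S)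
    (hzb : z.1 < a.1 ∨ b.1 < z.1) : 0 < ε * cr a b z := by
  refine (h.side z hz).lt_of_ne fun h0 => ?_
  have h1 := (mul_eq_zero.1 h0.symm).resolve_left (by omega)
  have := h.between z hz h1
  omega

/-- The next edge of the convex hull. -/
theorem HullEdge.exists_next {a b z : ℤ × ℤ} (hab : HullEdge ε S a b) (hε : ε = 1 ∨ ε = -1)
    (hz : z ∈ S) (hbz : b.1 < z.1) : ∃ e, HullEdge ε S b e := by
  obtain ⟨e, he, h⟩ := exists_min_slope (T := S.filter fun w => b.1 < w.1)
    ⟨z, by simp [hz, hbz]⟩ b (by simp) hε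
  simp only [Finset.mem_filter, and_imp] at he h
  have hlt := hab.lt
  have hpos := hab.cr_pos hε he.1 (Or.inr he.2)
  -- The next edge has extreme slope among the points on the right of `b` only. This relation, with
  -- the strict turn `hpos`, shows that the other points are on the good side too, and that none
  -- strictly to the left of `b` is on its line.
  have key : ∀ w, (b.1 - a.1) * (ε * cr b e w) =
      (e.1 - b.1) * (ε * cr a b w) + (ε * cr a b e) * (b.1 - w.1) := by
    intro w; simp only [cr]; ring
  refine ⟨e, hab.right_mem, he.1, he.2, fun w hw => ?_, fun w hw hw' => ?_⟩
  · rcases lt_or_ge b.1 w.1 with h1 | h1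
    · exact (h w hw h1).1
    · have h2 : 0 ≤ (e.1 - b.1) * (ε * cr a b w) := mul_nonneg (by omega) (hab.side w hw)
      have h3 : 0 ≤ (ε * cr a b e) * (b.1 - w.1) := mul_nonneg hpos.le (by omega)
      have := key w
      exact nonneg_of_mul_nonneg_right
        (by omega : 0 ≤ (b.1 - a.1) * (ε * cr b e w)) (by omega)
  · rcases lt_or_ge b.1 w.1 with h1 | h1
    · exact ⟨h1.le, (h w hw h1).2 hw'⟩
    · have h2 : 0 ≤ (e.1 - b.1) * (ε * cr a b w) := mul_nonneg (by omega) (hab.side w hw)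
      have h4 := key w
      rw [hw'] at h4
      refine ⟨?_, by omega⟩
      by_contra! hc
      have h3 : 0 < (ε * cr a b e) * (b.1 - w.1) := mul_pos hpos (by omega)
      linarith

/-- An upper edge that starts on a lower edge starts in the first column. -/
theorem HullEdge.left_eq {p q r s z : ℤ × ℤ} (hε : ε = 1 ∨ ε = -1) (h : HullEdge ε S p q)
    (h' : HullEdge (-ε) S r s) (hz : z ∈ S) (hleft : ∀ w ∈ S, z.1 ≤ w.1) (h0 : cr p q r = 0) :
    p = r ∧ p.1 = z.1 := by
  have hε' : -ε = 1 ∨ -ε = -1 := by omega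
  have hpq := h.lt
  have hrs := h'.lt
  obtain ⟨h1, h2⟩ := h.between r h'.left_mem h0
  have h3 := h'.side p h.left_mem
  have hpr : p.1 = r.1 := by
    by_contra hne
    have h4 := h'.cr_pos hε' h.left_mem (Or.inl (by omega))
    have h5 := h'.side q h.right_mem
    -- If `r` is on `p q` but not at `p`, it is a barycentre of `p` and `q`, both on the good side
    -- of `r s`, with `p` strictly so. The weight of `p` must vanish, that is `r = q`; then `s` and
    -- `p` give contradictory signs for the same triangle.
    have key : (q.1 - p.1) * cr r s r = (q.1 - r.1) * cr r s p + (r.1 - p.1) * cr r s q +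
        (s.1 - r.1) * cr p q r := by
      simp only [cr]; ring
    have hrr : cr r s r = 0 := by simp [cr]
    rw [hrr, h0] at key
    have h6 : 0 ≤ (q.1 - r.1) * (-ε * cr r s p) := mul_nonneg (by omega) h4.le
    have h7 : 0 ≤ (r.1 - p.1) * (-ε * cr r s q) := mul_nonneg (by omega) h5
    have h8 : (q.1 - r.1) * (-ε * cr r s p) + (r.1 - p.1) * (-ε * cr r s q) = 0 := by
      linear_combination ε * key
    have h9 : (q.1 - r.1) * (-ε * cr r s p) = 0 := by linarith
    have h10 : q.1 = r.1 := by
      rcases mul_eq_zero.1 h9 with h | h <;> omega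
    have h11 := h.cr_pos hε h'.right_mem (Or.inr (by omega))
    have hqr : q.2 = r.2 := by
      have : (q.1 - p.1) * (r.2 - q.2) = 0 := by
        rw [← h0]; simp only [cr, ← h10]; ring
      have := (mul_eq_zero.1 this).resolve_left (by omega)
      omega
    obtain rfl : q = r := Prod.ext h10 hqr
    have h12 : cr p q s = cr q s p := by simp only [cr]; ring
    rw [h12] at h11
    linarith
  have h4 : p.2 = r.2 := by
    have : (q.1 - p.1) * (r.2 - p.2) = 0 := by
      rw [← h0]; simp only [cr, ← hpr]; ring
    have := (mul_eq_zero.1 this).resolve_left (by omega)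
    omega
  obtain rfl : p = r := Prod.ext hpr h4
  refine ⟨rfl, (hleft p h.left_mem).antisymm' ?_⟩
  by_contra! hc
  have h5 := h.cr_pos hε hz (Or.inl hc)
  have h6 := h'.cr_pos hε' hz (Or.inl hc)
  have h7 := h.side s h'.right_mem
  -- The two edges starting from `p` open to the right, so the half planes that they bound cannot
  -- both contain a point on the left of `p`.
  have key : (s.1 - p.1) * (ε * cr p q z) + (q.1 - p.1) * (-ε * cr p s z) =
      (z.1 - p.1) * (ε * cr p q s) := by
    simp only [cr]; ring
  have h8 : 0 < (s.1 - p.1) * (ε * cr p q z) := mul_pos (by omega) h5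
  have h9 : 0 < (q.1 - p.1) * (-ε * cr p s z) := mul_pos (by omega) h6
  have h10 : (z.1 - p.1) * (ε * cr p q s) ≤ 0 := mul_nonpos_of_nonpos_of_nonneg (by omega) h7
  linarith

end

/-! ## From a digital convex set to a path -/

/-- The reflection in a vertical line. -/
def flip : ℤ × ℤ ≃ ℤ × ℤ := (Equiv.neg ℤ).prodCongr (Equiv.refl ℤ)

theorem flip_fst (z : ℤ × ℤ) : (flip z).1 = - z.1 := rfl

theorem flip_snd (z : ℤ × ℤ) : (flip z).2 = z.2 := rfl

theorem cr_flip (p q z : ℤ × ℤ) : cr (flip q) (flip p) (flip z) = cr p q z := by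
  simp only [cr, flip_fst, flip_snd]; ring

section
variable {S : Finset (ℤ × ℤ)} {ε : ℤ}

theorem HullEdge.flip {p q : ℤ × ℤ} (h : HullEdge ε S p q) :
    HullEdge ε (S.map XRay.flip.toEmbedding) (XRay.flip q) (XRay.flip p) := by
  obtain ⟨h1, h2, h3, h4, h5⟩ := h
  refine ⟨Finset.mem_map_of_mem _ h2, Finset.mem_map_of_mem _ h1, ?_, ?_, ?_⟩
  · simp only [flip_fst]; omega
  · intro w hw
    obtain ⟨z, hz, rfl⟩ := Finset.mem_map.1 hw
    simpa only [Equiv.coe_toEmbedding, cr_flip] using h4 z hz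
  · intro w hw h0
    obtain ⟨z, hz, rfl⟩ := Finset.mem_map.1 hw
    simp only [Equiv.coe_toEmbedding, cr_flip] at h0
    have := h5 z hz h0
    simp only [Equiv.coe_toEmbedding, flip_fst]
    omega

/-- An upper edge that ends on a lower edge ends in the last column. -/
theorem HullEdge.right_eq {p q r s z : ℤ × ℤ} (hε : ε = 1 ∨ ε = -1) (h : HullEdge ε S p q)
    (h' : HullEdge (-ε) S r s) (hz : z ∈ S) (hright : ∀ w ∈ S, w.1 ≤ z.1) (h0 : cr p q s = 0) :
    q = s ∧ q.1 = z.1 := by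
  obtain ⟨h1, h2⟩ := h.flip.left_eq hε h'.flip (z := XRay.flip z) (Finset.mem_map_of_mem _ hz)
    (by
      intro w hw
      obtain ⟨y, hy, rfl⟩ := Finset.mem_map.1 hw
      have := hright y hy
      simp only [Equiv.coe_toEmbedding, flip_fst]
      omega) (by rw [cr_flip]; exact h0)
  exact ⟨XRay.flip.injective h1, by simp only [flip_fst] at h2; omega⟩

end

/-- A digital convex set with X-ray `v` that starts at the origin and ends above a point of the
last column of the triangle. -/
structure Normalized {m : ℕ} (v : Fin m → ℤ) (S : Finset (ℤ × ℤ)) (y : ℤ) : Prop where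
  two_le : 2 ≤ m
  convex : DigitalConvex S
  xray : HasVerticalXRay v S
  first_mem : (0, 0) ∈ S
  first_le : ∀ z ∈ S, z.1 = 0 → 0 ≤ z.2
  last_mem : ((m : ℤ) - 1, y) ∈ S
  last_le : ∀ z ∈ S, z.1 = (m : ℤ) - 1 → y ≤ z.2
  nonneg : 0 ≤ y
  le : y ≤ (m : ℤ) - 1

/-- In a column, the lattice points between a point of the set and a chord of the set are in the
hull, since vertical slices of a convex set are intervals. -/
theorem DigitalConvex.vertical {S : Finset (ℤ × ℤ)} (h : DigitalConvex S) {a b z : ℤ × ℤ} {y : ℤ}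
    (ha : a ∈ S) (hb : b ∈ S) (hz : z ∈ S) (hab : a.1 < b.1) (haz : a.1 ≤ z.1) (hzb : z.1 ≤ b.1)
    (hy : (cr a b (z.1, y) ≤ 0 ∧ z.2 ≤ y) ∨ (0 ≤ cr a b (z.1, y) ∧ y ≤ z.2)) : (z.1, y) ∈ S := by
  rw [h]
  have h1 := segment_mem_convexHull (T := S) ha hb hab haz hzb
  have h2 : ((z.1 : ℝ), (z.2 : ℝ)) ∈ convexHull ℝ (toPlane '' (S : Set (ℤ × ℤ))) :=
    subset_convexHull ℝ _ ⟨z, hz, rfl⟩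
  have hab' : (0 : ℝ) < b.1 - a.1 := by
    have : (a.1 : ℝ) < b.1 := by exact_mod_cast hab
    linarith
  rcases hy with ⟨hc, hy⟩ | ⟨hc, hy⟩
  · refine ((convex_convexHull ℝ _).ordConnected_vertical _).out h2 h1 ⟨?_, ?_⟩
    · exact_mod_cast hy
    · have : ((b.1 - a.1) * (y - a.2) - (b.2 - a.2) * (z.1 - a.1) : ℝ) ≤ 0 := by
        exact_mod_cast hc
      rw [← sub_le_iff_le_add', le_div_iff₀ hab']
      dsimp only
      linarith
  · refine ((convex_convexHull ℝ _).ordConnected_vertical _).out h1 h2 ⟨?_, ?_⟩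
    · have : (0 : ℝ) ≤ ((b.1 - a.1) * (y - a.2) - (b.2 - a.2) * (z.1 - a.1) : ℝ) := by
        exact_mod_cast hc
      rw [← le_sub_iff_add_le', div_le_iff₀ hab']
      dsimp only
      linarith
    · exact_mod_cast hy

section
variable {m : ℕ} {v : Fin m → ℤ}

theorem HasVerticalXRay.length_le {S : Finset (ℤ × ℤ)} (h : HasVerticalXRay v S) (i : Fin m) {l u : ℤ}
    (hlu : ∀ y, l ≤ y → y ≤ u → (((i : ℕ) : ℤ), y) ∈ S) : u - l + 1 ≤ v i := by
  rw [← h.2 i]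
  have : (Finset.Icc l u).card ≤ (S.filter (fun p => p.1 = ((i : ℕ) : ℤ))).card := by
    rw [← Finset.card_image_of_injective (Finset.Icc l u)
      (f := fun y => (((i : ℕ) : ℤ), y)) (fun _ _ h => (Prod.mk.inj h).2)]
    refine Finset.card_le_card fun z hz => ?_
    simp only [Finset.mem_image, Finset.mem_Icc] at hz
    obtain ⟨y, hy, rfl⟩ := hz
    simp [hlu y hy.1 hy.2]
  rw [Int.card_Icc] at this
  omega

variable {S : Finset (ℤ × ℤ)} {Y : ℤ}

/-- In column `i` the chord from the origin to `(m - 1, Y)` has height between `0` and `i`. If a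
point of the set is above `i` or below `0`, all the lattice points from it to the triangle are in
the set, and there are at most `v i` of them. -/
theorem Normalized.subset_region (h : Normalized v S Y) {z : ℤ × ℤ} (hz : z ∈ S) :
    z ∈ Region v := by
  obtain ⟨h1, h2⟩ := h.xray.1 z hz
  obtain ⟨x, y⟩ := z
  lift x to ℕ using h1 with i
  have hi : i < m := by simpa using h2
  have h3 := h.nonneg
  have h4 := h.le
  have h5 := h.two_le
  have hcr : ∀ y' : ℤ, cr (0, 0) ((m : ℤ) - 1, Y) (((i : ℕ) : ℤ), y') = ((m : ℤ) - 1) * y' - Y * i := by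
    intro y'; simp [cr]
  have hcol : ∀ y' : ℤ, (((i : ℤ) ≤ y' ∧ y' ≤ y) ∨ (y ≤ y' ∧ y' ≤ 0)) → ((i : ℤ), y') ∈ S := by
    intro y' hy'
    refine h.convex.vertical h.first_mem h.last_mem hz (by simp only; omega) (by simp)
      (by simp only; omega) ?_
    rw [hcr]
    rcases hy' with ⟨h6, h7⟩ | ⟨h6, h7⟩
    · right
      refine ⟨?_, h7⟩
      have : Y * i ≤ ((m : ℤ) - 1) * i := mul_le_mul_of_nonneg_right h4 (by omega)
      have : ((m : ℤ) - 1) * i ≤ ((m : ℤ) - 1) * y' := mul_le_mul_of_nonneg_left h6 (by omega)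
      omega
    · left
      refine ⟨?_, h6⟩
      have : 0 ≤ Y * i := mul_nonneg h3 (by omega)
      have : ((m : ℤ) - 1) * y' ≤ 0 := mul_nonpos_of_nonneg_of_nonpos (by omega) h7
      omega
  refine ⟨⟨i, hi⟩, rfl, ?_⟩
  rcases lt_or_ge y 0 with h6 | h6
  · have := h.xray.length_le ⟨i, hi⟩ (l := y) (u := 0) fun y' a b => hcol y' (Or.inr ⟨a, b⟩)
    exact ⟨0, le_rfl, by simp, abs_le.2 ⟨by simp only; omega, by simp only; omega⟩⟩
  rcases le_or_gt y i with h7 | h7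
  · have := h.xray.length_le ⟨i, hi⟩ (l := y) (u := y) fun y' a b => by
      obtain rfl : y' = y := le_antisymm b a
      exact hz
    exact ⟨y, h6, h7, by simp only [sub_self, abs_zero]; omega⟩
  · have := h.xray.length_le ⟨i, hi⟩ (l := i) (u := y) fun y' a b => hcol y' (Or.inl ⟨a, b⟩)
    exact ⟨i, by simp, by simp, abs_le.2 ⟨by simp only; omega, by simp only; omega⟩⟩

/-- All the points of the set are between the lines of a lower and an upper hull edge; conversely,
in the common columns, the lattice points between the edges are in the hull, hence in the set. -/
theorem Normalized.isNode (h : Normalized v S Y) {p q r s : ℤ × ℤ} (hl : HullEdge 1 S p q)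
    (hu : HullEdge (-1) S r s) (hrq : r.1 ≤ q.1) (hps : p.1 ≤ s.1) :
    IsNode v ⟨⟨p, q⟩, ⟨r, s⟩⟩ := by
  have hpq := hl.lt
  have hrs := hu.lt
  have hlow : ∀ z ∈ S, 0 ≤ cr p q z := fun z hz => by have := hl.side z hz; omega
  have hupp : ∀ z ∈ S, cr r s z ≤ 0 := fun z hz => by have := hu.side z hz; omega
  have hleft : ∀ w ∈ S, (0, 0).1 ≤ w.1 := fun w hw => (h.xray.1 w hw).1
  have hright : ∀ w ∈ S, w.1 ≤ ((m : ℤ) - 1, Y).1 := fun w hw => by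
    have := (h.xray.1 w hw).2
    simp only; omega
  refine NodeTest.isNode ⟨hpq, hrs, ?_, ?_, max_le (le_min hpq.le hps) (le_min hrq hrs.le),
    ?_, ?_⟩ ?_
  · dsimp only
    -- The origin is the lowest point of its column, and it cannot be below the line of a lower edge
    -- starting at `p`.
    have horig : p.1 = 0 → p = (0, 0) := by
      intro h0
      have h1 := hlow _ h.first_mem
      have h2 := h.first_le p hl.left_mem h0
      simp only [cr, h0] at h1
      have h3 : 0 ≤ q.1 * -p.2 := by linarith
      have h4 := nonneg_of_mul_nonneg_right h3 (by omega)
      exact Prod.ext h0 (by simp only; omega)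
    by_cases h1 : cr p q r = 0
    · obtain ⟨h2, h3⟩ := hl.left_eq (Or.inl rfl) hu h.first_mem hleft h1
      exact Or.inl ⟨h2, horig h3⟩
    by_cases h2 : cr r s p = 0
    · obtain ⟨h2, h3⟩ := hu.left_eq (Or.inr rfl) (by simpa using hl) h.first_mem hleft h2
      exact Or.inl ⟨h2.symm, horig (by rw [← h2]; exact h3)⟩
    · have := hlow r hu.left_mem
      have := hupp p hl.left_mem
      exact Or.inr ⟨by omega, by omega⟩
  · dsimp only
    by_cases h1 : cr p q s = 0
    · obtain ⟨h2, h3⟩ := hl.right_eq (Or.inl rfl) hu h.last_mem hright h1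
      exact Or.inl ⟨h2, h3⟩
    by_cases h2 : cr r s q = 0
    · obtain ⟨h2, h3⟩ := hu.right_eq (Or.inr rfl) (by simpa using hl) h.last_mem hright h2
      exact Or.inl ⟨h2.symm, by rw [← h2]; exact h3⟩
    · have := hlow s hu.right_mem
      have := hupp q hl.right_mem
      exact Or.inr ⟨by omega, by omega⟩
  · intro i h1 h2
    simp only [Quad.first, Quad.last, max_le_iff, le_min_iff] at h1 h2
    rw [Seg.height_le_height_iff _ _ hpq hrs]
    -- The height of the upper edge above the line `p q` is interpolated between its values at `r`
    -- and `s`.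
    have h3 : 0 ≤ (s.1 - i) * cr p q r := mul_nonneg (by omega) (hlow r hu.left_mem)
    have h4 : 0 ≤ (i - r.1) * cr p q s := mul_nonneg (by omega) (hlow s hu.right_mem)
    simp only [cr] at h3 h4 ⊢
    linarith
  · intro i h1 h2
    simp only [Quad.first, Quad.last, max_le_iff, le_min_iff] at h1 h2
    have hmem : ∀ y : ℤ, (((i : ℕ) : ℤ), y) ∈ S ↔
        ⌈(Seg.mk p q).height (i : ℕ)⌉ ≤ y ∧ y ≤ ⌊(Seg.mk r s).height (i : ℕ)⌋ := by
      intro y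
      rw [Int.ceil_le, Int.le_floor, Seg.height_le_iff _ hpq, Seg.le_height_iff _ hrs]
      refine ⟨fun hy => ⟨hlow _ hy, hupp _ hy⟩, fun hy => ?_⟩
      rw [h.convex]
      exact mem_convexHull_of_between hl.left_mem hl.right_mem hu.left_mem hu.right_mem hpq hrs
        h1.1 h2.1 h1.2 h2.2 hy.1 hy.2
    have habove : (Seg.mk p q).height (i : ℕ) ≤ (Seg.mk r s).height (i : ℕ) := by
      rw [Seg.height_le_height_iff _ _ hpq hrs]
      have h3 : 0 ≤ (s.1 - i) * cr p q r := mul_nonneg (by omega) (hlow r hu.left_mem)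
      have h4 : 0 ≤ (i - r.1) * cr p q s := mul_nonneg (by omega) (hlow s hu.right_mem)
      simp only [cr] at h3 h4 ⊢
      linarith
    have h5 := ceil_le_floor_add_one habove
    have h6 : S.filter (fun p => p.1 = ((i : ℕ) : ℤ)) =
        (Finset.Icc ⌈(Seg.mk p q).height (i : ℕ)⌉ ⌊(Seg.mk r s).height (i : ℕ)⌋).image
          fun y => (((i : ℕ) : ℤ), y) := by
      ext ⟨x, y⟩
      simp only [Finset.mem_filter, Finset.mem_image, Finset.mem_Icc, ← hmem, Prod.mk.injEq]
      constructor
      · rintro ⟨hx, rfl⟩; exact ⟨y, hx, rfl, rfl⟩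
      · rintro ⟨y, hx, rfl, rfl⟩; exact ⟨hx, rfl⟩
    rw [← h.xray.2 i, h6, Finset.card_image_of_injective _ (fun _ _ h => (Prod.mk.inj h).2),
      Int.card_Icc]
    dsimp only
    omega
  · have := Quad.forall_vertices (q := ⟨⟨p, q⟩, ⟨r, s⟩⟩) (C := (· ∈ Region v))
    exact this.2 ⟨h.subset_region hl.left_mem, h.subset_region hl.right_mem,
      h.subset_region hu.left_mem, h.subset_region hu.right_mem⟩

/-- Induction on the total distance of the two right ends to the last column, which decreases at
each replacement of an edge. -/
theorem Normalized.exists_path (h : Normalized v S Y) (k : ℕ) : ∀ {p q r s : ℤ × ℤ},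
    HullEdge 1 S p q → HullEdge (-1) S r s → r.1 ≤ q.1 → p.1 ≤ s.1 →
    2 * (m : ℤ) - 2 - q.1 - s.1 ≤ k →
    ∃ q₂, IsRight v q₂ ∧ Relation.ReflTransGen (Edge v) ⟨⟨p, q⟩, ⟨r, s⟩⟩ q₂ := by
  have h2 := h.two_le
  induction k with
  | zero =>
    intro p q r s hl hu hrq hps hk
    have hn := h.isNode hl hu hrq hps
    have hq := (h.xray.1 q hl.right_mem).2
    have hs := (h.xray.1 s hu.right_mem).2
    have hq1 : q.1 = (m : ℤ) - 1 := by omega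
    have hs1 : s.1 = (m : ℤ) - 1 := by omega
    have hqY : q.2 = Y := by
      have h3 := h.last_le q hl.right_mem hq1
      have h4 := hl.side _ h.last_mem
      have h5 := hl.lt
      have h6 : 0 ≤ (q.1 - p.1) * (Y - q.2) := by
        simp only [cr, ← hq1] at h4; linarith
      have := nonneg_of_mul_nonneg_right h6 (by omega)
      omega
    -- The height of the upper right end is forced by the count in the last column.
    refine ⟨_, ⟨hn, by omega, Y, h.nonneg, h.le, Prod.ext hq1 hqY, Prod.ext hs1 ?_⟩, .refl⟩
    have := hn.xray ⟨m - 1, by omega⟩ (max_le (by have := hl.lt; simp only; omega)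
      (by have := hu.lt; simp only; omega)) (le_min (by simp only; omega) (by simp only; omega))
    have e1 : (((m - 1 : ℕ) : ℕ) : ℤ) = q.1 := by omega
    have e2 : q.1 = s.1 := by omega
    simp only [e1] at this
    rw [show (Seg.mk p q).height q.1 = q.2 from Seg.height_right _ hl.lt, e2,
      show (Seg.mk r s).height s.1 = s.2 from Seg.height_right _ hu.lt, Int.floor_intCast,
      Int.ceil_intCast] at this
    simp only
    omega
  | succ k ih =>
    intro p q r s hl hu hrq hps hk
    have hn := h.isNode hl hu hrq hps
    have hq := (h.xray.1 q hl.right_mem).2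
    have hs := (h.xray.1 s hu.right_mem).2
    by_cases hc : 2 * (m : ℤ) - 2 - q.1 - s.1 ≤ k
    · exact ih hl hu hrq hps hc
    push_cast at hk
    -- Advancing the edge that ends first keeps a common column, since the new edge starts at or
    -- before the end of the other one.
    rcases le_or_gt q.1 s.1 with hqs | hqs
    · obtain ⟨e, he⟩ := hl.exists_next (Or.inl rfl) h.last_mem (by simp only; omega)
      have hqe := he.lt
      obtain ⟨q₂, hr, hp⟩ := ih he hu (by omega) hqs (by omega)
      refine ⟨q₂, hr, .head ((edge_lower_iff hn).2 ⟨h.isNode he hu (by omega) hqs, ?_⟩) hp⟩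
      have := hl.cr_pos (Or.inl rfl) he.right_mem (Or.inr hqe)
      omega
    · obtain ⟨e, he⟩ := hu.exists_next (Or.inr rfl) h.last_mem (by simp only; omega)
      have hse := he.lt
      obtain ⟨q₂, hr, hp⟩ := ih hl he hqs.le (by omega) (by omega)
      refine ⟨q₂, hr, .head ((edge_upper_iff hn).2 ⟨h.isNode hl he hqs.le (by omega), ?_⟩) hp⟩
      have := hu.cr_pos (Or.inr rfl) he.right_mem (Or.inr hse)
      omega

theorem Normalized.hasPath (h : Normalized v S Y) : HasPath v := by
  have h2 := h.two_le
  have hleft : ∀ w ∈ S, 0 ≤ w.1 := fun w hw => (h.xray.1 w hw).1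
  obtain ⟨e, he⟩ := exists_first_hullEdge (Or.inl rfl) h.first_mem h.last_mem
    (by simp only; omega) hleft (by intro w hw hw'; simpa using h.first_le w hw hw')
  obtain ⟨u, hu, humax⟩ := (S.filter (fun p => p.1 = 0)).exists_max_image (fun p => p.2)
    ⟨(0, 0), by simp [h.first_mem]⟩
  simp only [Finset.mem_filter, and_imp] at hu humax
  obtain ⟨hu, hu0⟩ := hu
  obtain ⟨f, hf⟩ := exists_first_hullEdge (ε := -1) (Or.inr rfl) hu h.last_mem
    (by simp only; omega) (by rw [hu0]; exact hleft)
    (by intro w hw hw'; have := humax w hw (by omega); omega)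
  have h3 := hf.lt
  have h4 := he.lt
  have h4' : 0 < e.1 := h4
  obtain ⟨q₂, hr, hp⟩ := h.exists_path (2 * m) he hf (by omega) (by simp only; omega)
    (by have := hleft e he.right_mem; have := hleft f hf.right_mem; push_cast; omega)
  have hn := h.isNode he hf (by omega) (by simp only; omega)
  refine ⟨_, q₂, ⟨hn, rfl, by omega, Prod.ext hu0 ?_⟩, hr, hp⟩
  have := hn.xray ⟨0, by omega⟩ (max_le (by simp) (by simp [hu0]))
    (le_min (by simpa using h4.le) (by simp only; omega))
  have e1 : (((0 : ℕ) : ℕ) : ℤ) = u.1 := by omega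
  have e2 : u.1 = ((0 : ℤ), (0 : ℤ)).1 := by omega
  simp only [e1] at this
  rw [show (Seg.mk u f).height u.1 = u.2 from Seg.height_left _, e2,
      show (Seg.mk (0, 0) e).height (0, 0).1 = ((0, 0) : ℤ × ℤ).2 from Seg.height_left _,
      Int.floor_intCast, Int.ceil_intCast] at this
  simp only at this ⊢
  omega

theorem HasVerticalXRay.map_shear {S : Finset (ℤ × ℤ)} (h : HasVerticalXRay v S) (b c : ℤ) :
    HasVerticalXRay v (S.map (shear 0 b c).toEmbedding) := by
  refine ⟨fun p hp => ?_, fun i => ?_⟩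
  · obtain ⟨z, hz, rfl⟩ := Finset.mem_map.1 hp
    simpa [shear] using h.1 z hz
  · have := card_column_map_shear S 0 b c (i : ℕ)
    rw [add_zero] at this
    rw [this, h.2]

theorem HasVerticalXRay.exists_min {S : Finset (ℤ × ℤ)} (h : HasVerticalXRay v S) (i : Fin m)
    (hi : v i ≠ 0) : ∃ y, (((i : ℕ) : ℤ), y) ∈ S ∧ ∀ z ∈ S, z.1 = ((i : ℕ) : ℤ) → y ≤ z.2 := by
  have hne : (S.filter (fun p => p.1 = ((i : ℕ) : ℤ))).Nonempty := by
    rw [← Finset.card_pos]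
    have := h.2 i
    omega
  obtain ⟨w, hw, hmin⟩ := Finset.exists_min_image _ (fun p => p.2) hne
  simp only [Finset.mem_filter, and_imp] at hw hmin
  refine ⟨w.2, ?_, hmin⟩
  rw [← hw.2]
  exact hw.1

/-- The shear subtracts `k` times the abscissa, where `k` is the quotient of `y₁ - y₀` by `m - 1`.
The lowest point of the last column thus lands at the remainder, between `0` and `m - 2`. -/
theorem DTC.hasPath (hm : 2 ≤ m) {hl : 0 < m} {hr : m - 1 < m} (h0 : v ⟨0, hl⟩ ≠ 0)
    (h1 : v ⟨m - 1, hr⟩ ≠ 0) (h : DTC v) : HasPath v := by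
  obtain ⟨S, hS, hv⟩ := h
  obtain ⟨y₀, hy₀, hmin₀⟩ := hv.exists_min _ h0
  obtain ⟨y₁, hy₁, hmin₁⟩ := hv.exists_min _ h1
  have em : (((m - 1 : ℕ) : ℕ) : ℤ) = (m : ℤ) - 1 := by omega
  simp only [em, Nat.cast_zero] at hy₀ hmin₀ hy₁ hmin₁
  have hmod := Int.emod_add_mul_ediv (y₁ - y₀) ((m : ℤ) - 1)
  have hlt := Int.emod_lt_of_pos (y₁ - y₀) (by omega : 0 < (m : ℤ) - 1)
  have hnn := Int.emod_nonneg (y₁ - y₀) (by omega : (m : ℤ) - 1 ≠ 0)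
  set k := (y₁ - y₀) / ((m : ℤ) - 1)
  refine Normalized.hasPath (S := S.map (shear 0 (-y₀) (-k)).toEmbedding)
    (Y := (y₁ - y₀) % ((m : ℤ) - 1)) ⟨hm, hS.map_shear _ _ _, hv.map_shear _ _, ?_, ?_, ?_, ?_,
      hnn, hlt.le⟩
  · exact Finset.mem_map.2 ⟨_, hy₀, by simp [shear]⟩
  · intro z hz hz0
    obtain ⟨w, hw, rfl⟩ := Finset.mem_map.1 hz
    simp only [shear, Equiv.coe_toEmbedding, Equiv.coe_fn_mk, add_zero] at hz0 ⊢
    have := hmin₀ w hw hz0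
    rw [hz0]
    omega
  · refine Finset.mem_map.2 ⟨_, hy₁, ?_⟩
    simp only [shear, Equiv.coe_toEmbedding, Equiv.coe_fn_mk, add_zero, Prod.mk.injEq, true_and]
    linarith
  · intro z hz hz0
    obtain ⟨w, hw, rfl⟩ := Finset.mem_map.1 hz
    simp only [shear, Equiv.coe_toEmbedding, Equiv.coe_fn_mk, add_zero] at hz0 ⊢
    have := hmin₁ w hw hz0
    rw [hz0]
    linarith

/-- The reduction to a path in the graph of the quads. -/
theorem dtc_iff_hasPath (hm : 2 ≤ m) {hl : 0 < m} {hr : m - 1 < m} (h0 : v ⟨0, hl⟩ ≠ 0)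
    (h1 : v ⟨m - 1, hr⟩ ≠ 0) : DTC v ↔ HasPath v :=
  ⟨DTC.hasPath hm h0 h1, HasPath.dtc⟩

end

/-! ## Removal of the null columns -/

section
variable {m : ℕ} {v : Fin m → ℤ}

theorem DTC.nonneg (h : DTC v) (i : Fin m) : 0 ≤ v i := by
  obtain ⟨S, -, hS⟩ := h
  rw [← hS.2 i]
  exact Int.natCast_nonneg _

/-- A null column contains no point of the set, so a horizontal translation suffices. Null columns
inside the range are kept. -/
theorem dtc_trim {n lo : ℕ} (hlo : lo + n ≤ m) (h1 : ∀ i : Fin m, (i : ℕ) < lo → v i = 0)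
    (h2 : ∀ i : Fin m, lo + n ≤ i → v i = 0) :
    DTC v ↔ DTC (fun j : Fin n => v ⟨lo + j, by omega⟩) := by
  constructor
  · rintro ⟨S, hS, hv1, hv2⟩
    refine ⟨_, hS.map_shear (-lo) 0 0, fun p hp => ?_, fun j => ?_⟩
    · obtain ⟨z, hz, rfl⟩ := Finset.mem_map.1 hp
      obtain ⟨h3, h4⟩ := hv1 z hz
      obtain ⟨x, y⟩ := z
      lift x to ℕ using h3 with i
      have hi : i < m := by simpa using h4
      have hne : v ⟨i, hi⟩ ≠ 0 := by
        rw [← hv2]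
        have : ((i : ℤ), y) ∈ S.filter (fun p => p.1 = (i : ℤ)) := by simp [hz]
        have := Finset.card_pos.2 ⟨_, this⟩
        simp only
        omega
      have h5 : ¬ i < lo := fun h => hne (h1 _ h)
      have h6 : ¬ lo + n ≤ i := fun h => hne (h2 _ h)
      simp only [shear, Equiv.coe_toEmbedding, Equiv.coe_fn_mk]
      omega
    · have := card_column_map_shear S (-lo) 0 0 ((lo + j : ℕ) : ℤ)
      rw [show ((lo + j : ℕ) : ℤ) + -lo = ((j : ℕ) : ℤ) by push_cast; ring] at this
      rw [this]
      exact hv2 ⟨lo + j, by omega⟩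
  · rintro ⟨S, hS, hv1, hv2⟩
    refine ⟨_, hS.map_shear lo 0 0, fun p hp => ?_, fun i => ?_⟩
    · obtain ⟨z, hz, rfl⟩ := Finset.mem_map.1 hp
      have := hv1 z hz
      simp only [shear, Equiv.coe_toEmbedding, Equiv.coe_fn_mk]
      omega
    · have := card_column_map_shear S lo 0 0 (((i : ℕ) : ℤ) - lo)
      rw [sub_add_cancel] at this
      rw [this]
      by_cases hi : lo ≤ i ∧ (i : ℕ) < lo + n
      · have h3 := hv2 ⟨i - lo, by omega⟩
        simp only [show (((i : ℕ) - lo : ℕ) : ℤ) = ((i : ℕ) : ℤ) - lo by omega,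
          show lo + ((i : ℕ) - lo) = i by omega] at h3
        exact h3
      · have h3 : v i = 0 := by
          by_cases h : (i : ℕ) < lo
          · exact h1 i h
          · exact h2 i (by omega)
        rw [h3, Nat.cast_eq_zero, Finset.card_eq_zero, Finset.filter_eq_empty_iff]
        intro z hz
        have := hv1 z hz
        omega

theorem dtc_of_zero (h : ∀ i, v i = 0) : DTC v := by
  refine ⟨∅, fun p => by simp, by simp, fun i => by simp [h]⟩

theorem dtc_of_one {v : Fin 1 → ℤ} (h : 0 ≤ v 0) : DTC v := by
  refine ⟨ofColumns (fun _ => 0) (fun i => v i - 1), ?_, hasVerticalXRay_ofColumns (by simp)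
    (fun i => by rw [Subsingleton.elim i 0]; omega)⟩
  -- The constraints are `0 ≤ x`, `x ≤ 0`, `0 ≤ y` and `y ≤ v 0 - 1`; they are incompatible if `v 0
  -- = 0`, as they should be.
  refine digitalConvex_of_halfPlanes {((0, 1), (0, 0)), ((0, 0), (0, 1)), ((0, 0), (1, 0)),
    ((1, v 0 - 1), (0, v 0 - 1))} fun z => ?_
  simp [mem_ofColumns, cr]
  omega

end

/-! ## Executions with a time bound -/

section logic
variable {R A : Type} [DecidableEq R] [DecidableEq A]

/-- The execution of `P` from `σ` halts after at most `T` steps in a state that satisfies `Q`. -/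
def Run (P : Prog R A) (σ : Mem R A) (T : ℕ) (Q : Mem R A → Prop) : Prop :=
  ∃ t τ, Exec P σ t τ ∧ t ≤ T ∧ Q τ

variable {P P' : Prog R A} {σ : Mem R A} {T T' : ℕ} {Q Q' : Mem R A → Prop} {b : BExpr R A}

theorem Run.mono (h : Run P σ T Q) (hT : T ≤ T') (hQ : ∀ τ, Q τ → Q' τ) : Run P σ T' Q' := by
  obtain ⟨t, τ, h1, h2, h3⟩ := h
  exact ⟨t, τ, h1, h2.trans hT, hQ τ h3⟩

theorem Run.skip (h : Q σ) (hT : 1 ≤ T) : Run .skip σ T Q := ⟨1, σ, .skip σ, hT, h⟩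

theorem Run.assign {x : R} {e : AExpr R A} (h : Q (σ.setReg x (e.eval σ))) (hT : e.cost + 1 ≤ T) :
    Run (.assign x e) σ T Q := ⟨_, _, .assign x e σ, hT, h⟩

theorem Run.write {a : A} {j e : AExpr R A} (h : Q (σ.setArr a (j.eval σ) (e.eval σ)))
    (hT : j.cost + e.cost + 1 ≤ T) : Run (.write a j e) σ T Q := ⟨_, _, .write a j e σ, hT, h⟩

theorem Run.seq (T₁ T₂ : ℕ) (h : Run P σ T₁ fun τ => Run P' τ T₂ Q) (hT : T₁ + T₂ ≤ T) :
    Run (.seq P P') σ T Q := by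
  obtain ⟨t, τ, h1, h2, t', τ', h3, h4, h5⟩ := h
  exact ⟨_, _, .seq h1 h3, by omega, h5⟩

theorem Run.ite (T₁ : ℕ) (h : b.eval σ → Run P σ T₁ Q) (h' : ¬ b.eval σ → Run P' σ T₁ Q)
    (hT : b.cost + 1 + T₁ ≤ T) : Run (.ite b P P') σ T Q := by
  by_cases hb : b.eval σ
  · obtain ⟨t, τ, h1, h2, h3⟩ := h hb
    exact ⟨_, _, .ite_true hb h1, by omega, h3⟩
  · obtain ⟨t, τ, h1, h2, h3⟩ := h' hb
    exact ⟨_, _, .ite_false hb h1, by omega, h3⟩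

/-- The invariant is indexed by the remaining fuel, which must be positive whenever the guard holds:
termination and cost are obtained together. The extra round in `n + 1` pays for the last, failing
test. -/
theorem Run.loop (c n : ℕ) (I : ℕ → Mem R A → Prop) (h0 : I n σ)
    (step : ∀ k σ, I k σ → b.eval σ → 0 < k ∧ Run P σ c (I (k - 1)))
    (done : ∀ k σ, I k σ → ¬ b.eval σ → Q σ) (hT : (n + 1) * (b.cost + 1 + c) ≤ T) :
    Run (.loop b P) σ T Q := by
  suffices H : Run (.loop b P) σ ((n + 1) * (b.cost + 1 + c)) Q from H.mono hT fun _ h => h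
  clear hT
  induction n generalizing σ with
  | zero =>
    have hb : ¬ b.eval σ := fun hb => absurd (step _ _ h0 hb).1 (lt_irrefl _)
    exact ⟨_, _, .loop_done hb, by omega, done _ _ h0 hb⟩
  | succ n ih =>
    by_cases hb : b.eval σ
    · obtain ⟨-, t, τ, h1, h2, h3⟩ := step _ _ h0 hb
      obtain ⟨t', τ', h4, h5, h6⟩ := ih h3
      refine ⟨_, _, .loop_step hb h1 h4, ?_, h6⟩
      calc b.cost + 1 + t + t' ≤ (b.cost + 1 + c) + (n + 1) * (b.cost + 1 + c) := by omega
        _ = _ := by ring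
    · refine ⟨_, _, .loop_done hb, ?_, done _ _ h0 hb⟩
      calc b.cost + 1 ≤ 1 * (b.cost + 1 + c) := by omega
        _ ≤ _ := Nat.mul_le_mul_right _ (by omega)

end logic

/-! ### Evaluation rules for memory states and expressions -/

@[simp] theorem Mem.setReg_reg {R A : Type} [DecidableEq R] (σ : Mem R A) (x y : R) (z : ℤ) :
    (σ.setReg x z).reg y = if y = x then z else σ.reg y := by
  simp [Mem.setReg, Function.update_apply]

@[simp] theorem Mem.setReg_arr {R A : Type} [DecidableEq R] (σ : Mem R A) (x : R) (z : ℤ) :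
    (σ.setReg x z).arr = σ.arr := rfl

@[simp] theorem Mem.setArr_reg {R A : Type} [DecidableEq A] (σ : Mem R A) (a : A) (j z : ℤ) :
    (σ.setArr a j z).reg = σ.reg := rfl

@[simp] theorem Mem.setArr_arr {R A : Type} [DecidableEq A] (σ : Mem R A) (a a' : A)
    (j j' z : ℤ) :
    (σ.setArr a j z).arr a' j' = if a' = a ∧ j' = j then z else σ.arr a' j' := by
  by_cases h : a' = a
  · subst h; simp [Mem.setArr, Function.update_apply]
  · simp [Mem.setArr, h]

section eval
variable (σ : Mem Reg Arr) (e f : E)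

@[simp] theorem eval_add : (e + f).eval σ = e.eval σ + f.eval σ := rfl
@[simp] theorem eval_sub : (e - f).eval σ = e.eval σ - f.eval σ := rfl
@[simp] theorem eval_mul : (e * f).eval σ = e.eval σ * f.eval σ := rfl
@[simp] theorem eval_div : (e / f).eval σ = e.eval σ / f.eval σ := rfl
@[simp] theorem eval_zero : (0 : E).eval σ = 0 := rfl
@[simp] theorem eval_one : (1 : E).eval σ = 1 := rfl
@[simp] theorem eval_reg (z : Reg) : AExpr.eval σ (.reg z) = σ.reg z := rfl
@[simp] theorem eval_read (a : Arr) : AExpr.eval σ (.read a e) = σ.arr a (e.eval σ) := rfl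
@[simp] theorem eval_lt : BExpr.eval σ (.lt e f) ↔ e.eval σ < f.eval σ := Iff.rfl
@[simp] theorem eval_le : BExpr.eval σ (.le e f) ↔ e.eval σ ≤ f.eval σ := Iff.rfl
@[simp] theorem eval_eq : BExpr.eval σ (.eq e f) ↔ e.eval σ = f.eval σ := Iff.rfl
@[simp] theorem eval_and (b c : B) : BExpr.eval σ (.and b c) ↔ b.eval σ ∧ c.eval σ := Iff.rfl
@[simp] theorem eval_or (b c : B) : BExpr.eval σ (.or b c) ↔ b.eval σ ∨ c.eval σ := Iff.rfl

end eval

/-! ## The test of a candidate -/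

/-- The quad with the vertices of the given indices. -/
def quadAt (f : ℤ → ℤ × ℤ) (z : ℤ × ℤ × ℤ × ℤ) : Quad :=
  ⟨⟨f z.1, f z.2.1⟩, ⟨f z.2.2.1, f z.2.2.2⟩⟩

/-- The points `f 0, ..., f (k - 1)` are the points of the region, without repetition. -/
structure Listing {n : ℕ} (w : Fin n → ℤ) (k : ℕ) (f : ℤ → ℤ × ℤ) : Prop where
  region : ∀ z : ℤ, 0 ≤ z → z < k → f z ∈ Region w
  inj : ∀ y z : ℤ, 0 ≤ y → y < k → 0 ≤ z → z < k → f y = f z → y = z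
  surj : ∀ p ∈ Region w, ∃ z : ℤ, 0 ≤ z ∧ z < k ∧ f z = p

/-- The part of the memory that the search does not change. -/
structure World {n : ℕ} (w : Fin n → ℤ) (k : ℕ) (f : ℤ → ℤ × ℤ) (σ : Mem Reg Arr) : Prop where
  n_eq : σ.reg .n = n
  k_eq : σ.reg .k = k
  px : ∀ z, σ.arr .px z = (f z).1
  py : ∀ z, σ.arr .py z = (f z).2
  v : ∀ j : Fin n, σ.arr .v (σ.reg .lo + (j : ℕ)) = w j

/-- The states differ only in the registers used by the test of a candidate. -/
structure Frame (σ τ : Mem Reg Arr) : Prop where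
  arr : τ.arr = σ.arr
  reg : ∀ z, z ≠ .ok → z ≠ .i → z ≠ .j → τ.reg z = σ.reg z

/-- The status of the candidate tells whether `D` holds. -/
def Flag (τ : Mem Reg Arr) (D : Prop) : Prop :=
  (τ.reg .ok = 1 ∧ D) ∨ (τ.reg .ok = 0 ∧ ¬ D)

section
variable {σ τ : Mem Reg Arr}

theorem Frame.refl (σ : Mem Reg Arr) : Frame σ σ := ⟨rfl, fun _ _ _ _ => rfl⟩

theorem Frame.set (h : Frame σ τ) (u : Reg) (a : ℤ) (hx : u = .ok ∨ u = .i ∨ u = .j) :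
    Frame σ (τ.setReg u a) := by
  refine ⟨h.arr, fun z h1 h2 h3 => ?_⟩
  rw [Mem.setReg_reg, if_neg (by rintro rfl; rcases hx with h | h | h <;> contradiction),
    h.reg z h1 h2 h3]

/-- The status can only drop from `1` to `0`, so successive tests accumulate a conjunction; a failed
test does not interrupt the sequence. -/
theorem Run.require {b : B} {C D : Prop} {T : ℕ} {Q : Mem Reg Arr → Prop} (hF : Frame σ τ)
    (hD : Flag τ D) (hb : b.eval τ ↔ C)
    (hQ : ∀ τ', Frame σ τ' → Flag τ' (D ∧ C) → (∀ z, z ≠ .ok → τ'.reg z = τ.reg z) → Q τ')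
    (hT : b.cost + 3 ≤ T) : Run (require b) τ T Q := by
  refine Run.ite 2 (fun h => .skip (hQ τ hF ?_ fun _ _ => rfl) (by decide)) (fun h => .assign
    (hQ _ (hF.set _ _ (Or.inl rfl)) ?_ fun z hz => by simp [hz]) (by decide)) (by omega)
  · rcases hD with hD | hD
    · exact Or.inl ⟨hD.1, hD.2, hb.1 h⟩
    · exact Or.inr ⟨hD.1, fun h => hD.2 h.1⟩
  · exact Or.inr ⟨by simp, fun h' => h (hb.2 h'.2)⟩

end

section
variable {n : ℕ} {w : Fin n → ℤ} {k : ℕ} {f : ℤ → ℤ × ℤ} {σ : Mem Reg Arr}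

/-- The condition on the column `i` for a candidate with the given vertices. -/
def ColumnTest (V : ℤ → ℤ) (p q r s : ℤ × ℤ) (i : ℤ) : Prop :=
  (p.2 * (q.1 - p.1) + (i - p.1) * (q.2 - p.2)) * (s.1 - r.1) ≤
    (r.2 * (s.1 - r.1) + (i - r.1) * (s.2 - r.2)) * (q.1 - p.1) ∧
  (r.2 * (s.1 - r.1) + (i - r.1) * (s.2 - r.2)) / (s.1 - r.1) -
    (0 - (0 - (p.2 * (q.1 - p.1) + (i - p.1) * (q.2 - p.2))) / (q.1 - p.1)) + 1 = V i

/-- Since the listing is injective, equality of points is tested on indices. The conjunction is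
nested to the left, in the order in which `Run.require` accumulates the tests. -/
theorem nodeTest_quadAt_iff (hw : Listing w k f) {p q r s : ℤ}
    (hp : 0 ≤ p ∧ p < k) (hq : 0 ≤ q ∧ q < k) (hr : 0 ≤ r ∧ r < k) (hs : 0 ≤ s ∧ s < k)
    {V : ℤ → ℤ} (hV : ∀ j : Fin n, V (j : ℕ) = w j) :
    IsNode w (quadAt f (p, q, r, s)) ↔
      ((((((f p).1 < (f q).1 ∧ (f r).1 < (f s).1) ∧
        (p = r ∧ (f p).1 = 0 ∧ (f p).2 = 0 ∨
          0 < cr (f p) (f q) (f r) ∧ cr (f r) (f s) (f p) < 0)) ∧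
        (q = s ∧ (f q).1 = (n : ℤ) - 1 ∨
          0 < cr (f p) (f q) (f s) ∧ cr (f r) (f s) (f q) < 0)) ∧
        max (f p).1 (f r).1 ≤ min (f q).1 (f s).1) ∧
        ∀ i, max (f p).1 (f r).1 ≤ i → i ≤ min (f q).1 (f s).1 →
          ColumnTest V (f p) (f q) (f r) (f s) i) := by
  have hp' := Region.fst_mem (hw.region p hp.1 hp.2)
  have hq' := Region.fst_mem (hw.region q hq.1 hq.2)
  rw [isNode_iff_nodeTest (Quad.forall_vertices (C := (· ∈ Region w)) |>.2
    ⟨hw.region p hp.1 hp.2, hw.region q hq.1 hq.2, hw.region r hr.1 hr.2, hw.region s hs.1 hs.2⟩)]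
  have hpr : f p = f r ↔ p = r := ⟨hw.inj p r hp.1 hp.2 hr.1 hr.2, fun h => by rw [h]⟩
  have hqs : f q = f s ↔ q = s := ⟨hw.inj q s hq.1 hq.2 hs.1 hs.2, fun h => by rw [h]⟩
  constructor
  · rintro ⟨h1, h2, h3, h4, h5, h6, h7⟩
    simp only [quadAt, Quad.first, Quad.last, hpr, hqs] at h1 h2 h3 h4 h5 h6 h7
    refine ⟨⟨⟨⟨⟨h1, h2⟩, ?_⟩, h4⟩, h5⟩, fun i hi hi' => ⟨?_, ?_⟩⟩
    · rwa [Prod.ext_iff] at h3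
    · exact (Seg.height_le_height_iff _ _ h1 h2 i).1 (h6 i hi hi')
    · have hi0 : 0 ≤ i := hp'.1.trans ((le_max_left _ _).trans hi)
      have hin : i < n := by
        have := hi'.trans (min_le_left _ _)
        omega
      lift i to ℕ using hi0
      have := h7 ⟨i, by omega⟩ hi hi'
      rw [Seg.floor_height _ h2, Seg.ceil_height _ h1, ← hV] at this
      exact this
  · rintro ⟨⟨⟨⟨⟨h1, h2⟩, h3⟩, h4⟩, h5⟩, h6⟩
    refine ⟨h1, h2, ?_, ?_, h5, fun i hi hi' => ?_, fun i hi hi' => ?_⟩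
    · simp only [quadAt, hpr]
      rwa [Prod.ext_iff]
    · simp only [quadAt, hqs]
      exact h4
    · exact (Seg.height_le_height_iff _ _ h1 h2 i).2 (h6 i hi hi').1
    · rw [Seg.floor_height _ h2, Seg.ceil_height _ h1, ← hV]
      exact (h6 i hi hi').2

theorem Frame.eval (hσ : World w k f σ) {p q r s : ℤ}
    (h : σ.reg .p = p ∧ σ.reg .q = q ∧ σ.reg .r = r ∧ σ.reg .s = s) {τ : Mem Reg Arr}
    (hF : Frame σ τ) : τ.reg .p = p ∧ τ.reg .q = q ∧ τ.reg .r = r ∧ τ.reg .s = s ∧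
      τ.reg .n = n ∧ τ.reg .lo = σ.reg .lo := by
  refine ⟨?_, ?_, ?_, ?_, ?_, ?_⟩ <;> rw [hF.reg _ (by decide) (by decide) (by decide)]
  exacts [h.1, h.2.1, h.2.2.1, h.2.2.2, hσ.n_eq]

/-- The loop runs only if the earlier tests succeeded, which gives `lo ≤ hi`; after a failing column
it still goes through the remaining ones, at most `n` columns in all. -/
theorem run_columns (hσ : World w k f σ) {p q r s : ℤ}
    (hregs : σ.reg .p = p ∧ σ.reg .q = q ∧ σ.reg .r = r ∧ σ.reg .s = s) {τ : Mem Reg Arr}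
    {lo hi : ℤ} {D : Prop} (hF : Frame σ τ) (hi' : τ.reg .i = lo) (hj' : τ.reg .j = hi)
    (hlh : D → lo ≤ hi) (hlo : 0 ≤ lo) (hhi : hi ≤ (n : ℤ) - 1) (hD : Flag τ D) :
    Run (when (.eq (g .ok) 1) (.loop (.le (g .i) (g .j)) (require columnOk ;; incr .i))) τ
      ((n + 1) * 200 + 10) fun τ' => Frame σ τ' ∧ Flag τ' (D ∧ ∀ i, lo ≤ i → i ≤ hi →
        ColumnTest (fun i => σ.arr .v (σ.reg .lo + i)) (f p) (f q) (f r) (f s) i) := by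
  set V : ℤ → ℤ := fun i => σ.arr .v (σ.reg .lo + i) with hV
  have ev : ∀ τ, Frame σ τ → _ := fun τ h => h.eval hσ hregs
  refine .ite ((n + 1) * 200) (fun hok => ?_) (fun hok => .skip ⟨hF, ?_⟩ (by omega)) (by
    rw [show (BExpr.eq (g .ok) 1).cost = 3 by decide]; omega)
  · have hlt : lo ≤ hi := by
      rcases hD with h | h
      · exact hlh h.2
      · simp [h.1] at hok
    refine .loop 150 (hi + 1 - lo).toNat (fun k τ => Frame σ τ ∧ τ.reg .j = hi ∧
      τ.reg .i + k = hi + 1 ∧ lo ≤ τ.reg .i ∧ Flag τ (D ∧ ∀ i, lo ≤ i → i < τ.reg .i →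
        ColumnTest V (f p) (f q) (f r) (f s) i))
      ⟨hF, hj', by omega, hi'.ge, ?_⟩ ?_ ?_ ?_
    · rcases hD with h | h
      · exact Or.inl ⟨h.1, h.2, fun i h1 h2 => by omega⟩
      · exact Or.inr ⟨h.1, fun h' => h.2 h'.1⟩
    · rintro k τ ⟨hF, hj, hi, hlo, hD⟩ hb
      simp only [eval_le, eval_reg, hj] at hb
      obtain ⟨e1, e2, e3, e4, e5, e6⟩ := ev τ hF
      refine ⟨by omega, .seq 140 10 (.require hF hD
        (C := ColumnTest V (f p) (f q) (f r) (f s) (τ.reg .i)) ?_ ?_ (by decide)) (by omega)⟩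
      · simp [ColumnTest, V, columnOk, heightNum, heightDen, e1, e2, e3, e4, e6, hF.arr, hσ.px, hσ.py]
      · rintro τ' hF' hD' hreg
        rw [← hreg .i (by decide)] at hi
        rw [← hreg .j (by decide)] at hj
        refine .assign ⟨hF'.set _ _ (by simp), by simpa using hj, ?_, ?_, ?_⟩ (by decide)
        · have := hreg .i (by decide)
          simp; omega
        · simp [hreg]; omega
        · simp only [Flag, Mem.setReg_reg, reduceCtorEq, if_false] at hD' ⊢
          refine hD'.imp (And.imp_right ?_) (And.imp_right (mt ?_))
          · rintro ⟨⟨h1, h2⟩, h3⟩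
            refine ⟨h1, fun i h4 h5 => ?_⟩
            simp [hreg] at h5
            rcases (by omega : i < τ.reg .i ∨ i = τ.reg .i) with h | rfl
            · exact h2 i h4 h
            · exact h3
          · rintro ⟨h1, h2⟩
            refine ⟨⟨h1, fun i h4 h5 => h2 i h4 ?_⟩, h2 _ ?_ ?_⟩
            · simp [hreg]; omega
            · exact hlo
            · simp [hreg]
    · rintro k τ ⟨hF, hj, hi, hlo, hD⟩ hb
      simp only [eval_le, eval_reg, hj] at hb
      refine ⟨hF, ?_⟩
      refine hD.imp (And.imp_right ?_) (And.imp_right (mt ?_))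
      · rintro ⟨h1, h2⟩
        exact ⟨h1, fun i h3 h4 => h2 i h3 (by omega)⟩
      · rintro ⟨h1, h2⟩
        exact ⟨h1, fun i h3 h4 => h2 i h3 (by omega)⟩
    · rw [show (BExpr.le (g .i) (g .j)).cost = 3 by decide]
      have : (hi + 1 - lo).toNat ≤ n := by omega
      calc _ ≤ (n + 1) * (3 + 1 + 150) := Nat.mul_le_mul_right _ (by omega)
        _ ≤ _ := by omega
  · rcases hD with h | h
    · simp [h.1] at hok
    · exact Or.inr ⟨h.1, fun h' => h.2 h'.1⟩

/-- The tests before the column loop are allotted 222 steps in all, and the loop is linear in `n`.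
-/
theorem run_testNode (hw : Listing w k f) (hσ : World w k f σ) {p q r s : ℤ}
    (hp : 0 ≤ p ∧ p < k) (hq : 0 ≤ q ∧ q < k) (hr : 0 ≤ r ∧ r < k) (hs : 0 ≤ s ∧ s < k)
    (ep : σ.reg .p = p) (eq : σ.reg .q = q) (er : σ.reg .r = r) (es : σ.reg .s = s) :
    Run testNode σ (500 * (n + 1)) fun τ =>
      Frame σ τ ∧ Flag τ (IsNode w (quadAt f (p, q, r, s))) := by
  have hp' := Region.fst_mem (hw.region p hp.1 hp.2)
  have hq' := Region.fst_mem (hw.region q hq.1 hq.2)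
  rw [nodeTest_quadAt_iff hw hp hq hr hs
    (V := fun i => σ.arr .v (σ.reg .lo + i)) hσ.v]
  have ev : ∀ τ, Frame σ τ → _ := fun τ h => h.eval hσ ⟨ep, eq, er, es⟩
  refine .seq 2 (500 * (n + 1) - 2) (.assign ?_ (by decide)) (by omega)
  have hF := (Frame.refl σ).set .ok ((1 : E).eval σ) (Or.inl rfl)
  have hD : Flag (σ.setReg .ok ((1 : E).eval σ)) True := Or.inl ⟨by simp, trivial⟩
  generalize σ.setReg .ok ((1 : E).eval σ) = τ at *
  refine .seq 20 (500 * (n + 1) - 22) (.require hF hD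
    (C := (f p).1 < (f q).1 ∧ (f r).1 < (f s).1) ?_ ?_ (by decide)) (by omega)
  · obtain ⟨e1, e2, e3, e4, e5, e6⟩ := ev τ hF
    simp [e1, e2, e3, e4, hF.arr, hσ.px]
  clear hF hD
  rintro τ hF hD -
  refine .seq 70 (500 * (n + 1) - 92) (.require hF hD
    (C := (p = r ∧ (f p).1 = 0 ∧ (f p).2 = 0 ∨
          0 < cr (f p) (f q) (f r) ∧ cr (f r) (f s) (f p) < 0)) ?_ ?_ (by decide)) (by omega)
  · obtain ⟨e1, e2, e3, e4, e5, e6⟩ := ev τ hF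
    simp [leftEnds, cross, cr, e1, e2, e3, e4, hF.arr, hσ.px, hσ.py]
  clear hF hD
  rintro τ hF hD -
  refine .seq 70 (500 * (n + 1) - 162) (.require hF hD
    (C := (q = s ∧ (f q).1 = (n : ℤ) - 1 ∨
          0 < cr (f p) (f q) (f s) ∧ cr (f r) (f s) (f q) < 0)) ?_ ?_ (by decide)) (by omega)
  · obtain ⟨e1, e2, e3, e4, e5, e6⟩ := ev τ hF
    simp [rightEnds, cross, cr, e1, e2, e3, e4, e5, hF.arr, hσ.px, hσ.py]
  clear hF hD
  rintro τ hF hD -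
  set lo := max (f p).1 (f r).1 with hlo
  set hi := min (f q).1 (f s).1 with hhi
  refine .seq 20 (500 * (n + 1) - 182) (Run.mono (T := 20) (Q := fun τ' => Frame σ τ' ∧
    τ'.reg .i = lo ∧ τ'.reg .ok = τ.reg .ok) ?_ le_rfl ?_) (by omega)
  · obtain ⟨e1, e2, e3, e4, e5, e6⟩ := ev τ hF
    refine .ite 10 (fun h => .assign ⟨hF.set _ _ (by simp), ?_, by simp⟩ (by decide))
      (fun h => .assign ⟨hF.set _ _ (by simp), ?_, by simp⟩ (by decide)) (by decide) <;>
    · simp [e1, e3, hF.arr, hσ.px] at h ⊢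
      omega
  rintro τ' ⟨hF', hi', hok⟩
  simp only [Flag, ← hok] at hD
  clear hok hF
  rename' τ => τ₀, τ' => τ, hF' => hF
  refine .seq 20 (500 * (n + 1) - 202) (Run.mono (T := 20) (Q := fun τ' => Frame σ τ' ∧
    τ'.reg .j = hi ∧ τ'.reg .i = τ.reg .i ∧ τ'.reg .ok = τ.reg .ok) ?_ le_rfl ?_) (by omega)
  · obtain ⟨e1, e2, e3, e4, e5, e6⟩ := ev τ hF
    refine .ite 10 (fun h => .assign ⟨hF.set _ _ (by simp), ?_, by simp, by simp⟩ (by decide))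
      (fun h => .assign ⟨hF.set _ _ (by simp), ?_, by simp, by simp⟩ (by decide)) (by decide) <;>
    · simp [e2, e4, hF.arr, hσ.px] at h ⊢
      omega
  rintro τ' ⟨hF', hj', hi'', hok⟩
  rw [← hi''] at hi'
  rw [← hok] at hD
  clear hok hF hi''
  rename' τ => τ₁, τ' => τ, hF' => hF
  refine .seq 20 (500 * (n + 1) - 222) (.require hF hD (C := lo ≤ hi) ?_ ?_ (by decide))
    (by omega)
  · simp [hi', hj']
  rintro τ' hF' hD' hreg
  rw [← hreg _ (by decide)] at hi' hj'
  clear hF hD hreg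
  rename' τ => τ₂, τ' => τ, hF' => hF, hD' => hD
  refine (run_columns hσ ⟨ep, eq, er, es⟩ hF hi' hj' (And.right) ?_ ?_ hD).mono (by omega) fun τ' h => ?_
  · exact hp'.1.trans (le_max_left _ _)
  · exact (min_le_left _ _).trans hq'.2
  · simpa only [true_and] using h

end

/-! ## The queue of the reached quads -/

/-- The cell of a quadruple of indices in the array of the reached quads. -/
def cellOf (k : ℤ) (z : ℤ × ℤ × ℤ × ℤ) : ℤ := ((z.1 * k + z.2.1) * k + z.2.2.1) * k + z.2.2.2

/-- The indices are those of listed points. -/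
def InRange (k : ℕ) (z : ℤ × ℤ × ℤ × ℤ) : Prop :=
  (0 ≤ z.1 ∧ z.1 < k) ∧ (0 ≤ z.2.1 ∧ z.2.1 < k) ∧ (0 ≤ z.2.2.1 ∧ z.2.2.1 < k) ∧
    (0 ≤ z.2.2.2 ∧ z.2.2.2 < k)

theorem eq_of_mul_add_eq {k a b c d : ℤ} (hb : 0 ≤ b ∧ b < k) (hd : 0 ≤ d ∧ d < k)
    (h : a * k + b = c * k + d) : a = c ∧ b = d := by
  have h1 : (a * k + b) / k = a := by
    rw [add_comm, Int.add_mul_ediv_right _ _ (by omega), Int.ediv_eq_zero_of_lt hb.1 hb.2, zero_add]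
  have h2 : (c * k + d) / k = c := by
    rw [add_comm, Int.add_mul_ediv_right _ _ (by omega), Int.ediv_eq_zero_of_lt hd.1 hd.2, zero_add]
  obtain rfl : a = c := by rw [← h1, h, h2]
  exact ⟨rfl, by linarith⟩

theorem cellOf_inj {k : ℕ} {y z : ℤ × ℤ × ℤ × ℤ} (hy : InRange k y) (hz : InRange k z)
    (h : cellOf k y = cellOf k z) : y = z := by
  obtain ⟨-, hy2, hy3, hy4⟩ := hy
  obtain ⟨-, hz2, hz3, hz4⟩ := hz
  obtain ⟨h, h4⟩ := eq_of_mul_add_eq hy4 hz4 h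
  obtain ⟨h, h3⟩ := eq_of_mul_add_eq hy3 hz3 h
  obtain ⟨h1, h2⟩ := eq_of_mul_add_eq hy2 hz2 h
  exact Prod.ext h1 (Prod.ext h2 (Prod.ext h3 h4))

/-- Bounds the number of stored quads, hence the number of expansions. -/
theorem length_le_of_inRange {k : ℕ} {L : List (ℤ × ℤ × ℤ × ℤ)} (h : L.Nodup)
    (h' : ∀ z ∈ L, InRange k z) : L.length ≤ k ^ 4 := by
  let I := Finset.Ico (0 : ℤ) k
  have hsub : L.toFinset ⊆ I ×ˢ I ×ˢ I ×ˢ I := by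
    intro z hz
    have := h' z (List.mem_toFinset.1 hz)
    simpa [I, InRange] using this
  have := Finset.card_le_card hsub
  rw [List.toFinset_card_of_nodup h] at this
  simp only [Finset.card_product, I, Int.card_Ico, sub_zero, Int.toNat_natCast] at this
  calc _ ≤ _ := this
    _ = _ := by ring

/-- The node `q` is reached from the left-most nodes. -/
def Reach {n : ℕ} (w : Fin n → ℤ) (q : Quad) : Prop :=
  ∃ q₁, IsLeft w q₁ ∧ Relation.ReflTransGen (Edge w) q₁ q

theorem Reach.isNode {n : ℕ} {w : Fin n → ℤ} {q : Quad} (h : Reach w q) : IsNode w q := by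
  obtain ⟨q₁, h, h'⟩ := h
  cases h' with
  | refl => exact h.1
  | tail _ h => exact h.2.1

theorem Reach.tail {n : ℕ} {w : Fin n → ℤ} {q q' : Quad} (h : Reach w q) (h' : Edge w q q') :
    Reach w q' := by
  obtain ⟨q₁, h1, h2⟩ := h
  exact ⟨q₁, h1, h2.tail h'⟩

/-- The arrays describe the list `L` of the reached quads. -/
structure Queue {n : ℕ} (w : Fin n → ℤ) (k : ℕ) (f : ℤ → ℤ × ℤ) (L : List (ℤ × ℤ × ℤ × ℤ))
    (σ : Mem Reg Arr) : Prop where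
  t : σ.reg .t = L.length
  get : ∀ (i : ℕ) (h : i < L.length),
    (σ.arr .qa i, σ.arr .qb i, σ.arr .qc i, σ.arr .qd i) = L[i]
  seen : ∀ z, InRange k z → (σ.arr .seen (cellOf k z) = 0 ↔ z ∉ L)
  range : ∀ z ∈ L, InRange k z
  nodup : L.Nodup
  reach : ∀ z ∈ L, Reach w (quadAt f z)
  found : (σ.reg .found = 1 ∧ ∃ z ∈ L, IsRight w (quadAt f z)) ∨
    (σ.reg .found = 0 ∧ ∀ z ∈ L, ¬ IsRight w (quadAt f z))

/-- The states differ only in the registers and arrays that change during a visit. -/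
structure Keep (σ τ : Mem Reg Arr) : Prop where
  px : ∀ i, τ.arr .px i = σ.arr .px i
  py : ∀ i, τ.arr .py i = σ.arr .py i
  v : ∀ i, τ.arr .v i = σ.arr .v i
  reg : ∀ z, z ≠ .ok → z ≠ .i → z ≠ .j → z ≠ .t → z ≠ .found → τ.reg z = σ.reg z

theorem Frame.keep {σ τ : Mem Reg Arr} (h : Frame σ τ) : Keep σ τ :=
  ⟨by simp [h.arr], by simp [h.arr], by simp [h.arr], fun z h1 h2 h3 _ _ => h.reg z h1 h2 h3⟩

section
variable {n : ℕ} {w : Fin n → ℤ} {k : ℕ} {f : ℤ → ℤ × ℤ} {σ τ : Mem Reg Arr}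
  {L : List (ℤ × ℤ × ℤ × ℤ)}

theorem World.congr (h : World w k f σ) (hn : τ.reg .n = σ.reg .n) (hk : τ.reg .k = σ.reg .k)
    (hlo : τ.reg .lo = σ.reg .lo) (hpx : ∀ i, τ.arr .px i = σ.arr .px i)
    (hpy : ∀ i, τ.arr .py i = σ.arr .py i) (hv : ∀ i, τ.arr .v i = σ.arr .v i) :
    World w k f τ :=
  ⟨hn.trans h.n_eq, hk.trans h.k_eq, fun z => (hpx z).trans (h.px z),
    fun z => (hpy z).trans (h.py z), fun j => by rw [hv, hlo]; exact h.v j⟩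

theorem World.keep (h : World w k f σ) (hK : Keep σ τ) : World w k f τ :=
  h.congr (hK.reg _ (by decide) (by decide) (by decide) (by decide) (by decide))
    (hK.reg _ (by decide) (by decide) (by decide) (by decide) (by decide))
    (hK.reg _ (by decide) (by decide) (by decide) (by decide) (by decide)) hK.px hK.py hK.v

theorem Queue.congr (h : Queue w k f L σ) (harr : τ.arr = σ.arr) (ht : τ.reg .t = σ.reg .t)
    (hf : τ.reg .found = σ.reg .found) : Queue w k f L τ := by
  obtain ⟨h1, h2, h3, h4, h5, h6, h7⟩ := h
  exact ⟨ht.trans h1, by simpa [harr] using h2, by simpa [harr] using h3, h4, h5, h6,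
    by simpa [hf] using h7⟩

/-- For a node, the count in the last column determines the upper right end from the lower one, so
the program need not test it. -/
theorem isRight_quadAt_iff {p q r s : ℤ} (h : IsNode w (quadAt f (p, q, r, s))) :
    IsRight w (quadAt f (p, q, r, s)) ↔
      ((f q).1 = (n : ℤ) - 1 ∧ (f s).1 = (n : ℤ) - 1) ∧ 0 ≤ (f q).2 ∧ (f q).2 ≤ (n : ℤ) - 1 := by
  constructor
  · rintro ⟨-, hn, y, h1, h2, h3, h4⟩
    simp only [quadAt] at h3 h4
    simp [h3, h4, h1, h2]
  · rintro ⟨⟨h1, h2⟩, h3, h4⟩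
    have hpq : (f p).1 < (f q).1 := h.lower_lt
    have hrs : (f r).1 < (f s).1 := h.upper_lt
    have hp := (Region.fst_mem (h.region (show f p ∈ _ by simp [quadAt, Quad.vertices]))).1
    refine ⟨h, by omega, (f q).2, h3, h4, Prod.ext h1 rfl, Prod.ext h2 ?_⟩
    have hn : 0 < n := by omega
    have e : ((n - 1 : ℕ) : ℤ) = (n : ℤ) - 1 := by omega
    have := h.xray ⟨n - 1, by omega⟩ (by simp only [Quad.first, quadAt]; omega)
      (by simp only [Quad.last, quadAt]; omega)
    simp only [e, quadAt] at this
    rw [← h2, show (Seg.mk (f r) (f s)).height (f s).1 = (f s).2 from Seg.height_right _ hrs,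
      h2, ← h1, show (Seg.mk (f p) (f q)).height (f q).1 = (f q).2 from Seg.height_right _ hpq,
      Int.floor_intCast, Int.ceil_intCast] at this
    simp only [quadAt]
    omega

/-- The list only grows at its end, so positions and previous memberships remain valid. Soundness
enters through `hC`, used exactly when the candidate is stored. -/
theorem run_visit (hw : Listing w k f) (hσ : World w k f σ) (hL : Queue w k f L σ)
    {p q r s : ℤ} (hz : InRange k (p, q, r, s))
    (hregs : σ.reg .p = p ∧ σ.reg .q = q ∧ σ.reg .r = r ∧ σ.reg .s = s)
    {turn : B} {source : E} {C : Prop} (hturn : ∀ τ, Frame σ τ → (turn.eval τ ↔ C))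
    (hC : IsNode w (quadAt f (p, q, r, s)) → C → Reach w (quadAt f (p, q, r, s)))
    (hc : turn.cost ≤ 40) (hc' : source.cost ≤ 3) :
    Run (visit turn source) σ (800 * (n + 1)) fun τ => Keep σ τ ∧ ∃ L', Queue w k f L' τ ∧
      L <+: L' ∧ (IsNode w (quadAt f (p, q, r, s)) → C → (p, q, r, s) ∈ L') := by
  obtain ⟨e1, e2, e3, e4⟩ := hregs
  have hcell : cell.eval σ = cellOf k (p, q, r, s) := by
    simp [cell, cellOf, e1, e2, e3, e4, hσ.k_eq]
  refine .ite (700 * (n + 1)) (fun h => ?_) (fun h => .skip ⟨(Frame.refl σ).keep, L, hL,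
    List.prefix_refl _, fun _ _ => ?_⟩ (by omega)) (by
      rw [show (BExpr.eq (.read .seen cell) 0 : B).cost = 16 by decide]; omega)
  swap
  · simp only [eval_eq, eval_read, hcell, eval_zero] at h
    by_contra h'
    exact h ((hL.seen _ hz).2 h')
  have hnew : (p, q, r, s) ∉ L := (hL.seen _ hz).1 (by simpa [hcell] using h)
  refine .seq _ (700 * (n + 1) - 500 * (n + 1)) ((run_testNode hw hσ hz.1 hz.2.1 hz.2.2.1 hz.2.2.2
    e1 e2 e3 e4).mono le_rfl ?_) (by omega)
  rintro τ ⟨hF, hD⟩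
  refine .seq 50 150 (.require hF hD (hturn τ hF) ?_ (by omega)) (by omega)
  clear hF hD
  rintro τ hF hD -
  refine .ite 140 (fun h => ?_) (fun h => .skip ⟨hF.keep, L, hL.congr hF.arr
    (hF.reg _ (by decide) (by decide) (by decide)) (hF.reg _ (by decide) (by decide) (by decide)),
    List.prefix_refl _, fun h1 h2 => ?_⟩ (by omega)) (by decide)
  swap
  · rcases hD with hD | hD
    · simp [hD.1] at h
    · exact absurd ⟨h1, h2⟩ hD.2
  obtain ⟨hnode, hCC⟩ : IsNode w (quadAt f (p, q, r, s)) ∧ C := by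
    rcases hD with hD | hD
    · exact hD.2
    · simp [hD.1] at h
  obtain ⟨g1, g2, g3, g4, g5, g6⟩ := hF.eval hσ ⟨e1, e2, e3, e4⟩
  have gk : τ.reg .k = k := (hF.reg _ (by decide) (by decide) (by decide)).trans hσ.k_eq
  have gt : τ.reg .t = L.length := (hF.reg _ (by decide) (by decide) (by decide)).trans hL.t
  have gf : τ.reg .found = σ.reg .found := hF.reg _ (by decide) (by decide) (by decide)
  have gcell : cell.eval τ = cellOf k (p, q, r, s) := by
    simp [cell, cellOf, g1, g2, g3, g4, gk]
  have hright := isRight_quadAt_iff hnode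
  -- Marking the new cell changes no other mark, by injectivity of the numbering in base `k`.
  have hseen : ∀ z, InRange k z → (cellOf k z ≠ cellOf k (p, q, r, s) ∧
      σ.arr .seen (cellOf k z) = 0 ↔ z ∉ L ++ [(p, q, r, s)]) := by
    intro z hz'
    rw [hL.seen z hz', List.mem_append, List.mem_singleton, not_or, and_comm]
    exact and_congr_right fun _ => not_congr ⟨cellOf_inj hz' hz, fun h => by rw [h]⟩
  have hget : ∀ (X : ℤ → ℤ × ℤ × ℤ × ℤ), (∀ i : ℕ, i < L.length →
      X i = (σ.arr .qa i, σ.arr .qb i, σ.arr .qc i, σ.arr .qd i)) → X L.length = (p, q, r, s) →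
      ∀ (i : ℕ) (h : i < (L ++ [(p, q, r, s)]).length), X i = (L ++ [(p, q, r, s)])[i] := by
    intro X h1 h2 i h
    rcases lt_or_eq_of_le (Nat.le_of_lt_succ (by simpa using h)) with h3 | rfl
    · rw [List.getElem_append_left h3, h1 i h3, hL.get i h3]
    · simp [h2]
  refine .seq 20 115 (.write ?_ (by decide)) (by omega)
  refine .seq 5 105 (.write ?_ (by decide)) (by omega)
  refine .seq 5 95 (.write ?_ (by decide)) (by omega)
  refine .seq 5 85 (.write ?_ (by decide)) (by omega)
  refine .seq 5 75 (.write ?_ (by decide)) (by omega)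
  refine .seq 10 65 (.write ?_ (by simp [AExpr.cost]; omega)) (by omega)
  refine .seq 5 55 (.assign ?_ (by decide)) (by omega)
  -- The content of the new cell of `ante` is left unspecified, as antecedents are never read.
  have key : ∀ τ' : Mem Reg Arr, (∀ a j, τ'.arr a j =
      if a = .ante ∧ j = L.length then τ'.arr .ante L.length
      else if a = .qd ∧ j = L.length then s
      else if a = .qc ∧ j = L.length then r
      else if a = .qb ∧ j = L.length then q
      else if a = .qa ∧ j = L.length then p
      else if a = .seen ∧ j = cellOf k (p, q, r, s) then 1 else σ.arr a j) →
      (∀ z, z ≠ .ok → z ≠ .i → z ≠ .j → z ≠ .t → z ≠ .found → τ'.reg z = σ.reg z) →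
      τ'.reg .t = L.length + 1 →
      ((τ'.reg .found = 1 ∧ ∃ z ∈ L ++ [(p, q, r, s)], IsRight w (quadAt f z)) ∨
        (τ'.reg .found = 0 ∧ ∀ z ∈ L ++ [(p, q, r, s)], ¬ IsRight w (quadAt f z))) →
      Keep σ τ' ∧ ∃ L', Queue w k f L' τ' ∧
        L <+: L' ∧ (IsNode w (quadAt f (p, q, r, s)) → C → (p, q, r, s) ∈ L') := by
    intro τ' h1 h2 h3 h4
    refine ⟨⟨fun i => by rw [h1]; simp, fun i => by rw [h1]; simp, fun i => by rw [h1]; simp, h2⟩,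
      L ++ [(p, q, r, s)], ⟨by simp [h3], ?_, ?_, ?_, ?_, ?_, h4⟩, List.prefix_append _ _,
      fun _ _ => by simp⟩
    · refine hget (fun i => (τ'.arr .qa i, τ'.arr .qb i, τ'.arr .qc i, τ'.arr .qd i)) ?_ ?_
      · intro i hi
        have : (i : ℤ) ≠ L.length := by omega
        simp only [h1 .qa, h1 .qb, h1 .qc, h1 .qd, this]
        simp
      · simp only [h1 .qa, h1 .qb, h1 .qc, h1 .qd]
        simp
    · intro z hz'
      rw [← hseen z hz', h1]
      by_cases hc : cellOf k z = cellOf k (p, q, r, s) <;> simp [hc]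
    · intro z hz'
      rcases List.mem_append.1 hz' with h | h
      · exact hL.range z h
      · rw [List.mem_singleton.1 h]; exact hz
    · exact List.nodup_append.2 ⟨hL.nodup, by simp, by
        intro a ha b hb; rw [List.mem_singleton.1 hb]; rintro rfl; exact hnew ha⟩
    · intro z hz'
      rcases List.mem_append.1 hz' with h | h
      · exact hL.reach z h
      · rw [List.mem_singleton.1 h]; exact hC hnode hCC
  have main : ∀ τ' : Mem Reg Arr, (∀ a j, τ'.arr a j =
      if a = .ante ∧ j = L.length then τ'.arr .ante L.length
      else if a = .qd ∧ j = L.length then s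
      else if a = .qc ∧ j = L.length then r
      else if a = .qb ∧ j = L.length then q
      else if a = .qa ∧ j = L.length then p
      else if a = .seen ∧ j = cellOf k (p, q, r, s) then 1 else σ.arr a j) →
      (∀ z, z ≠ .t → τ'.reg z = τ.reg z) → τ'.reg .t = L.length + 1 →
      Run (when isRightQuad (.found <~ 1)) τ' 55 fun τ => Keep σ τ ∧ ∃ L', Queue w k f L' τ ∧
        L <+: L' ∧ (IsNode w (quadAt f (p, q, r, s)) → C → (p, q, r, s) ∈ L') := by
    intro τ' h1 h2 h3
    have h4 : isRightQuad.eval τ' ↔ IsRight w (quadAt f (p, q, r, s)) := by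
      have hx : ∀ i, τ'.arr .px i = (f i).1 := fun i => by rw [h1]; simp [hσ.px]
      have hy : ∀ i, τ'.arr .py i = (f i).2 := fun i => by rw [h1]; simp [hσ.py]
      rw [hright]
      simp [isRightQuad, hx, hy, h2, g2, g4, g5]
    have h5 : ∀ z, z ≠ .ok → z ≠ .i → z ≠ .j → z ≠ .t → z ≠ .found →
        τ'.reg z = σ.reg z := fun z a b c d _ => (h2 z d).trans (hF.reg z a b c)
    refine .ite 10 (fun h => .assign (key _ h1 ?_ (by simpa using h3) (Or.inl ⟨by simp, ?_⟩))
      (by decide)) (fun h => .skip (key _ h1 h5 h3 ?_) (by decide)) (by decide)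
    · intro z a b c d e
      simp [e, h5 z a b c d e]
    · exact ⟨_, by simp, h4.1 h⟩
    · rw [h2 _ (by decide), gf]
      rcases hL.found with ⟨hf, z, hz, hz'⟩ | ⟨hf, hz⟩
      · exact Or.inl ⟨hf, z, by simp [hz], hz'⟩
      · refine Or.inr ⟨hf, fun z hz' => ?_⟩
        rcases List.mem_append.1 hz' with h' | h'
        · exact hz z h'
        · rw [List.mem_singleton.1 h', ← h4]; exact h
  refine main _ ?_ ?_ ?_
  · intro a j
    simp [g1, g2, g3, g4, gcell, gt, hF.arr]
  · intro z hz
    simp [hz]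
  · simp [gt]

end

/-! ## The search of a path -/

section
variable {n : ℕ} {w : Fin n → ℤ} {k : ℕ} {f : ℤ → ℤ × ℤ} {σ τ : Mem Reg Arr}
  {L : List (ℤ × ℤ × ℤ × ℤ)}

theorem World.set (h : World w k f σ) (u : Reg) (a : ℤ) (h1 : u ≠ .n) (h2 : u ≠ .k)
    (h3 : u ≠ .lo) : World w k f (σ.setReg u a) :=
  h.congr (by simp [h1.symm]) (by simp [h2.symm]) (by simp [h3.symm]) (fun _ => rfl)
    (fun _ => rfl) (fun _ => rfl)

theorem Queue.set (h : Queue w k f L σ) (u : Reg) (a : ℤ) (h1 : u ≠ .t) (h2 : u ≠ .found) :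
    Queue w k f L (σ.setReg u a) :=
  h.congr rfl (by simp [h1.symm]) (by simp [h2.symm])

theorem Keep.get (h : Keep σ τ) (u : Reg) (hu : (u ≠ .ok ∧ u ≠ .i ∧ u ≠ .j ∧ u ≠ .t ∧ u ≠ .found)) :
    τ.reg u = σ.reg u := h.reg u hu.1 hu.2.1 hu.2.2.1 hu.2.2.2.1 hu.2.2.2.2

/-- The states differ only in the registers of the candidate. -/
structure Load (σ τ : Mem Reg Arr) : Prop where
  arr : τ.arr = σ.arr
  reg : ∀ z, z ≠ .p → z ≠ .q → z ≠ .r → z ≠ .s → τ.reg z = σ.reg z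

theorem Load.world (h : Load σ τ) (hσ : World w k f σ) : World w k f τ :=
  hσ.congr (h.reg _ (by decide) (by decide) (by decide) (by decide))
    (h.reg _ (by decide) (by decide) (by decide) (by decide))
    (h.reg _ (by decide) (by decide) (by decide) (by decide)) (by simp [h.arr]) (by simp [h.arr])
    (by simp [h.arr])

theorem Load.queue (h : Load σ τ) (hL : Queue w k f L σ) : Queue w k f L τ :=
  hL.congr h.arr (h.reg _ (by decide) (by decide) (by decide) (by decide))
    (h.reg _ (by decide) (by decide) (by decide) (by decide))

theorem Load.set (h : Load σ τ) (u : Reg) (a : ℤ) (hu : u = .p ∨ u = .q ∨ u = .r ∨ u = .s) :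
    Load σ (τ.setReg u a) := by
  refine ⟨h.arr, fun z h1 h2 h3 h4 => ?_⟩
  rw [Mem.setReg_reg, if_neg (by rintro rfl; rcases hu with h | h | h | h <;> contradiction),
    h.reg z h1 h2 h3 h4]

/-- The four values are required in every state that differs only in the registers of the candidate,
so the order of the assignments does not matter. -/
theorem run_load {p q r s : ℤ} {e₁ e₂ e₃ e₄ : E} {S : P} {T : ℕ} {Q : Mem Reg Arr → Prop}
    (h₁ : ∀ τ, Load σ τ → e₁.eval τ = p) (h₂ : ∀ τ, Load σ τ → e₂.eval τ = q)
    (h₃ : ∀ τ, Load σ τ → e₃.eval τ = r) (h₄ : ∀ τ, Load σ τ → e₄.eval τ = s)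
    (hc : e₁.cost + e₂.cost + e₃.cost + e₄.cost ≤ 20)
    (hS : ∀ τ, Load σ τ → (τ.reg .p = p ∧ τ.reg .q = q ∧ τ.reg .r = r ∧ τ.reg .s = s) →
      Run S τ T Q) :
    Run (.p <~ e₁ ;; .q <~ e₂ ;; .r <~ e₃ ;; .s <~ e₄ ;; S) σ (T + 24) Q := by
  have l0 : Load σ σ := ⟨rfl, fun _ _ _ _ _ => rfl⟩
  have l1 := l0.set .p p (by simp)
  have l2 := l1.set .q q (by simp)
  have l3 := l2.set .r r (by simp)
  have l4 := l3.set .s s (by simp)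
  refine .seq (e₁.cost + 1) (e₂.cost + 1 + (e₃.cost + 1 + (e₄.cost + 1 + T)))
    (.assign ?_ le_rfl) (by omega)
  rw [h₁ _ l0]
  refine .seq (e₂.cost + 1) (e₃.cost + 1 + (e₄.cost + 1 + T)) (.assign ?_ le_rfl) (by omega)
  rw [h₂ _ l1]
  refine .seq (e₃.cost + 1) (e₄.cost + 1 + T) (.assign ?_ le_rfl) (by omega)
  rw [h₃ _ l2]
  refine .seq (e₄.cost + 1) T (.assign ?_ le_rfl) (by omega)
  rw [h₄ _ l3]
  exact hS _ l4 (by simp)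

theorem IsNode.isLeft {q : Quad} (hn : 0 < n) (h : IsNode w q) (h1 : q.lower.left = (0, 0))
    (h2 : q.upper.left = (0, w ⟨0, hn⟩ - 1)) : IsLeft w q := ⟨h, h1, hn, h2⟩

/-- The left ends have the fixed indices `w₀` and `2 * w₀ - 1`, so two nested loops over the right
ends suffice. The turn condition is trivial because these nodes need no predecessor. -/
theorem run_visitLeft (hw : Listing w k f) (hσ : World w k f σ) (hn : 0 < n) {w₀ : ℤ}
    (hw₀ : w ⟨0, hn⟩ = w₀) (hpos : 0 < w₀) (hk : 2 * w₀ ≤ k) (hf1 : f w₀ = (0, 0))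
    (hf2 : f (2 * w₀ - 1) = (0, w₀ - 1)) (hseen : ∀ i, σ.arr .seen i = 0) :
    Run visitLeft σ ((k + 1) * ((k + 1) * (1000 * (n + 1)) + 30) + 20) fun τ =>
      World w k f τ ∧ τ.reg .h = 0 ∧ ∃ L, Queue w k f L τ ∧
        ∀ b d : ℤ, 0 ≤ b → b < k → 0 ≤ d → d < k →
          IsNode w (quadAt f (w₀, b, 2 * w₀ - 1, d)) → (w₀, b, 2 * w₀ - 1, d) ∈ L := by
  have hW : ∀ τ, World w k f τ → (W 0).eval τ = w₀ := fun τ h => by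
    have := h.v ⟨0, hn⟩
    simpa [hw₀] using this
  set Good : ℤ → ℤ → List (ℤ × ℤ × ℤ × ℤ) → Prop := fun b d L =>
    IsNode w (quadAt f (w₀, b, 2 * w₀ - 1, d)) → (w₀, b, 2 * w₀ - 1, d) ∈ L with hGood
  refine .seq 2 _ (.assign ?_ (by decide)) (Nat.add_sub_of_le (by omega)).le
  refine .seq 2 _ (.assign ?_ (by decide)) (Nat.add_sub_of_le (by omega)).le
  refine .seq 2 _ (.assign ?_ (by decide)) (Nat.add_sub_of_le (by omega)).le
  refine .seq 2 _ (.assign ?_ (by decide)) (Nat.add_sub_of_le (by omega)).le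
  refine .loop ((k + 1) * (1000 * (n + 1)) + 20) k (fun j τ => World w k f τ ∧ τ.reg .h = 0 ∧
    0 ≤ τ.reg .b ∧ τ.reg .b + j = k ∧ ∃ L, Queue w k f L τ ∧
      ∀ b d : ℤ, 0 ≤ b → b < τ.reg .b → 0 ≤ d → d < k → Good b d L) ?_ ?_ ?_ ?_
  · refine ⟨(((hσ.set _ _ ?_ ?_ ?_).set _ _ ?_ ?_ ?_).set _ _ ?_ ?_ ?_).set _ _ ?_ ?_ ?_, ?_, ?_, ?_,
      [], ⟨?_, ?_, ?_, ?_, ?_, ?_, ?_⟩, ?_⟩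
    all_goals first | decide | skip
    all_goals simp [hseen]
    omega
  · rintro j τ ⟨h1, h2, h3, h4, L, h5, h6⟩ hb
    simp only [eval_lt, eval_reg, h1.k_eq] at hb
    refine ⟨by omega, ?_⟩
    obtain ⟨b₀, hb₀⟩ : ∃ b₀, τ.reg .b = b₀ := ⟨_, rfl⟩
    rw [hb₀] at h3 h4 h6 hb
    refine .seq 2 ((k + 1) * (1000 * (n + 1)) + 15) (.assign ?_ (by decide)) (by omega)
    refine .seq ((k + 1) * (1000 * (n + 1))) 10 ?_ (by omega)
    refine .loop (900 * (n + 1)) k (fun j τ => World w k f τ ∧ τ.reg .h = 0 ∧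
      τ.reg .b = b₀ ∧ 0 ≤ τ.reg .d ∧ τ.reg .d + j = k ∧ ∃ L, Queue w k f L τ ∧
      (∀ b d : ℤ, 0 ≤ b → b < b₀ → 0 ≤ d → d < k → Good b d L) ∧
      ∀ d : ℤ, 0 ≤ d → d < τ.reg .d → Good b₀ d L) ?_ ?_ ?_ ?_
    · exact ⟨h1.set _ _ (by decide) (by decide) (by decide), by simpa using h2, by simp [hb₀],
        by simp, by simp, L, h5.set _ _ (by decide) (by decide), h6, fun d h h' => by
          simp at h'; omega⟩
    · clear hb₀ h1 h2 h5 h6 τ L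
      rintro j τ ⟨h1, h2, h3, h4, h5, L, h6, h7, h8⟩ hd
      simp only [eval_lt, eval_reg, h1.k_eq] at hd
      refine ⟨by omega, ?_⟩
      refine (run_load (p := w₀) (q := b₀) (r := 2 * w₀ - 1) (s := τ.reg .d)
        (T := 800 * (n + 1) + 5) (fun τ' h => hW τ' (h.world h1)) (fun τ' h => by simp [h.reg, h3])
        (fun τ' h => by rw [eval_sub, eval_mul, hW τ' (h.world h1)]; rfl)
        (fun τ' h => by simp [h.reg]) (by decide) ?_).mono (by omega) fun _ h => h
      intro τ₁ hl hregs
      refine .seq (800 * (n + 1)) 5 ((run_visit hw (hl.world h1) (hl.queue h6)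
        (C := True) ⟨⟨by omega, by omega⟩, ⟨by omega, by omega⟩,
          ⟨by simp only; omega, by simp only; omega⟩, ⟨by simp only; omega, by simp only; omega⟩⟩
        hregs (fun τ _ => by simp) ?_
          (by decide) (by decide)).mono le_rfl ?_) (by omega)
      · intro hN _
        exact ⟨_, hN.isLeft hn hf1 (by rw [hw₀]; exact hf2), .refl⟩
      · rintro τ' ⟨hK, L', h9, h10, h11⟩
        refine .assign ⟨((hl.world h1).keep hK).set _ _ (by decide) (by decide) (by decide), ?_, ?_, ?_, ?_,
          L', h9.set _ _ (by decide) (by decide), ?_, ?_⟩ (by decide)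
        · simp [hK.get .h (by decide), hl.reg, h2]
        · simp [hK.get .b (by decide), hl.reg, h3]
        · simp [hK.get .d (by decide), hl.reg]; omega
        · simp [hK.get .d (by decide), hl.reg]; omega
        · intro b d a1 a2 a3 a4 hN
          exact h10.subset (h7 b d a1 a2 a3 a4 hN)
        · intro d a1 a2
          simp [hK.get .d (by decide), hl.reg] at a2
          rcases (by omega : d < τ.reg .d ∨ d = τ.reg .d) with a3 | rfl
          · exact fun hN => h10.subset (h8 d a1 a3 hN)
          · exact fun hN => h11 hN trivial
    · clear hb₀ h1 h2 h5 h6 τ L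
      rintro j' τ ⟨h1, h2, h3', h4, h5, L, h6, h7, h8⟩ hd
      simp only [eval_lt, eval_reg, h1.k_eq] at hd
      refine .assign ⟨h1.set _ _ (by decide) (by decide) (by decide), by simpa using h2, ?_, ?_,
          L, h6.set _ _ (by decide) (by decide), ?_⟩ (by decide)
      · simp [h3']; omega
      · simp [h3']; omega
      · intro b d a1 a2 a3 a4
        simp [h3'] at a2
        rcases (by omega : b < b₀ ∨ b = b₀) with a5 | rfl
        · exact h7 b d a1 a5 a3 a4
        · exact h8 d a3 (by omega)
    · exact Nat.mul_le_mul_left _ (by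
        rw [show (BExpr.lt (g .d) (g .k)).cost = 3 by decide]; omega)
  · rintro j τ ⟨h1, h2, h3, h4, L, h5, h6⟩ hb
    simp only [eval_lt, eval_reg, h1.k_eq] at hb
    exact ⟨h1, h2, L, h5, fun b d a1 a2 a3 a4 => h6 b d a1 (by omega) a3 a4⟩
  · rw [show (BExpr.lt (g .b) (g .k)).cost = 3 by decide]
    have : (k + 1) * (3 + 1 + ((k + 1) * (1000 * (n + 1)) + 20)) ≤
      (k + 1) * ((k + 1) * (1000 * (n + 1)) + 30) := Nat.mul_le_mul_left _ (by omega)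
    omega

/-- The successors of the quad of indices `z` are in `L`. -/
def Expanded {n : ℕ} (w : Fin n → ℤ) (f : ℤ → ℤ × ℤ) (L : List (ℤ × ℤ × ℤ × ℤ))
    (z : ℤ × ℤ × ℤ × ℤ) (e : ℤ) : Prop :=
  (IsNode w (quadAt f (z.2.1, e, z.2.2.1, z.2.2.2)) → 0 < cr (f z.1) (f z.2.1) (f e) →
    (z.2.1, e, z.2.2.1, z.2.2.2) ∈ L) ∧
  (IsNode w (quadAt f (z.1, z.2.1, z.2.2.2, e)) → cr (f z.2.2.1) (f z.2.2.2) (f e) < 0 →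
    (z.1, z.2.1, z.2.2.2, e) ∈ L)

theorem Expanded.mono {L' : List (ℤ × ℤ × ℤ × ℤ)} {z : ℤ × ℤ × ℤ × ℤ} {e : ℤ}
    (h : Expanded w f L z e) (hL : L <+: L') : Expanded w f L' z e :=
  ⟨fun h1 h2 => hL.subset (h.1 h1 h2), fun h1 h2 => hL.subset (h.2 h1 h2)⟩

/-- For each point `e`, both the lower and the upper segment are extended to `e`; a stored candidate
is reached because it is a successor of a reached node. -/
theorem run_expand (hw : Listing w k f) (hσ : World w k f σ) (hL : Queue w k f L σ) {i : ℕ}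
    (hi : i < L.length) (hh : σ.reg .h = i) :
    Run expand σ ((k + 1) * (1900 * (n + 1)) + 40) fun τ =>
      World w k f τ ∧ τ.reg .h = i + 1 ∧ ∃ L', Queue w k f L' τ ∧ L <+: L' ∧
        ∀ e : ℤ, 0 ≤ e → e < k → Expanded w f L' L[i] e := by
  have hmem := List.getElem_mem hi
  have hread := hL.get i hi
  have hreach := hL.reach _ hmem
  have hrange := hL.range _ hmem
  generalize L[i] = z at *
  obtain ⟨a, b, c, d⟩ := z
  simp only [Prod.mk.injEq] at hread
  obtain ⟨r1, r2, r3, r4⟩ := hread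
  refine .seq 5 _ (.assign ?_ (by decide)) (Nat.add_sub_of_le (by omega)).le
  refine .seq 5 _ (.assign ?_ (by decide)) (Nat.add_sub_of_le (by omega)).le
  refine .seq 5 _ (.assign ?_ (by decide)) (Nat.add_sub_of_le (by omega)).le
  refine .seq 5 _ (.assign ?_ (by decide)) (Nat.add_sub_of_le (by omega)).le
  refine .seq 5 ((k + 1) * (1900 * (n + 1)) + 10) (.assign ?_ (by decide)) (by omega)
  refine .seq ((k + 1) * (1900 * (n + 1))) 10 ?_ (by omega)
  refine .loop (1800 * (n + 1)) k (fun j τ => World w k f τ ∧ (τ.reg .h = i ∧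
      τ.reg .a = a ∧ τ.reg .b = b ∧ τ.reg .c = c ∧ τ.reg .d = d) ∧
      0 ≤ τ.reg .e ∧ τ.reg .e + j = k ∧ ∃ L', Queue w k f L' τ ∧ L <+: L' ∧
      ∀ e : ℤ, 0 ≤ e → e < τ.reg .e → Expanded w f L' (a, b, c, d) e) ?_ ?_ ?_ ?_
  · refine ⟨hσ.congr ?_ ?_ ?_ (fun _ => rfl) (fun _ => rfl) (fun _ => rfl), ?_, ?_, ?_,
      L, hL.congr rfl ?_ ?_, List.prefix_refl _, ?_⟩
    all_goals simp [hh, r1, r2, r3, r4]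
    omega
  · rintro j τ ⟨h1, ⟨h2, ea, eb, ec, ed⟩, h3, h4, L', h5, h6, h7⟩ he
    simp only [eval_lt, eval_reg, h1.k_eq] at he
    refine ⟨by omega, ?_⟩
    set e := τ.reg .e with hee
    refine (run_load (p := b) (q := e) (r := c) (s := d) (T := 1700 * (n + 1))
      (fun τ' h => by simp [h.reg, eb]) (fun τ' h => by simp [h.reg, hee])
      (fun τ' h => by simp [h.reg, ec]) (fun τ' h => by simp [h.reg, ed])
      (by decide) ?_).mono (by omega) fun _ h => h
    intro τ₁ hl hregs
    refine .seq (800 * (n + 1)) (900 * (n + 1)) ((run_visit hw (hl.world h1) (hl.queue h5)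
      (p := b) (q := e) (r := c) (s := d) (C := 0 < cr (f a) (f b) (f e)) ⟨hrange.2.1, ⟨h3, he⟩, hrange.2.2.1, hrange.2.2.2⟩
      hregs ?_ ?_ (by decide) (by decide)).mono le_rfl ?_) (by omega)
    · intro τ' hF
      simp [cross, cr, hF.arr, hF.reg, hl.arr, hl.reg, h1.px, h1.py, ea, eb, ← hee]
    · intro hN hC
      exact hreach.tail ((edge_lower_iff hreach.isNode).2 ⟨hN, hC⟩)
    rintro τ' ⟨hK, L₁, h8, h9, h10⟩
    have k4 := (hl.world h1).keep hK
    have ea' : τ'.reg .a = a := by simp [hK.get .a (by decide), hl.reg, ea]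
    have eb' : τ'.reg .b = b := by simp [hK.get .b (by decide), hl.reg, eb]
    have ec' : τ'.reg .c = c := by simp [hK.get .c (by decide), hl.reg, ec]
    have ed' : τ'.reg .d = d := by simp [hK.get .d (by decide), hl.reg, ed]
    have ee' : τ'.reg .e = e := by simp [hK.get .e (by decide), hl.reg, hee]
    have eh' : τ'.reg .h = i := by simp [hK.get .h (by decide), hl.reg, h2]
    clear hregs hl hK τ₁
    refine (run_load (p := a) (q := b) (r := d) (s := e) (T := 800 * (n + 1) + 10)
      (fun τ' h => by simp [h.reg, ea']) (fun τ' h => by simp [h.reg, eb'])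
      (fun τ' h => by simp [h.reg, ed']) (fun τ' h => by simp [h.reg, ee'])
      (by decide) ?_).mono (by omega) fun _ h => h
    intro τ₁ hl hregs
    refine .seq (800 * (n + 1)) 10 ((run_visit hw (hl.world k4) (hl.queue h8)
      (p := a) (q := b) (r := d) (s := e) (C := cr (f c) (f d) (f e) < 0) ⟨hrange.1, hrange.2.1, hrange.2.2.2, ⟨h3, he⟩⟩
      hregs ?_ ?_ (by decide) (by decide)).mono le_rfl ?_) (by omega)
    · intro τ'' hF
      simp [cross, cr, hF.arr, hF.reg, hl.arr, hl.reg, k4.px, k4.py, ec', ed', ee']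
    · intro hN hC
      exact hreach.tail ((edge_upper_iff hreach.isNode).2 ⟨hN, hC⟩)
    rintro τ'' ⟨hK, L₂, h11, h12, h13⟩
    refine .assign ⟨((hl.world k4).keep hK).set _ _ (by decide) (by decide) (by decide),
      ⟨?_, ?_, ?_, ?_, ?_⟩, ?_, ?_, L₂, h11.set _ _ (by decide) (by decide),
      h6.trans (h9.trans h12), ?_⟩ (by decide)
    · simp [hK.get .h (by decide), hl.reg, eh']
    · simp [hK.get .a (by decide), hl.reg, ea']
    · simp [hK.get .b (by decide), hl.reg, eb']
    · simp [hK.get .c (by decide), hl.reg, ec']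
    · simp [hK.get .d (by decide), hl.reg, ed']
    · simp [hK.get .e (by decide), hl.reg, ee']; omega
    · simp [hK.get .e (by decide), hl.reg, ee']; omega
    · intro e' a1 a2
      simp [hK.get .e (by decide), hl.reg, ee'] at a2
      rcases (by omega : e' < e ∨ e' = e) with a3 | rfl
      · exact (h7 e' a1 a3).mono (h9.trans h12)
      · exact ⟨fun b1 b2 => h12.subset (h10 b1 b2), h13⟩
  · rintro j τ ⟨h1, ⟨h2, -⟩, h3, h4, L', h5, h6, h7⟩ he
    simp only [eval_lt, eval_reg, h1.k_eq] at he
    refine .assign ⟨h1.set _ _ (by decide) (by decide) (by decide), by simp [h2], L',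
      h5.set _ _ (by decide) (by decide), h6, fun e a1 a2 => h7 e a1 (by omega)⟩ (by decide)
  · exact Nat.mul_le_mul_left _ (by
        rw [show (BExpr.lt (g .e) (g .k)).cost = 3 by decide]; omega)

/-- A set of reached quads that contains the left-most ones and is closed under the edges contains
all the reached ones. -/
theorem mem_of_reach (hw : Listing w k f) (hn : 0 < n) {w₀ : ℤ} (hw₀ : w ⟨0, hn⟩ = w₀)
    (hf1 : f w₀ = (0, 0)) (hf2 : f (2 * w₀ - 1) = (0, w₀ - 1))
    (hleft : ∀ b d : ℤ, 0 ≤ b → b < k → 0 ≤ d → d < k →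
          IsNode w (quadAt f (w₀, b, 2 * w₀ - 1, d)) → (w₀, b, 2 * w₀ - 1, d) ∈ L)
    (hexp : ∀ z ∈ L, ∀ e : ℤ, 0 ≤ e → e < k → Expanded w f L z e) {q : Quad} (hq : Reach w q) :
    ∃ z ∈ L, quadAt f z = q := by
  obtain ⟨q₁, ⟨h1, h2, h3, h4⟩, h5⟩ := hq
  induction h5 with
  | refl =>
    obtain ⟨⟨p, q⟩, ⟨r, s⟩⟩ := q₁
    obtain ⟨b, hb, hb', rfl⟩ := hw.surj q (h1.region (by simp [Quad.vertices]))
    obtain ⟨d, hd, hd', rfl⟩ := hw.surj s (h1.region (by simp [Quad.vertices]))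
    simp only at h2 h4
    have : quadAt f (w₀, b, 2 * w₀ - 1, d) = ⟨⟨p, f b⟩, ⟨r, f d⟩⟩ := by
      simp only [quadAt, hf1, hf2, h2, h4, hw₀]
    refine ⟨_, hleft b d hb hb' hd hd' ?_, this⟩
    rw [this]; exact h1
  | tail _ he ih =>
    obtain ⟨⟨a, b, c, d⟩, hz, rfl⟩ := ih
    have hnode := he.1
    have hnode' := he.2.1
    rcases he.cases with ⟨p, rfl⟩ | ⟨p, rfl⟩
    · obtain ⟨e, h6, h7, rfl⟩ := hw.surj p (hnode'.region (by simp [Quad.vertices]))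
      exact ⟨_, (hexp _ hz e h6 h7).1 hnode' ((edge_lower_iff hnode).1 he).2, rfl⟩
    · obtain ⟨e, h6, h7, rfl⟩ := hw.surj p (hnode'.region (by simp [Quad.vertices]))
      exact ⟨_, (hexp _ hz e h6 h7).2 hnode' ((edge_upper_iff hnode).1 he).2, rfl⟩

/-- The quads before position `h` are expanded, and the fuel is `k ^ 4 - h`: it is positive while
the queue is not exhausted, because the queue has at most `k ^ 4` entries. -/
theorem run_explore (hw : Listing w k f) (hσ : World w k f σ) (hn : 0 < n) {w₀ : ℤ}
    (hw₀ : w ⟨0, hn⟩ = w₀) (hf1 : f w₀ = (0, 0)) (hf2 : f (2 * w₀ - 1) = (0, w₀ - 1))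
    (hh : σ.reg .h = 0) (hL : Queue w k f L σ)
    (hleft : ∀ b d : ℤ, 0 ≤ b → b < k → 0 ≤ d → d < k →
          IsNode w (quadAt f (w₀, b, 2 * w₀ - 1, d)) → (w₀, b, 2 * w₀ - 1, d) ∈ L) :
    Run (.loop (.and (.lt (g .h) (g .t)) (.eq (g .found) 0)) expand) σ
      ((k ^ 4 + 1) * ((k + 1) * (1900 * (n + 1)) + 60)) fun τ =>
      (τ.reg .found = 1 ∧ HasPath w) ∨ (τ.reg .found = 0 ∧ ¬ HasPath w) := by
  refine .loop ((k + 1) * (1900 * (n + 1)) + 40) (k ^ 4) (fun j τ => World w k f τ ∧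
    ∃ L', Queue w k f L' τ ∧ L <+: L' ∧ ∃ i : ℕ, τ.reg .h = i ∧ i + j = k ^ 4 ∧ i ≤ L'.length ∧
      ∀ (l : ℕ) (h : l < L'.length), l < i → ∀ e : ℤ, 0 ≤ e → e < k → Expanded w f L' L'[l] e)
    ⟨hσ, L, hL, List.prefix_refl _, 0, hh, by simp, by simp, fun l _ h => by omega⟩ ?_ ?_ ?_
  · rintro j τ ⟨h1, L', h2, h3, i, h4, h5, h6, h7⟩ hb
    simp only [eval_and, eval_lt, eval_reg, h4, h2.t] at hb
    have hi : i < L'.length := by omega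
    have := length_le_of_inRange h2.nodup h2.range
    refine ⟨by omega, (run_expand hw h1 h2 hi h4).mono le_rfl ?_⟩
    rintro τ' ⟨h8, h9, L'', h10, h11, h12⟩
    have := h11.length_le
    refine ⟨h8, L'', h10, h3.trans h11, i + 1, by simp [h9], by omega, by omega, fun l hl hl' => ?_⟩
    have hll : l < L'.length := by omega
    rw [← h11.getElem hll]
    rcases (by omega : l < i ∨ l = i) with h | rfl
    · exact fun e a1 a2 => (h7 l hll h e a1 a2).mono h11
    · exact h12
  · rintro j τ ⟨h1, L', h2, h3, i, h4, h5, h6, h7⟩ hb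
    rcases h2.found with ⟨h8, z, hz, hz'⟩ | ⟨h8, h9⟩
    · obtain ⟨q₁, h9, h10⟩ := h2.reach z hz
      exact Or.inl ⟨h8, q₁, _, h9, hz', h10⟩
    · refine Or.inr ⟨h8, ?_⟩
      rintro ⟨q₁, q, h10, h11, h12⟩
      -- With `found = 0` the loop can only have stopped at the end of the queue, so every entry is
      -- expanded.
      simp [h4, h2.t, h8] at hb
      obtain ⟨z, hz, rfl⟩ := mem_of_reach (L := L') hw hn hw₀ hf1 hf2
        (fun b d a1 a2 a3 a4 a5 => h3.subset (hleft b d a1 a2 a3 a4 a5)) (by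
          intro z hz
          obtain ⟨l, hl, rfl⟩ := List.getElem_of_mem hz
          exact h7 l hl (by omega)) ⟨q₁, h10, h12⟩
      exact h9 z hz h11
  · exact Nat.mul_le_mul_left _ (by
        rw [show (BExpr.and (.lt (g .h) (g .t)) (.eq (g .found) 0)).cost = 7 by decide]; omega)

end

/-! ## The list of the points of the region -/

section
variable {n : ℕ} {w : Fin n → ℤ} {u : ℕ → ℕ}

theorem mem_region_iff (hu : ∀ i : Fin n, (u i : ℤ) = w i) {i : ℕ} {y : ℤ} :
    ((i : ℤ), y) ∈ Region w ↔ i < n ∧ -(u i : ℤ) ≤ y ∧ y ≤ i + u i := by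
  constructor
  · rintro ⟨j, h1, z, h2, h3, h4⟩
    have := j.2
    obtain rfl : i = j := by simpa using h1
    rw [← hu, abs_le] at h4
    simp only at h4 h3
    omega
  · rintro ⟨hi, h1, h2⟩
    -- The point of the column of the triangle nearest to `y`.
    refine ⟨⟨i, hi⟩, rfl, max 0 (min y i), by omega, by simp only; omega, ?_⟩
    rw [← hu ⟨i, hi⟩, abs_le]
    simp only
    omega

/-- The first `k` points are the points of the region that precede `(x, y)`, in lexicographic
order. -/
structure PartialListing (w : Fin n → ℤ) (f : ℤ → ℤ × ℤ) (k x y : ℤ) : Prop where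
  mem : ∀ z, 0 ≤ z → z < k → f z ∈ Region w ∧ ((f z).1 < x ∨ (f z).1 = x ∧ (f z).2 < y)
  mono : ∀ a b, 0 ≤ a → a < b → b < k → (f a).1 < (f b).1 ∨ (f a).1 = (f b).1 ∧ (f a).2 < (f b).2
  surj : ∀ p ∈ Region w, (p.1 < x ∨ p.1 = x ∧ p.2 < y) → ∃ z, 0 ≤ z ∧ z < k ∧ f z = p
  first : ∀ (h : 0 < n) z, 0 ≤ z → z < k → z ≤ 2 * w ⟨0, h⟩ → f z = (0, z - w ⟨0, h⟩)

/-- By `h0`, the first `2 * w 0 + 1` pushes are those of column `0`; this fixes the indices of the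
left ends used in `visitLeft`. -/
theorem PartialListing.push {f f' : ℤ → ℤ × ℤ} {k x y : ℤ} (h : PartialListing w f k x y)
    (hk : 0 ≤ k) (hxy : (x, y) ∈ Region w)
    (h0 : ∀ h : 0 < n, k ≤ 2 * w ⟨0, h⟩ → x = 0 ∧ y = k - w ⟨0, h⟩)
    (hf : ∀ z, z ≠ k → f' z = f z) (hf' : f' k = (x, y)) :
    PartialListing w f' (k + 1) x (y + 1) := by
  obtain ⟨h1, h2, h3, h4⟩ := h
  refine ⟨fun z hz hz' => ?_, fun a b ha hab hb => ?_, fun p hp hp' => ?_,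
    fun hn z hz hz' hz'' => ?_⟩
  · rcases (by omega : z < k ∨ z = k) with h | rfl
    · rw [hf z (by omega)]
      obtain ⟨h5, h6⟩ := h1 z hz h
      exact ⟨h5, by omega⟩
    · rw [hf']
      exact ⟨hxy, Or.inr ⟨rfl, by simp⟩⟩
  · rw [hf a (by omega)]
    rcases (by omega : b < k ∨ b = k) with h | rfl
    · rw [hf b (by omega)]
      exact h2 a b ha hab h
    · rw [hf']
      exact (h1 a ha hab).2
  · by_cases hc : p.1 < x ∨ p.1 = x ∧ p.2 < y
    · obtain ⟨z, h5, h6, h7⟩ := h3 p hp hc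
      exact ⟨z, h5, by omega, by rw [hf z (by omega), h7]⟩
    · exact ⟨k, hk, by omega, by rw [hf']; exact Prod.ext (by simp only; omega) (by simp only; omega)⟩
  · rcases (by omega : z < k ∨ z = k) with h | rfl
    · rw [hf z (by omega)]
      exact h4 hn z hz h hz''
    · obtain ⟨rfl, rfl⟩ := h0 hn hz''
      exact hf'

theorem PartialListing.next {f : ℤ → ℤ × ℤ} {k x y y' : ℤ} (h : PartialListing w f k x y)
    (hx : ∀ p ∈ Region w, p.1 = x → p.2 < y) (hx' : ∀ p ∈ Region w, p.1 = x + 1 → y' ≤ p.2) :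
    PartialListing w f k (x + 1) y' := by
  refine ⟨fun z hz hz' => ?_, h.mono, fun p hp hp' => h.surj p hp ?_, h.first⟩
  · obtain ⟨h1, h2⟩ := h.mem z hz hz'
    exact ⟨h1, by omega⟩
  · have := hx p hp
    have := hx' p hp
    omega

theorem PartialListing.listing {f : ℤ → ℤ × ℤ} {k : ℕ} {y : ℤ} (h : PartialListing w f k n y) :
    Listing w k f := by
  refine ⟨fun z hz hz' => (h.mem z hz hz').1, fun a b ha ha' hb hb' hab => ?_, fun p hp => ?_⟩
  · rcases lt_trichotomy a b with h1 | h1 | h1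
    · have := h.mono a b ha h1 hb'
      rw [hab] at this
      omega
    · exact h1
    · have := h.mono b a hb h1 ha'
      rw [hab] at this
      omega
  · have := (Region.fst_mem hp).2
    exact h.surj p hp (Or.inl (by omega))

/-- The number of points of the region in the first `x` columns, where `u i` is the prescribed
number of points in column `i`. -/
def regionSize (u : ℕ → ℕ) (x : ℕ) : ℕ := ∑ i ∈ Finset.range x, (i + 2 * u i + 1)

theorem regionSize_succ (x : ℕ) : regionSize u (x + 1) = regionSize u x + (x + 2 * u x + 1) :=
  Finset.sum_range_succ _ _

theorem regionSize_mono : Monotone (regionSize u) :=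
  monotone_nat_of_le_succ fun x => by rw [regionSize_succ]; omega

/-- The triangle has about `x ^ 2 / 2` points, and each column adds `u i` points above and below. -/
theorem regionSize_le (u : ℕ → ℕ) (x : ℕ) :
    regionSize u x ≤ x ^ 2 + 2 * ∑ i ∈ Finset.range x, u i := by
  induction x with
  | zero => simp [regionSize]
  | succ x ih =>
    rw [regionSize_succ, Finset.sum_range_succ]
    nlinarith

/-- Since `u` is defined on all naturals, the bound `-u n` makes sense although column `n` does not
exist; it imposes nothing, as the region has no point there. -/
theorem run_listRegion {σ : Mem Reg Arr} (hn : σ.reg .n = n) (hu : ∀ i : Fin n, (u i : ℤ) = w i)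
    (hv : ∀ j : Fin n, σ.arr .v (σ.reg .lo + (j : ℕ)) = w j) :
    Run listRegion σ ((n + 1) * ((regionSize u n + 1) * 60 + 60) + 10) fun τ =>
      (∀ i, τ.arr .seen i = σ.arr .seen i) ∧ ∃ f, World w (regionSize u n) f τ ∧
        PartialListing w f (regionSize u n) n (-u n) := by
  refine .seq 2 _ (.assign ?_ (by decide)) (Nat.add_sub_of_le (by omega)).le
  refine .seq 2 _ (.assign ?_ (by decide)) (Nat.add_sub_of_le (by omega)).le
  refine .loop ((regionSize u n + 1) * 60 + 40) n (fun j τ => (τ.reg .n = n ∧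
    τ.reg .lo = σ.reg .lo ∧ (∀ i, τ.arr .v i = σ.arr .v i) ∧
    (∀ i, τ.arr .seen i = σ.arr .seen i)) ∧ ∃ x : ℕ, τ.reg .x = x ∧ x + j = n ∧
      τ.reg .k = regionSize u x ∧
      PartialListing w (fun z => (τ.arr .px z, τ.arr .py z)) (regionSize u x) x (-u x)) ?_ ?_ ?_ ?_
  · refine ⟨by simp [hn], 0, by simp, by simp, by simp [regionSize], fun z h h' => ?_,
      fun a b ha hab hb => ?_, fun p hp hp' => ?_, fun h z hz hz' => ?_⟩
    · simp [regionSize] at h'; omega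
    · simp [regionSize] at hb; omega
    · have h1 := (Region.fst_mem hp).1
      obtain ⟨a, b⟩ := p
      simp only at hp' h1
      obtain rfl : a = (0 : ℕ) := by simp at hp' ⊢; omega
      have := (mem_region_iff hu).1 hp
      simp at hp' this
      omega
    · simp [regionSize] at hz'; omega
  · rintro j τ ⟨⟨h1, h2, h3, h4⟩, x, h5, h6, h7, h8⟩ hb
    simp only [eval_lt, eval_reg, h1, h5, Nat.cast_lt] at hb
    have hW : ∀ τ' : Mem Reg Arr, τ'.reg .x = x → τ'.reg .lo = σ.reg .lo →
        (∀ i, τ'.arr .v i = σ.arr .v i) → (W (g .x)).eval τ' = u x := by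
      intro τ' a b c
      have := hv ⟨x, hb⟩
      rw [← hu] at this
      simpa [a, b, c] using this
    have hle := regionSize_mono (u := u) (show x + 1 ≤ n from hb)
    rw [regionSize_succ] at hle
    refine ⟨by omega, .seq 10 ((regionSize u n + 1) * 60 + 30) (.assign ?_ (by decide)) (by omega)⟩
    refine .seq ((regionSize u n + 1) * 60) 10 ?_ (by omega)
    refine .loop 40 (x + 2 * u x + 1) (fun j τ => (τ.reg .n = n ∧ τ.reg .x = x ∧
      τ.reg .lo = σ.reg .lo ∧ (∀ i, τ.arr .v i = σ.arr .v i) ∧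
      (∀ i, τ.arr .seen i = σ.arr .seen i)) ∧ -(u x : ℤ) ≤ τ.reg .y ∧
      τ.reg .y + j = x + u x + 1 ∧ τ.reg .k = regionSize u x + (τ.reg .y + u x) ∧
      PartialListing w (fun z => (τ.arr .px z, τ.arr .py z)) (τ.reg .k) x (τ.reg .y)) ?_ ?_ ?_ ?_
    · have hy := hW τ h5 h2 h3
      rw [eval_sub, hy]
      refine ⟨by simp [h1, h2, h3, h4, h5], by simp, ?_, ?_, ?_⟩
      · simp; omega
      · simp [h7]
      · simpa [h7] using h8
    · clear h1 h2 h3 h4 h5 h7 h8 τ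
      rintro j' τ ⟨⟨h1, h2, h3, h4, h5⟩, h7, h8, h9, h10⟩ hb'
      rw [eval_le, eval_add, hW τ h2 h3 h4] at hb'
      simp only [eval_reg, h2] at hb'
      refine ⟨by omega, ?_⟩
      refine .seq 5 35 (.write ?_ (by decide)) (by omega)
      refine .seq 5 30 (.write ?_ (by decide)) (by omega)
      refine .seq 5 25 (.assign ?_ (by decide)) (by omega)
      refine .assign ⟨?_, ?_, ?_, ?_, ?_⟩ (by decide)
      · simp [h1, h2, h3, h4, h5]
      · simp; omega
      · simp; omega
      · simp [h9]; ring
      · have := h10.push (f' := fun z => (if z = τ.reg .k then (x : ℤ) else τ.arr .px z,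
          if z = τ.reg .k then τ.reg .y else τ.arr .py z)) (by omega)
          ((mem_region_iff hu).2 ⟨hb, h7, hb'⟩) ?_ (by intro z hz; simp [hz]) (by simp)
        · simpa [h2] using this
        -- In column `0` the index is `y + u 0`; in later columns the index already exceeds `2 * u
        -- 0`.
        · intro hn hk
          have hu0 := hu ⟨0, hn⟩
          rcases Nat.eq_zero_or_pos x with rfl | hx
          · simp [regionSize] at h9
            simp only at hu0
            exact ⟨rfl, by omega⟩
          · have := regionSize_mono (u := u) (show 1 ≤ x from hx)
            simp [regionSize_succ] at this
            simp only at hu0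
            omega
    · clear h1 h2 h3 h4 h5 h7 h8 τ
      rintro j' τ ⟨⟨h1, h2, h3, h4, h5⟩, h7, h8, h9, h10⟩ hb'
      rw [eval_le, eval_add, hW τ h2 h3 h4] at hb'
      simp only [eval_reg, h2] at hb'
      have hk : τ.reg .k = regionSize u (x + 1) := by
        rw [regionSize_succ]
        push_cast
        omega
      refine .assign ⟨by simp [h1, h3, h4, h5], x + 1, by simp [h2], by omega, by simp [hk], ?_⟩
        (by decide)
      rw [hk] at h10
      refine PartialListing.next h10 ?_ ?_
      · rintro ⟨a, b⟩ hp hpx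
        simp only at hpx
        subst hpx
        have := (mem_region_iff hu).1 hp
        simp only
        omega
      · rintro ⟨a, b⟩ hp hpx
        simp only at hpx
        obtain rfl : a = (x + 1 : ℕ) := by omega
        exact ((mem_region_iff hu).1 hp).2.1
    · rw [show (BExpr.le (g .y) (g .x + W (g .x))).cost = 8 by decide]
      omega
  · rintro j τ ⟨⟨h1, h2, h3, h4⟩, x, h5, h6, h7, h8⟩ hb
    simp only [eval_lt, eval_reg, h1, h5, Nat.cast_lt] at hb
    obtain rfl : x = n := by omega
    exact ⟨h4, _, ⟨h1, h7, fun z => rfl, fun z => rfl, fun j => by rw [h3, h2, hv]⟩, h8⟩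
  · rw [show (BExpr.lt (g .x) (g .n)).cost = 3 by decide]
    have : (n + 1) * (3 + 1 + ((regionSize u n + 1) * 60 + 40)) ≤
      (n + 1) * ((regionSize u n + 1) * 60 + 60) := Nat.mul_le_mul_left _ (by omega)
    omega

end

/-! ## The algorithm -/

section
variable {n : ℕ} {w : Fin n → ℤ} {u : ℕ → ℕ} {σ : Mem Reg Arr}

/-- Among the phases, the exploration dominates: at most `k ^ 4` expansions of `k` rounds, each
linear in `n`. -/
theorem run_search (hn : σ.reg .n = n) (hu : ∀ i : Fin n, (u i : ℤ) = w i)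
    (hv : ∀ j : Fin n, σ.arr .v (σ.reg .lo + (j : ℕ)) = w j) (hn0 : 0 < n)
    (hw0 : 0 < w ⟨0, hn0⟩) (hseen : ∀ i, σ.arr .seen i = 0) :
    Run search σ (4000 * ((n + 1) * (regionSize u n + 1) ^ 5)) fun τ =>
      (HasPath w → τ.reg .out = 1) ∧ (¬ HasPath w → τ.reg .out = 0) := by
  set k := regionSize u n with hk
  have hT : ((n + 1) * ((k + 1) * 60 + 60) + 10) +
      (((k + 1) * ((k + 1) * (1000 * (n + 1)) + 30) + 20) +
      ((k ^ 4 + 1) * ((k + 1) * (1900 * (n + 1)) + 60) + 2)) ≤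
      4000 * ((n + 1) * (k + 1) ^ 5) := by
    have e1 : k ^ 4 + 1 ≤ (k + 1) ^ 4 := by nlinarith [Nat.zero_le (k ^ 3), Nat.zero_le (k ^ 2)]
    have e2 : 1 ≤ (k + 1) ^ 4 := Nat.one_le_pow _ _ (by omega)
    have e3 : (k + 1) * ((k + 1) * (1000 * (n + 1)) + 30) ≤ 1030 * ((n + 1) * (k + 1) ^ 5) := by
      calc (k + 1) * ((k + 1) * (1000 * (n + 1)) + 30)
          ≤ (k + 1) * ((k + 1) * (1000 * (n + 1)) + (k + 1) * (30 * (n + 1))) := by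
            gcongr; nlinarith
        _ = 1030 * ((n + 1) * (k + 1) ^ 2) := by ring
        _ ≤ _ := by gcongr <;> omega
    have e4 : (k ^ 4 + 1) * ((k + 1) * (1900 * (n + 1)) + 60) ≤
        1960 * ((n + 1) * (k + 1) ^ 5) := by
      calc (k ^ 4 + 1) * ((k + 1) * (1900 * (n + 1)) + 60)
          ≤ (k + 1) ^ 4 * ((k + 1) * (1900 * (n + 1)) + (k + 1) * (60 * (n + 1))) := by
            gcongr; nlinarith
        _ = _ := by ring
    have e5 : (n + 1) * ((k + 1) * 60 + 60) ≤ 120 * ((n + 1) * (k + 1) ^ 5) := by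
      calc (n + 1) * ((k + 1) * 60 + 60) ≤ (n + 1) * ((k + 1) * 60 + (k + 1) * 60) := by
            gcongr; omega
        _ = 120 * ((n + 1) * (k + 1) ^ 1) := by ring
        _ ≤ _ := by gcongr <;> omega
    have e6 : 1 ≤ (n + 1) * (k + 1) ^ 5 := Nat.one_le_iff_ne_zero.2 (by positivity)
    omega
  refine Run.mono ?_ hT fun _ h => h
  refine .seq _ _ ((run_listRegion hn hu hv).mono le_rfl ?_) le_rfl
  rintro τ ⟨h1, f, hW, hP⟩
  have hL := hP.listing
  have hw0' : (u 0 : ℤ) = w ⟨0, hn0⟩ := hu ⟨0, hn0⟩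
  have hk2 : 2 * w ⟨0, hn0⟩ ≤ (k : ℤ) - 1 := by
    have := regionSize_mono (u := u) (show 1 ≤ n from hn0)
    simp [regionSize_succ] at this
    omega
  have hf1 : f (w ⟨0, hn0⟩) = (0, 0) := by
    rw [hP.first hn0 _ hw0.le (by omega) (by omega), sub_self]
  have hf2 : f (2 * w ⟨0, hn0⟩ - 1) = (0, w ⟨0, hn0⟩ - 1) := by
    rw [hP.first hn0 _ (by omega) (by omega) (by omega)]
    congr 1
    ring
  refine .seq _ _ ((run_visitLeft hL hW hn0 rfl hw0 (by omega) hf1 hf2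
    (fun i => (h1 i).trans (hseen i))).mono le_rfl ?_) le_rfl
  rintro τ' ⟨hW', hh, L, hQ, hleft⟩
  refine .seq _ 2 ((run_explore hL hW' hn0 rfl hf1 hf2 hh hQ hleft).mono le_rfl ?_) le_rfl
  rintro τ'' h
  refine .assign ?_ (by decide)
  rcases h with ⟨h, h'⟩ | ⟨h, h'⟩
  · simp [h, h']
  · simp [h, h']

end

/-! ### Final time bound and correctness of the whole program -/

section
variable {m : ℕ} {v : Fin m → ℤ}

theorem input_v {l : ℕ} (hl : l < m) : (input v).arr .v l = v ⟨l, hl⟩ := by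
  simp [input, hl]

theorem sum_toNat_le {n lo : ℕ} (h : lo + n ≤ m) :
    ∑ i ∈ Finset.range n, ((input v).arr .v ((lo + i : ℕ) : ℤ)).toNat ≤ ∑ i, (v i).toNat := by
  have h1 : ∑ i, (v i).toNat = ∑ i ∈ Finset.range m, ((input v).arr .v (i : ℤ)).toNat := by
    rw [Finset.sum_range]
    exact Finset.sum_congr rfl fun i _ => by rw [input_v i.2]
  rw [h1]
  obtain ⟨r, rfl⟩ := Nat.exists_eq_add_of_le h
  rw [Finset.sum_range_add, Finset.sum_range_add]
  omega

/-- The power mean inequality `(a + b) ^ 5 ≤ 2 ^ 4 * (a ^ 5 + b ^ 5)` separates the contribution of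
the triangle, `m * (m ^ 2) ^ 5`, from that of the entries. -/
theorem cost_le {n s V k : ℕ} (hn : 0 < n) (hnm : n ≤ m) (hs : s ≤ V) (hk : k ≤ n ^ 2 + 2 * s) :
    4000 * ((n + 1) * (k + 1) ^ 5) ≤ 200000000 * (m ^ 11 + m * V ^ 5) := by
  have h1 : k + 1 ≤ 2 * (m ^ 2 + 2 * V) := by
    have : n ^ 2 ≤ m ^ 2 := Nat.pow_le_pow_left hnm 2
    have : 1 ≤ n ^ 2 := Nat.one_le_pow _ _ hn
    omega
  have h2 : (m ^ 2 + 2 * V) ^ 5 ≤ 2 ^ (5 - 1) * ((m ^ 2) ^ 5 + (2 * V) ^ 5) :=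
    add_pow_le (Nat.zero_le _) (Nat.zero_le _) 5
  calc 4000 * ((n + 1) * (k + 1) ^ 5) ≤ 4000 * ((2 * m) * (2 * (m ^ 2 + 2 * V)) ^ 5) := by
        gcongr; omega
    _ = 256000 * m * (m ^ 2 + 2 * V) ^ 5 := by ring
    _ ≤ 256000 * m * (2 ^ (5 - 1) * ((m ^ 2) ^ 5 + (2 * V) ^ 5)) := by gcongr
    _ = 4096000 * m ^ 11 + 131072000 * (m * V ^ 5) := by ring
    _ ≤ _ := by omega

/-- The scans before the search cost `O(m)`, which is absorbed by `m ^ 11`. -/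
theorem run_DAGTomo1 (hm : 0 < m) :
    Run DAGTomo1 (input v) (200001000 * (m ^ 11 + m * (∑ i, (v i).toNat) ^ 5)) fun τ =>
      (DTC v → τ.reg .out = 1) ∧ (¬ DTC v → τ.reg .out = 0) := by
  set V := ∑ i, (v i).toNat with hV
  have hT : 1000 * m + 200000000 * (m ^ 11 + m * V ^ 5) ≤
      200001000 * (m ^ 11 + m * V ^ 5) := by
    have : m ^ 1 ≤ m ^ 11 := Nat.pow_le_pow_right hm (by omega)
    rw [pow_one] at this
    omega
  refine Run.mono ?_ hT fun _ h => h
  set C := 200000000 * (m ^ 11 + m * V ^ 5) with hC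
  refine .seq 2 _ (.assign ?_ (by decide)) (Nat.add_sub_of_le (by omega)).le
  refine .seq 2 (1000 * m + C - 4) (.assign ?_ (by decide)) (by omega)
  refine .seq (100 * m) (800 * m + C) (Run.mono (T := 100 * m) (Q := fun τ =>
    τ.arr = (input v).arr ∧ τ.reg .m = m ∧ ((τ.reg .bad = 1 ∧ ∃ i, v i < 0) ∨
      (τ.reg .bad = 0 ∧ ∀ i, 0 ≤ v i))) ?_ le_rfl ?_) (by omega)
  · refine .loop 20 m (fun j τ => τ.arr = (input v).arr ∧ τ.reg .m = m ∧ ∃ i : ℕ, τ.reg .i = i ∧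
      i + j = m ∧ ((τ.reg .bad = 1 ∧ ∃ i, v i < 0) ∨
        (τ.reg .bad = 0 ∧ ∀ l : Fin m, (l : ℕ) < i → 0 ≤ v l))) ?_ ?_ ?_ ?_
    · exact ⟨rfl, by simp [input], 0, by simp, by simp, Or.inr ⟨by simp, by simp⟩⟩
    · rintro j τ ⟨h1, h2, i, h3, h4, h5⟩ hb
      simp only [eval_lt, eval_reg, h2, h3, Nat.cast_lt] at hb
      have hvi : (AExpr.read .v (g .i) : E).eval τ = v ⟨i, hb⟩ := by
        rw [eval_read, eval_reg, h3, h1, input_v hb]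
      refine ⟨by omega, .seq 15 5 (.ite 2 (fun h => .assign (.assign ⟨h1, by simp [h2], i + 1,
        by simp [h3], by omega, Or.inl ⟨by simp, ⟨i, hb⟩, ?_⟩⟩ (by decide)) (by decide))
        (fun h => .skip (.assign ⟨h1, by simp [h2], i + 1, by simp [h3], by omega, ?_⟩
          (by decide)) (by decide)) (by decide)) (by omega)⟩
      · simpa [hvi] using h
      · rw [eval_lt, hvi, eval_zero, not_lt] at h
        refine h5.imp (fun h => ⟨by simpa using h.1, h.2⟩) fun h5 => ⟨by simpa using h5.1,
          fun l hl => ?_⟩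
        rcases (by omega : (l : ℕ) < i ∨ (l : ℕ) = i) with h6 | h6
        · exact h5.2 l h6
        · obtain rfl : l = ⟨i, hb⟩ := Fin.ext h6
          exact h
    · rintro j τ ⟨h1, h2, i, h3, h4, h5⟩ hb
      simp only [eval_lt, eval_reg, h2, h3, Nat.cast_lt] at hb
      exact ⟨h1, h2, h5.imp_right fun h => ⟨h.1, fun l => h.2 l (by omega)⟩⟩
    · rw [show (BExpr.lt (g .i) (g .m)).cost = 3 by decide]
      omega
  rintro τ ⟨h1, h2, h3⟩
  refine .ite (700 * m + C) (fun h => .assign ?_ (Nat.le_add_right_of_le (by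
    rw [show (0 : E).cost = 1 by decide]; omega))) (fun h => ?_)
    (by rw [show (BExpr.eq (g .bad) 1).cost = 3 by decide]; omega)
  · rcases h3 with ⟨-, i, hi⟩ | h3
    · exact ⟨fun h => absurd (h.nonneg i) (by omega), fun _ => by simp⟩
    · simp [h3.1] at h
  have hnonneg : ∀ i, 0 ≤ v i := by
    rcases h3 with h3 | h3
    · simp [h3.1] at h
    · exact h3.2
  clear h h3
  refine .seq 2 (700 * m + C - 2) (.assign ?_ (by decide)) (by omega)
  refine .seq (100 * m) (500 * m + C) (Run.mono (T := 100 * m) (Q := fun τ =>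
    τ.arr = (input v).arr ∧ τ.reg .m = m ∧ ∃ lo : ℕ, τ.reg .lo = lo ∧ lo ≤ m ∧
      (∀ i : Fin m, (i : ℕ) < lo → v i = 0) ∧ ∀ h : lo < m, v ⟨lo, h⟩ ≠ 0) ?_ le_rfl ?_) (by omega)
  · have hW : ∀ τ : Mem Reg Arr, τ.arr = (input v).arr → ∀ (lo : ℕ), τ.reg .lo = lo →
        ∀ h : lo < m, (W 0).eval τ = v ⟨lo, h⟩ := by
      intro τ a lo b h
      simp [a, b, input_v h]
    refine .loop 20 m (fun j τ => τ.arr = (input v).arr ∧ τ.reg .m = m ∧ ∃ lo : ℕ,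
      τ.reg .lo = lo ∧ lo + j = m ∧ ∀ i : Fin m, (i : ℕ) < lo → v i = 0) ?_ ?_ ?_ ?_
    · exact ⟨h1, by simp [h2], 0, by simp, by simp, by simp⟩
    · rintro j τ ⟨h1, h2, lo, h3, h4, h5⟩ ⟨hb, hb'⟩
      simp only [eval_lt, eval_reg, h2, h3, Nat.cast_lt] at hb
      rw [eval_eq, hW τ h1 lo h3 hb, eval_zero] at hb'
      refine ⟨by omega, .assign ⟨h1, by simp [h2], lo + 1, by simp [h3], by omega, fun l hl => ?_⟩
        (by decide)⟩
      rcases (by omega : (l : ℕ) < lo ∨ (l : ℕ) = lo) with h6 | h6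
      · exact h5 l h6
      · obtain rfl : l = ⟨lo, hb⟩ := Fin.ext h6
        exact hb'
    · rintro j τ ⟨h1, h2, lo, h3, h4, h5⟩ hb
      refine ⟨h1, h2, lo, h3, by omega, h5, fun h h' => hb ⟨?_, ?_⟩⟩
      · simpa [h2, h3] using h
      · rw [eval_eq, hW τ h1 lo h3 h, h', eval_zero]
    · rw [show (BExpr.and (.lt (g .lo) (g .m)) (.eq (W 0) 0)).cost = 10 by decide]
      omega
  clear h1 h2 τ
  rintro τ ⟨h1, h2, lo, h3, h4, h5, h6⟩
  refine .ite (400 * m + C) (fun h => .assign ?_ (Nat.le_add_right_of_le (by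
    rw [show (1 : E).cost = 1 by decide]; omega))) (fun h => ?_)
    (by rw [show (BExpr.eq (g .lo) (g .m)).cost = 3 by decide]; omega)
  · simp only [eval_eq, eval_reg, h2, h3, Nat.cast_inj] at h
    exact ⟨fun _ => by simp, fun h' => absurd (dtc_of_zero fun i => h5 i (by omega)) h'⟩
  simp only [eval_eq, eval_reg, h2, h3, Nat.cast_inj] at h
  have hlo : lo < m := by omega
  replace h6 := h6 hlo
  refine .seq 5 (400 * m + C - 5) (.assign ?_ (by decide)) (by omega)
  refine .seq (100 * m) (200 * m + C) (Run.mono (T := 100 * m) (Q := fun τ =>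
    τ.arr = (input v).arr ∧ τ.reg .lo = lo ∧ ∃ n : ℕ, ∃ hn : lo + n ≤ m, τ.reg .n = n ∧
      ∃ hn0 : 0 < n, (∀ i : Fin m, lo + n ≤ i → v i = 0) ∧ v ⟨lo + (n - 1), by omega⟩ ≠ 0)
      ?_ le_rfl ?_) (by omega)
  · have hW : ∀ τ : Mem Reg Arr, τ.arr = (input v).arr → τ.reg .lo = lo → ∀ (n : ℕ), 0 < n →
        τ.reg .n = n → ∀ h : lo + (n - 1) < m, (W (g .n - 1)).eval τ = v ⟨lo + (n - 1), h⟩ := by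
      intro τ a b n hn c h
      rw [← input_v (v := v) h, eval_read, eval_add, eval_sub, eval_reg, eval_reg, a, b, c, eval_one]
      congr 1
      omega
    -- The scan from the right needs no bound test: it stops at the latest at `n = 1`, because the
    -- entry in column `lo` is nonzero.
    refine .loop 20 (m - lo - 1) (fun j τ => τ.arr = (input v).arr ∧ τ.reg .lo = lo ∧ ∃ n : ℕ,
      lo + n ≤ m ∧ τ.reg .n = n ∧ n = j + 1 ∧ ∀ i : Fin m, lo + n ≤ i → v i = 0) ?_ ?_ ?_ ?_
    · refine ⟨h1, by simp [h3], m - lo, by omega, ?_, by omega, fun i hi => by omega⟩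
      simp [h2, h3]
      omega
    · rintro j τ ⟨h1, h3, n, h7, h8, h9, h10⟩ hb
      rw [eval_eq, hW τ h1 h3 n (by omega) h8 (by omega), eval_zero] at hb
      have hj : 0 < j := by
        rcases Nat.eq_zero_or_pos j with rfl | hj
        · subst h9
          exact absurd hb h6
        · exact hj
      refine ⟨hj, .assign ⟨h1, by simp [h3], n - 1, by omega, ?_, by omega, fun l hl => ?_⟩
        (by decide)⟩
      · simp [h8]; omega
      · rcases (by omega : lo + n ≤ l ∨ (l : ℕ) = lo + (n - 1)) with h11 | h11
        · exact h10 l h11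
        · rw [show l = ⟨lo + (n - 1), by omega⟩ from Fin.ext h11]
          exact hb
    · rintro j τ ⟨h1, h3, n, h7, h8, h9, h10⟩ hb
      refine ⟨h1, h3, n, h7, h8, by omega, h10, fun h => hb ?_⟩
      rw [eval_eq, hW τ h1 h3 n (by omega) h8 (by omega), h, eval_zero]
    · rw [show (BExpr.eq (W (g .n - 1)) 0).cost = 8 by decide]
      have : m - lo - 1 + 1 ≤ m := by omega
      nlinarith
  rintro τ ⟨h1, h2, n, hn, h3, hn0, h7, h8⟩
  have htrim := dtc_trim hn h5 h7
  refine .ite (100 * m + C) (fun h => .assign ?_ (Nat.le_add_right_of_le (by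
    rw [show (1 : E).cost = 1 by decide]; omega))) (fun h => ?_)
    (by rw [show (BExpr.eq (g .n) 1).cost = 3 by decide]; omega)
  · obtain rfl : n = 1 := by simpa [h3] using h
    exact ⟨fun _ => by simp, fun h' => absurd (htrim.2 (dtc_of_one (hnonneg _))) h'⟩
  have hn2 : 2 ≤ n := by
    have : n ≠ 1 := by simpa [h3] using h
    omega
  rw [htrim, dtc_iff_hasPath hn2 (hl := hn0) (hr := Nat.sub_lt hn0 one_pos) h6 h8]
  have hlt : ∀ j : Fin n, lo + (j : ℕ) < m := fun j => by have := j.2; omega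
  have hread : ∀ j : Fin n, τ.arr .v (τ.reg .lo + (j : ℕ)) = v ⟨lo + j, by omega⟩ := by
    intro j
    rw [← input_v (v := v) (hlt j), h1, h2, Nat.cast_add]
  -- The sizes are read in the input array, which is defined everywhere, so that `u` is a total
  -- function of the column.
  refine (run_search (u := fun i => ((input v).arr .v ((lo + i : ℕ) : ℤ)).toNat) h3 ?_ hread hn0
    ?_ ?_).mono ?_ fun _ h => h
  · intro i
    have h9 := hnonneg ⟨lo + i, hlt i⟩
    rw [input_v (hlt i)]
    exact Int.toNat_of_nonneg h9
  · exact lt_of_le_of_ne (hnonneg _) (Ne.symm h6)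
  · intro i
    rw [h1]
    simp [input]
  · exact (cost_le (V := V) hn0 (show n ≤ m by omega) (sum_toNat_le (v := v) hn)
      (regionSize_le _ _)).trans
      (by omega)

end

end XRay

theorem theorem1 :
    -- DAGTomo1 decides the problem, in time `O(m ^ 11 + m * (∑ v i) ^ 5)`
    (∃ C : ℕ, ∀ (m : ℕ) (v : Fin m → ℤ), 0 < m →
      ∃ (t : ℕ) (τ : XRay.Mem XRay.Reg XRay.Arr),
        XRay.Exec XRay.DAGTomo1 (XRay.input v) t τ ∧
        (XRay.DTC v → τ.reg XRay.Reg.out = 1) ∧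
        (¬ XRay.DTC v → τ.reg XRay.Reg.out = 0) ∧
        t ≤ C * (m ^ 11 + m * (∑ i, (v i).toNat) ^ 5)) ∧
    -- the reduction to a path in the graph of quads
    (∀ (m : ℕ) (v : Fin m → ℤ) (hm : 2 ≤ m),
      v ⟨0, by omega⟩ ≠ 0 → v ⟨m - 1, by omega⟩ ≠ 0 →
      (XRay.DTC v ↔ XRay.HasPath v)) := by
  refine ⟨⟨200001000, fun m v hm => ?_⟩, fun m v hm h0 h1 => XRay.dtc_iff_hasPath hm h0 h1⟩
  obtain ⟨t, τ, h1, h2, h3, h4⟩ := XRay.run_DAGTomo1 (v := v) hm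
  exact ⟨t, τ, h1, h3, h4, h2⟩
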